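/- A Lie-Hermitian manifold $(G,J,g)$ of complex dimension $n$ is a Lie group $G$ of real dimension $2n$ with a left invariant (integrable) complex structure $J$ and a left invariant Riemannian metric $g=\langle\,,\rangle$ compatible with $J$. Its Strominger (Bismut) connection $\nabla^s$ is the unique connection with $\nabla^s g=0$, $\nabla^s J=0$ and totally skew-symmetric torsion. Write $R(X,Y,Z,W)=\langle \nabla^s_X\nabla^s_YZ-\nabla^s_Y\nabla^s_XZ-\nabla^s_{[X,Y]}Z,\,W\rangle$. The manifold is Strominger Kähler-like if $R$ has the symmetries of the curvature of a Kähler metric: for all tangent vectors, $$R(X,Y,Z,W)+R(Y,Z,X,W)+R(Z,X,Y,W)=0,\qquad R(X,Y,JZ,JW)=R(X,Y,Z,W).$$ (As $\nabla^sJ=0$, this is the same as $R(X,Y,Z,W)=R(Z,Y,X,W)$ for all $X,Z$ of type $(1,0)$ and all complex tangent vectors $Y,W$.) A unitary coframe is the dual coframe $\varphi=(\varphi_1,\dots,\varphi_n)$ of a frame $e_1,\dots,e_n$ of type $(1,0)$ with $\langle e_i,\overline{e}_j\rangle=\delta_{ij}$; write $\varphi_i\overline\varphi_i$ for $\varphi_i\wedge\overline{\varphi}_i$,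 and $i=\sqrt{-1}$ in coefficients. **Corollary.** Let $(G,J,g)$ be a nilpotent Lie-Hermitian manifold of complex dimension $n$, $2\le n\le 6$ (the Lie algebra of $G$ is nilpotent). It is Strominger Kähler-like if and only if it admits a left invariant unitary coframe $\varphi$ such that 1. when $n=2$: $d\varphi_1=0$, $d\varphi_2=\lambda\,\varphi_1\overline\varphi_1$; 2. when $n=3$: $d\varphi_1=d\varphi_2=0$, $d\varphi_3=\lambda\,\varphi_1\overline\varphi_1+ia\,\varphi_2\overline\varphi_2$; 3. when $n=4$: either $d\varphi_1=d\varphi_2=d\varphi_3=0$, $d\varphi_4=\lambda\,\varphi_1\overline\varphi_1+ia\,\varphi_2\overline\varphi_2$; or $d\varphi_1=d\varphi_2=0$, $d\varphi_3=\lambda_1\,\varphi_1\overline\varphi_1+ia\,\varphi_2\overline\varphi_2$, $d\varphi_4=\lambda_2\,\varphi_2\overline\varphi_2$; 4. when $n=5$: either $d\varphi_1=\dots=d\varphi_4=0$, $d\varphi_5=\lambda\,\varphi_1\overline\varphi_1+ia\,\varphi_2\overline\varphi_2$; or $d\varphi_1=d\varphi_2=d\varphi_3=0$, $d\varphi_4=\lambda_1\,\varphi_1\overline\varphi_1+ia\,\varphi_2\overline\varphi_2+ib\,\varphi_3\overline\varphi_3$,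 $d\varphi_5=\lambda_2\,\varphi_2\overline\varphi_2+\bigl(ic-\tfrac{ab}{\lambda_2}\bigr)\varphi_3\overline\varphi_3$; 5. when $n=6$: either $d\varphi_1=\dots=d\varphi_5=0$, $d\varphi_6=\lambda\,\varphi_1\overline\varphi_1+ia\,\varphi_2\overline\varphi_2$; or $d\varphi_1=\dots=d\varphi_4=0$, $$d\varphi_5=\lambda_1\varphi_1\overline\varphi_1+ia\,\varphi_2\overline\varphi_2+ib\,\varphi_3\overline\varphi_3+ic\,\varphi_4\overline\varphi_4,$$ $$d\varphi_6=\lambda_2\varphi_2\overline\varphi_2+\bigl(ix-\tfrac{ab}{\lambda_2}\bigr)\varphi_3\overline\varphi_3+\bigl(iy-\tfrac{ac}{\lambda_2}\bigr)\varphi_4\overline\varphi_4,$$ where $bc+xy+\tfrac{ab}{\lambda_2}\cdot\tfrac{ac}{\lambda_2}=0$; or $d\varphi_1=d\varphi_2=d\varphi_3=0$, $$d\varphi_4=\lambda_1\varphi_1\overline\varphi_1+ia\,\varphi_2\overline\varphi_2+ib\,\varphi_3\overline\varphi_3,\quad d\varphi_5=\lambda_2\varphi_2\overline\varphi_2+\bigl(ic-\tfrac{ab}{\lambda_2}\bigr)\varphi_3\overline\varphi_3,\quad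 d\varphi_6=\lambda_3\varphi_3\overline\varphi_3.$$ Here $a,b,c,x,y,\lambda,\lambda_1,\lambda_2,\lambda_3$ are real constants with $\lambda\ge 0$ and $\lambda_1,\lambda_2,\lambda_3>0$. -/

import Mathlib

open Bundle
open scoped Manifold ContDiff ComplexConjugate

/-- The Lie bracket on the Lie algebra of a smooth Lie group needs only `C^3` regularity, written
`minSmoothness ℝ 3` in the library; a smooth Lie group has it. -/
instance lieGroup_minSmoothness_three {E : Type*} [NormedAddCommGroup E] [NormedSpace ℝ E]
    {H : Type*} [TopologicalSpace H] {I : ModelWithCorners ℝ E H}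
    {G : Type*} [TopologicalSpace G] [ChartedSpace H G] [Group G] [h : LieGroup I ∞ G] :
    LieGroup I (minSmoothness ℝ 3) G :=
  h.of_le (by rw [minSmoothness_of_isRCLikeNormedField]; exact ENat.LEInfty.out)

noncomputable section

/-! ### Vector fields, Hermitian structures and connections on a manifold modelled on `E` -/

/-- A (not necessarily smooth) vector field on `M`. -/
abbrev VField (E : Type*) [NormedAddCommGroup E] [NormedSpace ℝ E]
    (M : Type*) [TopologicalSpace M] [ChartedSpace E M] : Type _ :=
  (p : M) → TangentSpace 𝓘(ℝ, E) p

/-- `X` is a smooth vector field. -/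
def IsSmoothField {E : Type*} [NormedAddCommGroup E] [NormedSpace ℝ E]
    {M : Type*} [TopologicalSpace M] [ChartedSpace E M] [IsManifold 𝓘(ℝ, E) ∞ M]
    (X : VField E M) : Prop :=
  ContMDiff 𝓘(ℝ, E) 𝓘(ℝ, E).tangent ∞ (fun p => (⟨p, X p⟩ : TangentBundle 𝓘(ℝ, E) M))

/-- A Hermitian structure `(J, g)` on the smooth manifold `M`: a complex structure `J`, i.e. a
smooth field of endomorphisms of the tangent spaces with `J² = -1` and vanishing Nijenhuis tensor,
and a smooth Riemannian metric `g` compatible with `J`. -/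
structure HermitianStructure (E : Type*) [NormedAddCommGroup E] [NormedSpace ℝ E]
    (M : Type*) [TopologicalSpace M] [ChartedSpace E M] [IsManifold 𝓘(ℝ, E) ∞ M] where
  /-- the complex structure -/
  J : (p : M) → TangentSpace 𝓘(ℝ, E) p →L[ℝ] TangentSpace 𝓘(ℝ, E) p
  J_sq : ∀ (p : M) (v : TangentSpace 𝓘(ℝ, E) p), J p (J p v) = -v
  J_smooth : ∀ X : VField E M, IsSmoothField X → IsSmoothField (fun p => J p (X p))
  /-- `[JX, JY] - [X, Y] - J [JX, Y] - J [X, JY] = 0` -/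
  J_integrable : ∀ X Y : VField E M, IsSmoothField X → IsSmoothField Y → ∀ p : M,
    VectorField.mlieBracket 𝓘(ℝ, E) (fun q => J q (X q)) (fun q => J q (Y q)) p
      - VectorField.mlieBracket 𝓘(ℝ, E) X Y p
      - J p (VectorField.mlieBracket 𝓘(ℝ, E) (fun q => J q (X q)) Y p)
      - J p (VectorField.mlieBracket 𝓘(ℝ, E) X (fun q => J q (Y q)) p) = 0
  /-- the Riemannian metric -/
  g : ContMDiffRiemannianMetric 𝓘(ℝ, E) ∞ E (fun p : M => TangentSpace 𝓘(ℝ, E) p)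
  compatible : ∀ (p : M) (v w : TangentSpace 𝓘(ℝ, E) p), g.inner p (J p v) (J p w) = g.inner p v w

/-- An affine connection on `M`, i.e. a connection on the tangent bundle of `M`. -/
abbrev AffineConnection (E : Type*) [NormedAddCommGroup E] [NormedSpace ℝ E]
    (M : Type*) [TopologicalSpace M] [ChartedSpace E M] [IsManifold 𝓘(ℝ, E) ∞ M] : Type _ :=
  CovariantDerivative 𝓘(ℝ, E) E (fun p : M => TangentSpace 𝓘(ℝ, E) p)

namespace AffineConnection

/-- `D_X Y`. -/
def cov {E : Type*} [NormedAddCommGroup E] [NormedSpace ℝ E]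
    {M : Type*} [TopologicalSpace M] [ChartedSpace E M] [IsManifold 𝓘(ℝ, E) ∞ M]
    (D : AffineConnection E M) (X Y : VField E M) : VField E M :=
  fun p => D.toFun Y p (X p)

/-- The torsion `T(X, Y) = D_X Y - D_Y X - [X, Y]`. -/
def tor {E : Type*} [NormedAddCommGroup E] [NormedSpace ℝ E]
    {M : Type*} [TopologicalSpace M] [ChartedSpace E M] [IsManifold 𝓘(ℝ, E) ∞ M]
    (D : AffineConnection E M) (X Y : VField E M) : VField E M :=
  fun p => cov D X Y p - cov D Y X p - VectorField.mlieBracket 𝓘(ℝ, E) X Y p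

/-- The curvature `R(X, Y) Z = D_X D_Y Z - D_Y D_X Z - D_{[X, Y]} Z`. -/
def curv {E : Type*} [NormedAddCommGroup E] [NormedSpace ℝ E]
    {M : Type*} [TopologicalSpace M] [ChartedSpace E M] [IsManifold 𝓘(ℝ, E) ∞ M]
    (D : AffineConnection E M) (X Y Z : VField E M) : VField E M :=
  fun p => cov D X (cov D Y Z) p - cov D Y (cov D X Z) p
    - cov D (VectorField.mlieBracket 𝓘(ℝ, E) X Y) Z p

end AffineConnection

namespace HermitianStructure

/-- `D` is a Strominger (Bismut) connection of `(M, J, g)`: it is smooth, `D g = 0`, `D J = 0`,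
and its torsion is totally skew-symmetric. (There is exactly one such connection.) -/
structure IsStrominger {E : Type*} [NormedAddCommGroup E] [NormedSpace ℝ E]
    {M : Type*} [TopologicalSpace M] [ChartedSpace E M] [IsManifold 𝓘(ℝ, E) ∞ M]
    (S : HermitianStructure E M) (D : AffineConnection E M) : Prop where
  smooth : CovariantDerivative.ContMDiffCovariantDerivative D ∞
  metric : ∀ X Y Z : VField E M, IsSmoothField X → IsSmoothField Y → IsSmoothField Z →
    ∀ p : M, mvfderiv 𝓘(ℝ, E) (fun q => S.g.inner q (Y q) (Z q)) p (X p)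
      = S.g.inner p (D.cov X Y p) (Z p) + S.g.inner p (Y p) (D.cov X Z p)
  parallel_J : ∀ X Y : VField E M, IsSmoothField X → IsSmoothField Y →
    ∀ p : M, D.cov X (fun q => S.J q (Y q)) p = S.J p (D.cov X Y p)
  /-- The torsion `T(X, Y)` is skew in `X, Y` by its definition, so skewness of `g(T(X, Y), Z)`
  in `Y, Z` makes it skew in all three arguments. -/
  skew_torsion : ∀ X Y Z : VField E M, IsSmoothField X → IsSmoothField Y → IsSmoothField Z →
    ∀ p : M, S.g.inner p (D.tor X Y p) (Z p) = - S.g.inner p (D.tor X Z p) (Y p)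

/-- The curvature as a function of four vector fields, `R(X, Y, Z, W) = g(R(X, Y) Z, W)`. -/
def curv {E : Type*} [NormedAddCommGroup E] [NormedSpace ℝ E]
    {M : Type*} [TopologicalSpace M] [ChartedSpace E M] [IsManifold 𝓘(ℝ, E) ∞ M]
    (S : HermitianStructure E M) (D : AffineConnection E M) (X Y Z W : VField E M) (p : M) : ℝ :=
  S.g.inner p (D.curv X Y Z p) (W p)

/-- The metric connection `D` is Kähler-like: its curvature has the symmetries of the curvature of
a Kähler metric, namely the first Bianchi identity
`R(X, Y, Z, W) + R(Y, Z, X, W) + R(Z, X, Y, W) = 0` and `R(X, Y, JZ, JW) = R(X, Y, Z, W)`.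
For a Hermitian connection (`D g = 0`, `D J = 0`) the second condition is automatic, and the first
one says precisely that the complex-multilinear extension of `R` satisfies
`R(X, Y, Z, W) = R(Z, Y, X, W)` for `X, Z` of type `(1,0)` and arbitrary `Y, W`. -/
def IsKahlerLike {E : Type*} [NormedAddCommGroup E] [NormedSpace ℝ E]
    {M : Type*} [TopologicalSpace M] [ChartedSpace E M] [IsManifold 𝓘(ℝ, E) ∞ M]
    (S : HermitianStructure E M) (D : AffineConnection E M) : Prop :=
  ∀ X Y Z W : VField E M,
    IsSmoothField X → IsSmoothField Y → IsSmoothField Z → IsSmoothField W → ∀ p : M,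
      S.curv D X Y Z W p + S.curv D Y Z X W p + S.curv D Z X Y W p = 0 ∧
      S.curv D X Y (fun q => S.J q (Z q)) (fun q => S.J q (W q)) p = S.curv D X Y Z W p

/-- `(M, J, g)` is Strominger Kähler-like: its Strominger connection is Kähler-like. -/
def IsStromingerKahlerLike {E : Type*} [NormedAddCommGroup E] [NormedSpace ℝ E]
    {M : Type*} [TopologicalSpace M] [ChartedSpace E M] [IsManifold 𝓘(ℝ, E) ∞ M]
    (S : HermitianStructure E M) : Prop :=
  ∃ D : AffineConnection E M, S.IsStrominger D ∧ S.IsKahlerLike D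

end HermitianStructure

/-! ### Complex-valued forms -/

/-- A complex-valued `1`-form on `M`. -/
abbrev COneForm (E : Type*) [NormedAddCommGroup E] [NormedSpace ℝ E]
    (M : Type*) [TopologicalSpace M] [ChartedSpace E M] : Type _ :=
  (p : M) → TangentSpace 𝓘(ℝ, E) p →L[ℝ] ℂ

namespace COneForm

/-- The exterior derivative, `dφ(X, Y) = X(φ(Y)) - Y(φ(X)) - φ([X, Y])`. -/
def extDer {E : Type*} [NormedAddCommGroup E] [NormedSpace ℝ E]
    {M : Type*} [TopologicalSpace M] [ChartedSpace E M]
    (φ : COneForm E M) (X Y : VField E M) (p : M) : ℂ :=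
  mvfderiv 𝓘(ℝ, E) (fun q => φ q (Y q)) p (X p) - mvfderiv 𝓘(ℝ, E) (fun q => φ q (X q)) p (Y p)
    - φ p (VectorField.mlieBracket 𝓘(ℝ, E) X Y p)

/-- The `2`-form `φ ∧ φ̄`, `(φ ∧ φ̄)(X, Y) = φ(X) φ̄(Y) - φ(Y) φ̄(X)`. -/
def wedgeConj {E : Type*} [NormedAddCommGroup E] [NormedSpace ℝ E]
    {M : Type*} [TopologicalSpace M] [ChartedSpace E M]
    (φ : COneForm E M) (X Y : VField E M) (p : M) : ℂ :=
  φ p (X p) * conj (φ p (Y p)) - φ p (Y p) * conj (φ p (X p))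

/-- The structure equations `dφ_k = ∑ i, A k i • φ_i ∧ φ̄_i`, for all `k`. -/
def StructureEquations {E : Type*} [NormedAddCommGroup E] [NormedSpace ℝ E]
    {M : Type*} [TopologicalSpace M] [ChartedSpace E M] [IsManifold 𝓘(ℝ, E) ∞ M] {n : ℕ}
    (φ : Fin n → COneForm E M) (A : Matrix (Fin n) (Fin n) ℂ) : Prop :=
  ∀ k : Fin n, ∀ X Y : VField E M, IsSmoothField X → IsSmoothField Y → ∀ p : M,
    (φ k).extDer X Y p = ∑ i, A k i * (φ i).wedgeConj X Y p

end COneForm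

/-! ### Lie-Hermitian manifolds -/

/-- A Lie-Hermitian manifold `(G, J, g)`: a Hermitian structure on the Lie group `G` for which
`J` and `g` are left invariant. -/
structure LieHermitian (E : Type*) [NormedAddCommGroup E] [NormedSpace ℝ E]
    (G : Type*) [TopologicalSpace G] [ChartedSpace E G] [Group G] [LieGroup 𝓘(ℝ, E) ∞ G]
    extends HermitianStructure E G where
  J_left : ∀ (a p : G) (v : TangentSpace 𝓘(ℝ, E) p),
    J (a * p) (mfderiv 𝓘(ℝ, E) 𝓘(ℝ, E) (fun x : G => a * x) p v)
      = mfderiv 𝓘(ℝ, E) 𝓘(ℝ, E) (fun x : G => a * x) p (J p v)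
  g_left : ∀ (a p : G) (v w : TangentSpace 𝓘(ℝ, E) p),
    g.inner (a * p) (mfderiv 𝓘(ℝ, E) 𝓘(ℝ, E) (fun x : G => a * x) p v)
      (mfderiv 𝓘(ℝ, E) 𝓘(ℝ, E) (fun x : G => a * x) p w) = g.inner p v w

namespace LieHermitian

/-- `φ_1, …, φ_n` is a left invariant unitary coframe of `(G, J, g)`, where `n` is meant to be the
complex dimension of `G`: the `φ_i` are left invariant complex `1`-forms of type `(1,0)` with
`g = ∑ i, (φ_i ⊗ φ̄_i + φ̄_i ⊗ φ_i)`. The last condition says that `φ` is dual to a frame `e` of type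
`(1,0)` with `g(e_i, ē_j) = δ_ij` for the complex-bilinear extension of `g`, equivalently to
`e_i = (ε_i - √-1 Jε_i) / √2` for an orthonormal frame `ε_1, …, ε_n, Jε_1, …, Jε_n`. -/
structure IsLeftInvariantUnitaryCoframe {E : Type*} [NormedAddCommGroup E] [NormedSpace ℝ E]
    {G : Type*} [TopologicalSpace G] [ChartedSpace E G] [Group G] [LieGroup 𝓘(ℝ, E) ∞ G]
    (S : LieHermitian E G) {n : ℕ} (φ : Fin n → COneForm E G) : Prop where
  left_invariant : ∀ (i : Fin n) (a p : G) (v : TangentSpace 𝓘(ℝ, E) p),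
    φ i (a * p) (mfderiv 𝓘(ℝ, E) 𝓘(ℝ, E) (fun x : G => a * x) p v) = φ i p v
  type_one_zero : ∀ (i : Fin n) (p : G) (v : TangentSpace 𝓘(ℝ, E) p),
    φ i p (S.J p v) = Complex.I * φ i p v
  unitary : ∀ (p : G) (v w : TangentSpace 𝓘(ℝ, E) p),
    ((S.g.inner p v w : ℝ) : ℂ)
      = ∑ i, (φ i p v * conj (φ i p w) + conj (φ i p v) * φ i p w)

end LieHermitian

/-! ### The normal forms -/

open Complex in
/-- The list of normal forms in complex dimension `n = 2, …, 6`. `IsNormalForm n A` says that the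
equations `dφ_k = ∑ i, A k i • φ_i ∧ φ̄_i` (`k = 1, …, n`) belong to the list. All parameters
`a b c x y l l₁ l₂ l₃` are real. -/
def IsNormalForm : (n : ℕ) → Matrix (Fin n) (Fin n) ℂ → Prop
  | 2, A => ∃ l : ℝ, 0 ≤ l ∧
      A = !![0,       0;
             (l : ℂ), 0]
  | 3, A => ∃ l a : ℝ, 0 ≤ l ∧
      A = !![0,       0,     0;
             0,       0,     0;
             (l : ℂ), I * a, 0]
  | 4, A =>
      (∃ l a : ℝ, 0 ≤ l ∧
        A = !![0,       0,     0, 0;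
               0,       0,     0, 0;
               0,       0,     0, 0;
               (l : ℂ), I * a, 0, 0]) ∨
      (∃ l₁ l₂ a : ℝ, 0 < l₁ ∧ 0 < l₂ ∧
        A = !![0,        0,     0, 0;
               0,        0,     0, 0;
               (l₁ : ℂ), I * a, 0, 0;
               0,        l₂,    0, 0])
  | 5, A =>
      (∃ l a : ℝ, 0 ≤ l ∧
        A = !![0,       0,     0, 0, 0;
               0,       0,     0, 0, 0;
               0,       0,     0, 0, 0;
               0,       0,     0, 0, 0;
               (l : ℂ), I * a, 0, 0, 0]) ∨
      (∃ l₁ l₂ a b c : ℝ, 0 < l₁ ∧ 0 < l₂ ∧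
        A = !![0,        0,     0,                  0, 0;
               0,        0,     0,                  0, 0;
               0,        0,     0,                  0, 0;
               (l₁ : ℂ), I * a, I * b,              0, 0;
               0,        l₂,    I * c - a * b / l₂, 0, 0])
  | 6, A =>
      (∃ l a : ℝ, 0 ≤ l ∧
        A = !![0,       0,     0, 0, 0, 0;
               0,       0,     0, 0, 0, 0;
               0,       0,     0, 0, 0, 0;
               0,       0,     0, 0, 0, 0;
               0,       0,     0, 0, 0, 0;
               (l : ℂ), I * a, 0, 0, 0, 0]) ∨
      (∃ l₁ l₂ a b c x y : ℝ, 0 < l₁ ∧ 0 < l₂ ∧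
        b * c + x * y + (a * b / l₂) * (a * c / l₂) = 0 ∧
        A = !![0,        0,     0,                  0,                  0, 0;
               0,        0,     0,                  0,                  0, 0;
               0,        0,     0,                  0,                  0, 0;
               0,        0,     0,                  0,                  0, 0;
               (l₁ : ℂ), I * a, I * b,              I * c,              0, 0;
               0,        l₂,    I * x - a * b / l₂, I * y - a * c / l₂, 0, 0]) ∨
      (∃ l₁ l₂ l₃ a b c : ℝ, 0 < l₁ ∧ 0 < l₂ ∧ 0 < l₃ ∧
        A = !![0,        0,     0,                  0, 0, 0;
               0,        0,     0,                  0, 0, 0;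
               0,        0,     0,                  0, 0, 0;
               (l₁ : ℂ), I * a, I * b,              0, 0, 0;
               0,        l₂,    I * c - a * b / l₂, 0, 0, 0;
               0,        0,     l₃,                 0, 0, 0])
  | _, _ => False

end

/-! The problem is moved to the Lie algebra, identified with a complex inner product space `H`. A
Hermitian product with skew torsion is determined by the bracket (`hermitianProduct_unique`), so the
Strominger connection is left invariant, and being Kähler-like becomes the first Bianchi identity
for a bilinear product `nab` on `H`.

Forward direction. The heart is the center. For central `x` the operator `L = nab.flip x`, `e ↦ nab
e x`, is skew. Two contractions of the curvature, compared with the help of its Kähler symmetries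
and of the unimodularity of nilpotent algebras, show that the symmetric part of `J L` has square of
trace zero, so it vanishes. Hence `J x` is central (`central_mulI_aux`), and a second trace argument
gives `L = 0`: central elements are parallel (`nab_central`). By pair symmetry all `R(x, ·)` vanish,
so the operators `nab x` with `x` central commute with every `nab y`. They are skew and complex
linear, they act as derivations of the torsion (`nab_central_tor`), and they encode the central
component of the bracket (`inner_br_central`).

Diagonalize them simultaneously. The zero weight space is the center (`mem_ker_of_forall_nab`):
otherwise its part orthogonal to the center would be a nonzero ideal, and such an ideal contains
central vectors. A nonzero weight has complex multiplicity one, because the Bianchi identity writes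
zero as a sum of three squared norms (`eq_zero_of_orthogonal_weight`). The brackets `c i = [b i, J b
i]` are central (`br_mulI_mem_ker`), different weight lines commute (`nab_weight_weight`), and the
Bianchi identity on two weight lines makes the `c i` pairwise orthogonal for the real inner product
(`weight_br_mulI`). This is `exists_basis`: the bracket is `∑ Im(conj x_i * y_i) • c i`, and `c j ⊥
b i` whenever `c i ≠ 0`.

What remains is unitary linear algebra (`exists_isNormalForm`). If `r` of the `c i` are nonzero and
they span a space of complex dimension `d`, then `r + d ≤ n ≤ 6` and `d ≤ r`, so `d ≤ 3`.
Gram-Schmidt puts the columns in triangular form, and real orthogonality makes the entries imaginary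
or forces the correction terms such as `-a b / l₂`.

Backward direction. The columns of every normal form are orthogonal for the real inner product
(`IsNormalForm.sum_re_eq_zero`). For a bracket that is diagonal in this sense, `diagonalProduct` is
Hermitian with skew torsion, and its curvature is diagonal with the coefficients `Im(conj x_j * y_j)
* ‖c j‖ ^ 2`, from which the Bianchi identity is immediate. The corresponding left invariant
connection is the Strominger connection. -/

open scoped InnerProductSpace

/-! ### Real linear algebra on a complex inner product space -/

section RealLinearAlgebra

attribute [local instance] InnerProductSpace.complexToReal

variable {H : Type*} [NormedAddCommGroup H] [InnerProductSpace ℂ H]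

/-- Multiplication by `√-1` as a real linear map. -/
noncomputable def mulI (H : Type*) [NormedAddCommGroup H] [InnerProductSpace ℂ H] : H →ₗ[ℝ] H where
  toFun x := Complex.I • x
  map_add' := smul_add _
  map_smul' _ _ := smul_comm _ _ _

theorem mulI_mulI (x : H) : mulI H (mulI H x) = -x := by
  change Complex.I • Complex.I • x = -x
  rw [smul_smul, Complex.I_mul_I, neg_one_smul]

theorem inner_mulI_mulI (x y : H) : ⟪mulI H x, mulI H y⟫_ℝ = ⟪x, y⟫_ℝ := by
  change ⟪Complex.I • x, Complex.I • y⟫_ℝ = _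
  rw [real_inner_eq_re_inner ℂ, real_inner_eq_re_inner ℂ, inner_smul_left, inner_smul_right,
    ← mul_assoc]
  simp

theorem inner_mulI_left (x y : H) : ⟪mulI H x, y⟫_ℝ = -⟪x, mulI H y⟫_ℝ := by
  rw [← inner_mulI_mulI x (mulI H y), mulI_mulI, inner_neg_right, neg_neg]

theorem inner_mulI_self (x : H) : ⟪mulI H x, x⟫_ℝ = 0 := by
  have h := inner_mulI_left x x
  rw [real_inner_comm x (mulI H x)] at h
  rw [real_inner_comm]
  linarith

theorem norm_mulI (x : H) : ‖mulI H x‖ = ‖x‖ := by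
  change ‖Complex.I • x‖ = _
  simp [norm_smul]

/-- A real linear operator that is skew with respect to the real inner product. -/
def IsSkewOp (f : H →ₗ[ℝ] H) : Prop := ∀ y z, ⟪f y, z⟫_ℝ = -⟪y, f z⟫_ℝ

/-- A real linear operator that is symmetric with respect to the real inner product. -/
def IsSymmetricOp (f : H →ₗ[ℝ] H) : Prop := ∀ y z, ⟪f y, z⟫_ℝ = ⟪y, f z⟫_ℝ

theorem IsSkewOp.sub {f g : H →ₗ[ℝ] H} (hf : IsSkewOp f) (hg : IsSkewOp g) : IsSkewOp (f - g) := by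
  intro y z
  simp only [LinearMap.sub_apply, inner_sub_left, inner_sub_right, hf y z, hg y z]
  ring

theorem IsSkewOp.add {f g : H →ₗ[ℝ] H} (hf : IsSkewOp f) (hg : IsSkewOp g) : IsSkewOp (f + g) := by
  intro y z
  simp only [LinearMap.add_apply, inner_add_left, inner_add_right, hf y z, hg y z]
  ring

theorem IsSkewOp.inner_self {f : H →ₗ[ℝ] H} (hf : IsSkewOp f) (y : H) : ⟪f y, y⟫_ℝ = 0 := by
  have h := hf y y
  rw [real_inner_comm (f y) y] at h
  linarith

/-- For skew `f` one has `‖f w‖² = -⟪f (f w), w⟫`, so `f²` has the same kernel as `f`, and powers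
can be lowered one at a time. -/
theorem IsSkewOp.apply_eq_zero_of_pow {f : H →ₗ[ℝ] H} (hf : IsSkewOp f) (k : ℕ) (y : H)
    (h : (f ^ k) y = 0) : f y = 0 := by
  induction k with
  | zero => rw [show y = 0 by simpa using h, map_zero]
  | succ k ih =>
    rcases k with _ | k
    · simpa using h
    · apply ih
      rw [pow_succ', Module.End.mul_apply] at h ⊢
      rw [pow_succ', Module.End.mul_apply] at h
      set w := (f ^ k) y
      have := hf (f w) w
      rw [h, inner_zero_left] at this
      rw [← inner_self_eq_zero (𝕜 := ℝ)]
      linarith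

theorem IsSkewOp.eq_zero_of_isNilpotent {f : H →ₗ[ℝ] H} (hf : IsSkewOp f)
    (h : IsNilpotent f) : f = 0 := by
  obtain ⟨k, hk⟩ := h
  ext y
  exact hf.apply_eq_zero_of_pow k y (by rw [hk]; rfl)

theorem trace_eq_zero_of_isNilpotent {f : H →ₗ[ℝ] H} (hf : IsNilpotent f) :
    LinearMap.trace ℝ H f = 0 :=
  (LinearMap.isNilpotent_trace_of_isNilpotent hf).eq_zero

theorem mulI_mul_mulI : (mulI H * mulI H : Module.End ℝ H) = -1 := by
  ext x
  simp [mulI_mulI]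

variable [FiniteDimensional ℂ H]

instance finiteDimensional_real_of_complex : FiniteDimensional ℝ H :=
  FiniteDimensional.complexToReal H

theorem IsSkewOp.trace_eq_zero {f : H →ₗ[ℝ] H} (hf : IsSkewOp f) : LinearMap.trace ℝ H f = 0 := by
  rw [LinearMap.trace_eq_sum_inner f (stdOrthonormalBasis ℝ H)]
  exact Finset.sum_eq_zero fun i _ => by rw [real_inner_comm, hf.inner_self]

theorem trace_transpose {f g : H →ₗ[ℝ] H} (h : ∀ y z, ⟪f y, z⟫_ℝ = ⟪y, g z⟫_ℝ) :
    LinearMap.trace ℝ H f = LinearMap.trace ℝ H g := by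
  rw [LinearMap.trace_eq_sum_inner f (stdOrthonormalBasis ℝ H),
    LinearMap.trace_eq_sum_inner g (stdOrthonormalBasis ℝ H)]
  exact Finset.sum_congr rfl fun i _ => by rw [real_inner_comm, h]

theorem eq_zero_of_sum_norm {f : H →ₗ[ℝ] H}
    (h : ∑ i, ‖f (stdOrthonormalBasis ℝ H i)‖ ^ 2 = 0) : f = 0 := by
  rw [Finset.sum_eq_zero_iff_of_nonneg fun _ _ => by positivity] at h
  refine (stdOrthonormalBasis ℝ H).toBasis.ext fun i => ?_
  simpa using h i (Finset.mem_univ i)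

/-- For skew `f`, `-tr (f²)` is the squared Hilbert-Schmidt norm. -/
theorem IsSkewOp.eq_zero_of_trace_mul_self {f : H →ₗ[ℝ] H} (hf : IsSkewOp f)
    (h : LinearMap.trace ℝ H (f * f) = 0) : f = 0 := by
  apply eq_zero_of_sum_norm
  rw [LinearMap.trace_eq_sum_inner _ (stdOrthonormalBasis ℝ H)] at h
  rw [← neg_eq_zero, ← Finset.sum_neg_distrib, ← h]
  refine Finset.sum_congr rfl fun i _ => ?_
  rw [Module.End.mul_apply, ← real_inner_self_eq_norm_sq, hf, neg_neg]

theorem IsSymmetricOp.eq_zero_of_trace_mul_self {f : H →ₗ[ℝ] H} (hf : IsSymmetricOp f)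
    (h : LinearMap.trace ℝ H (f * f) = 0) : f = 0 := by
  apply eq_zero_of_sum_norm
  rw [LinearMap.trace_eq_sum_inner _ (stdOrthonormalBasis ℝ H)] at h
  rw [← h]
  refine Finset.sum_congr rfl fun i _ => ?_
  rw [Module.End.mul_apply, ← real_inner_self_eq_norm_sq, hf]

omit [FiniteDimensional ℂ H] in
/-- The trace of `f * g` vanishes if `f` anticommutes and `g` commutes with `√-1`. -/
theorem trace_mul_eq_zero_of_anticommute {f g : Module.End ℝ H}
    (hf : mulI H * f = -(f * mulI H)) (hg : mulI H * g = g * mulI H) :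
    LinearMap.trace ℝ H (f * g) = 0 := by
  have h : LinearMap.trace ℝ H (mulI H * (f * g * mulI H)) = LinearMap.trace ℝ H (f * g) := by
    rw [← mul_assoc, ← mul_assoc, hf, neg_mul, neg_mul, mul_assoc f, hg, mul_assoc f, mul_assoc g,
      mulI_mul_mulI]
    simp
  rw [LinearMap.trace_mul_comm, mul_assoc (f * g), mulI_mul_mulI] at h
  simp only [mul_neg, mul_one, map_neg] at h
  linarith

end RealLinearAlgebra

/-! ### Lie algebras with a Kähler-like Hermitian connection -/

section KahlerLikeAlgebra

attribute [local instance] InnerProductSpace.complexToReal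

/-- The torsion of the bilinear product `nab` with respect to the bracket `br`. -/
noncomputable def algTor {H : Type*} [NormedAddCommGroup H] [InnerProductSpace ℂ H]
    (br nab : H →ₗ[ℝ] H →ₗ[ℝ] H) : H →ₗ[ℝ] H →ₗ[ℝ] H := nab - nab.flip - br

/-- The curvature operator of the bilinear product `nab` with respect to the bracket `br`. -/
noncomputable def algCurv {H : Type*} [NormedAddCommGroup H] [InnerProductSpace ℂ H]
    (br nab : H →ₗ[ℝ] H →ₗ[ℝ] H) (x y : H) : Module.End ℝ H :=
  nab x * nab y - nab y * nab x - nab (br x y)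

/-- A nilpotent Lie bracket `br` with integrable complex structure on a complex inner product
space, together with a Hermitian product `nab` with skew torsion that satisfies the first Bianchi
identity. -/
structure IsKahlerLikeAlgebra {H : Type*} [NormedAddCommGroup H] [InnerProductSpace ℂ H]
    (br nab : H →ₗ[ℝ] H →ₗ[ℝ] H) : Prop where
  skew : ∀ x y, br x y = -br y x
  jacobi : ∀ x y z, br x (br y z) = br (br x y) z + br y (br x z)
  nilpotent : ∃ k, ∀ l : List H, l.length = k → ∀ y, l.foldr (fun a b => br a b) y = 0
  integrable : ∀ x y, br (mulI H x) (mulI H y) - br x y - mulI H (br (mulI H x) y)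
    - mulI H (br x (mulI H y)) = 0
  metric : ∀ x, IsSkewOp (nab x)
  parallel : ∀ x y, nab x (mulI H y) = mulI H (nab x y)
  torsion : ∀ x, IsSkewOp (algTor br nab x)
  bianchi : ∀ x y z, algCurv br nab x y z + algCurv br nab y z x + algCurv br nab z x y = 0

namespace IsKahlerLikeAlgebra

variable {H : Type*} [NormedAddCommGroup H] [InnerProductSpace ℂ H]
  {br nab : H →ₗ[ℝ] H →ₗ[ℝ] H}

theorem algTor_apply (br nab : H →ₗ[ℝ] H →ₗ[ℝ] H) (x y : H) :
    algTor br nab x y = nab x y - nab y x - br x y := rfl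

theorem algCurv_apply (br nab : H →ₗ[ℝ] H →ₗ[ℝ] H) (x y z : H) :
    algCurv br nab x y z = nab x (nab y z) - nab y (nab x z) - nab (br x y) z := rfl

theorem flip_eq (y : H) : nab.flip y = nab y - br y - algTor br nab y := by
  ext e
  simp only [LinearMap.sub_apply, algTor_apply, LinearMap.flip_apply]
  abel

variable (h : IsKahlerLikeAlgebra br nab)
include h

theorem tor_swap (x y : H) : algTor br nab x y = -algTor br nab y x := by
  rw [algTor_apply, algTor_apply, h.skew x y]
  abel

theorem tor_self (x : H) : algTor br nab x x = 0 := by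
  have := h.tor_swap x x
  rwa [eq_neg_iff_add_eq_zero, ← two_smul ℝ, smul_eq_zero_iff_right two_ne_zero] at this

theorem br_self (x : H) : br x x = 0 := by
  have := h.skew x x
  rwa [eq_neg_iff_add_eq_zero, ← two_smul ℝ, smul_eq_zero_iff_right two_ne_zero] at this

theorem inner_tor_rotate (x y z : H) :
    ⟪algTor br nab x y, z⟫_ℝ = ⟪algTor br nab y z, x⟫_ℝ := by
  rw [h.tor_swap x y, inner_neg_left, h.torsion y x z, neg_neg, real_inner_comm]

theorem isNilpotent_br (x : H) : IsNilpotent (br x : Module.End ℝ H) := by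
  obtain ⟨k, hk⟩ := h.nilpotent
  refine ⟨k, LinearMap.ext fun y => ?_⟩
  have : ∀ m : ℕ, ((br x : Module.End ℝ H) ^ m) y
      = (List.replicate m x).foldr (fun a b => br a b) y := by
    intro m
    induction m with
    | zero => rfl
    | succ m ih => rw [pow_succ', Module.End.mul_apply, ih]; rfl
  rw [this]
  exact hk _ (by simp) y

theorem curv_skew (x y : H) : IsSkewOp (algCurv br nab x y) := by
  intro z w
  simp only [algCurv_apply, inner_sub_left, inner_sub_right]
  rw [h.metric x (nab y z) w, h.metric y z, h.metric y (nab x z) w, h.metric x z,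
    h.metric (br x y) z w]
  ring

theorem curv_swap (x y z : H) : algCurv br nab x y z = -algCurv br nab y x z := by
  rw [algCurv_apply, algCurv_apply, h.skew x y, map_neg, LinearMap.neg_apply]
  abel

theorem curv_mulI (x y z : H) :
    algCurv br nab x y (mulI H z) = mulI H (algCurv br nab x y z) := by
  simp only [algCurv_apply, h.parallel, map_sub]

/-- The classical octahedron argument: the Bianchi identities for the four cyclic rotations of `x,
y, z, w` combine, modulo skewness in each pair. -/
theorem curv_pair (x y z w : H) :
    ⟪algCurv br nab x y z, w⟫_ℝ = ⟪algCurv br nab z w x, y⟫_ℝ := by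
  have B : ∀ x y z w : H, ⟪algCurv br nab x y z, w⟫_ℝ + ⟪algCurv br nab y z x, w⟫_ℝ
      + ⟪algCurv br nab z x y, w⟫_ℝ = 0 := by
    intro x y z w
    rw [← inner_add_left, ← inner_add_left, h.bianchi, inner_zero_left]
  have S : ∀ x y z w : H, ⟪algCurv br nab x y z, w⟫_ℝ = -⟪algCurv br nab x y w, z⟫_ℝ := by
    intro x y z w
    rw [h.curv_skew, real_inner_comm]
  have A : ∀ x y z w : H, ⟪algCurv br nab x y z, w⟫_ℝ = -⟪algCurv br nab y x z, w⟫_ℝ := by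
    intro x y z w
    rw [h.curv_swap, inner_neg_left]
  linarith [B x y z w, B y z w x, B z w x y, B w x y z, S x y z w, S y z x w, S z x y w,
    S y z w x, S z w y x, S w y z x, S z w x y, S w x z y, S x z w y, S w x y z, S x y w z,
    S y w x z, A x y z w, A y z x w, A z x y w, A y z w x, A z w y x, A w y z x, A z w x y,
    A w x z y, A x z w y, A w x y z, A x y w z, A y w x z]

/-- Pair symmetry carries the complex structure to the operator slots, where it commutes with the
curvature and is orthogonal. -/
theorem curv_mulI_mulI (x y : H) :
    algCurv br nab (mulI H x) (mulI H y) = algCurv br nab x y := by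
  ext z
  refine ext_inner_right ℝ fun w => ?_
  rw [h.curv_pair, h.curv_mulI, inner_mulI_mulI, h.curv_pair]

theorem curv_right_mulI (x y z : H) :
    algCurv br nab x (mulI H y) z = -algCurv br nab (mulI H x) y z := by
  rw [← h.curv_mulI_mulI x (mulI H y), mulI_mulI]
  simp [algCurv_apply]
  abel

/-- The operator `e ↦ R(e, y) y`. -/
noncomputable def _root_.algRic (br nab : H →ₗ[ℝ] H →ₗ[ℝ] H) (y : H) : Module.End ℝ H :=
  nab.flip (nab y y) - nab y * nab.flip y + nab.flip y * br y

theorem curv_eq_algRic (y e : H) : algCurv br nab e y y = algRic br nab y e := by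
  simp only [algRic, algCurv_apply, LinearMap.add_apply, LinearMap.sub_apply, Module.End.mul_apply,
    LinearMap.flip_apply]
  rw [h.skew e y, map_neg, LinearMap.neg_apply]
  abel

theorem algRic_mulI (y : H) :
    algRic br nab (mulI H y) = -(mulI H * algRic br nab y * mulI H) := by
  ext e
  rw [← h.curv_eq_algRic, h.curv_mulI, h.curv_right_mulI, h.curv_eq_algRic]
  simp

/-- The Bianchi identity for `x, J x, e` turns the two remaining terms into values of `algRic` at `J
e` and `e`. -/
theorem curv_mulI_self (x : H) :
    algCurv br nab x (mulI H x) = -(algRic br nab x * mulI H) - mulI H * algRic br nab x := by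
  ext e
  have hb := h.bianchi x (mulI H x) e
  rw [h.curv_swap (mulI H x) e x, h.curv_right_mulI e x x, neg_neg, h.curv_mulI,
    h.curv_eq_algRic, h.curv_eq_algRic] at hb
  simp only [LinearMap.sub_apply, LinearMap.neg_apply, Module.End.mul_apply]
  rw [add_assoc, add_eq_zero_iff_eq_neg] at hb
  rw [hb]
  abel

theorem nab_comm_mulI (x : H) : (mulI H * nab x : Module.End ℝ H) = nab x * mulI H := by
  ext e
  simp [h.parallel]

variable [FiniteDimensional ℂ H]

/-- This is unimodularity: up to skew operators `nab.flip y` is `-ad y`, which is nilpotent. -/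
theorem trace_flip (y : H) : LinearMap.trace ℝ H (nab.flip y) = 0 := by
  rw [flip_eq (br := br), map_sub, map_sub, (h.metric y).trace_eq_zero, (h.torsion y).trace_eq_zero,
    trace_eq_zero_of_isNilpotent (h.isNilpotent_br y)]
  simp

/-- Eliminating `br y` in favour of `nab y` and the torsion leaves a commutator with `nab y`, and
the term with `nab y y` is traceless by `trace_flip`. -/
theorem trace_algRic (y : H) : LinearMap.trace ℝ H (algRic br nab y)
    = -LinearMap.trace ℝ H (nab.flip y * (nab.flip y + algTor br nab y) : Module.End ℝ H) := by
  have hb : (br y : Module.End ℝ H) = nab y - (nab.flip y + algTor br nab y) := by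
    rw [flip_eq (br := br)]; abel
  rw [algRic, hb, mul_sub, map_add, map_sub, map_sub, h.trace_flip,
    LinearMap.trace_mul_comm _ (nab y)]
  ring

omit [FiniteDimensional ℂ H] in
theorem trace_algRic_mulI (y : H) :
    LinearMap.trace ℝ H (algRic br nab (mulI H y)) = LinearMap.trace ℝ H (algRic br nab y) := by
  rw [h.algRic_mulI, map_neg, LinearMap.trace_mul_comm, ← mul_assoc, mulI_mul_mulI]
  simp

omit [FiniteDimensional ℂ H] in
-- Comparison of the two contractions of a Kähler-type curvature: the Ricci form against the Ricci
-- tensor.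
theorem trace_mulI_curv_mulI_self (x : H) :
    LinearMap.trace ℝ H (mulI H * algCurv br nab x (mulI H x))
      = 2 * LinearMap.trace ℝ H (algRic br nab x) := by
  rw [h.curv_mulI_self, mul_sub, mul_neg, map_sub, map_neg, ← mul_assoc, ← mul_assoc,
    LinearMap.trace_mul_comm, ← mul_assoc, mulI_mul_mulI]
  simp
  ring

/-! ### Central elements: invariance under the complex structure and parallelism -/

section Central

variable {x : H} (hx : ∀ y, br x y = 0)
include hx

omit [FiniteDimensional ℂ H] in
-- For central `x` the curvature is the commutator of `nab x` and `nab (J x)`. Both commute with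
-- `J`, so its product with `J` is still a commutator.
theorem trace_mulI_curv_of_central :
    LinearMap.trace ℝ H (mulI H * algCurv br nab x (mulI H x)) = 0 := by
  have : mulI H * algCurv br nab x (mulI H x)
      = (mulI H * nab x) * nab (mulI H x) - nab (mulI H x) * (mulI H * nab x) := by
    rw [algCurv, hx, map_zero, sub_zero, mul_sub, ← mul_assoc, ← mul_assoc,
      h.nab_comm_mulI (mulI H x), mul_assoc (nab (mulI H x))]
  rw [this, map_sub, LinearMap.trace_mul_comm, sub_self]

omit [FiniteDimensional ℂ H] in
theorem flip_skew_of_central : IsSkewOp (nab.flip x) := by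
  rw [flip_eq (br := br), show br x = 0 from LinearMap.ext hx, sub_zero]
  exact (h.metric x).sub (h.torsion x)

/-- Let `L = nab.flip x` and `t` the torsion of `J x`. The trace identities give `tr (J L (J L + t))
= 0`. Split `J L = s + k` with `s` symmetric and complex linear, `k` skew and complex antilinear.
Integrability makes `k + t` complex linear, and it is skew, so all cross terms have trace zero and
`tr (s²) = 0`. Thus `s = 0`. Then `ad (J x)` is a difference of skew operators; being nilpotent as
well, it vanishes. -/
theorem central_mulI_aux : (mulI H * nab.flip x : Module.End ℝ H) = -(nab.flip x * mulI H) ∧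
    ∀ y, br (mulI H x) y = 0 := by
  have htr : LinearMap.trace ℝ H (algRic br nab (mulI H x)) = 0 := by
    have := h.trace_mulI_curv_mulI_self x
    rw [h.trace_mulI_curv_of_central hx] at this
    rw [h.trace_algRic_mulI]
    linarith
  rw [h.trace_algRic, neg_eq_zero] at htr
  set L : Module.End ℝ H := nab.flip x with hL
  have hskew : IsSkewOp L := h.flip_skew_of_central hx
  have hLy : nab.flip (mulI H x) = mulI H * L := by
    ext e
    simp [hL, h.parallel]
  set s : Module.End ℝ H := (2⁻¹ : ℝ) • (mulI H * L + L * mulI H) with hs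
  set k : Module.End ℝ H := (2⁻¹ : ℝ) • (mulI H * L - L * mulI H) with hk
  set t : Module.End ℝ H := algTor br nab (mulI H x) with ht
  have hJJ : (mulI H * mulI H : Module.End ℝ H) = -1 := mulI_mul_mulI
  have hsk : mulI H * L = s + k := by
    rw [hs, hk, ← smul_add, add_add_sub_cancel, ← two_smul ℝ, smul_smul]
    norm_num
  have hsJ : mulI H * s = s * mulI H := by
    rw [hs, mul_smul_comm, smul_mul_assoc, mul_add, add_mul, ← mul_assoc, hJJ, mul_assoc L, hJJ,
      ← mul_assoc]
    simp [add_comm]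
  have hkJ : mulI H * k = -(k * mulI H) := by
    rw [hk, mul_smul_comm, smul_mul_assoc, mul_sub, sub_mul, ← mul_assoc, hJJ, mul_assoc L, hJJ,
      ← mul_assoc]
    simp
    module
  -- As `x` is central, the Nijenhuis condition for `x, e` reduces to its two terms containing `ad
  -- (J x)`.
  have hadJ : (mulI H * br (mulI H x) : Module.End ℝ H) = br (mulI H x) * mulI H := by
    ext e
    have := h.integrable x e
    rw [hx, hx, map_zero, sub_zero, sub_zero, sub_eq_zero] at this
    simp [this]
  have ht' : t = nab (mulI H x) - br (mulI H x) - (s + k) := by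
    rw [← hsk, ← hLy, flip_eq (br := br), ht]
    abel
  have hMJ : mulI H * (k + t) = (k + t) * mulI H := by
    have : k + t = nab (mulI H x) - br (mulI H x) - s := by rw [ht']; abel
    rw [this, mul_sub, mul_sub, sub_mul, sub_mul, hsJ, hadJ, h.nab_comm_mulI]
  have hs_symm : IsSymmetricOp s := by
    intro y z
    simp only [hs, LinearMap.smul_apply, LinearMap.add_apply, Module.End.mul_apply,
      real_inner_smul_left, real_inner_smul_right, inner_add_left, inner_add_right,
      inner_mulI_left, hskew (mulI H y) z, hskew y]
    ring
  have hk_skew : IsSkewOp k := by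
    intro y z
    simp only [hk, LinearMap.smul_apply, LinearMap.sub_apply, Module.End.mul_apply,
      real_inner_smul_left, real_inner_smul_right, inner_sub_left, inner_sub_right,
      inner_mulI_left, hskew (mulI H y) z, hskew y]
    ring
  have hM_skew : IsSkewOp (k + t) := hk_skew.add (h.torsion _)
  -- A symmetric operator is trace-orthogonal to a skew one.
  have hsM : LinearMap.trace ℝ H (s * (k + t)) = 0 := by
    have : LinearMap.trace ℝ H (s * (k + t)) = LinearMap.trace ℝ H (-((k + t) * s)) := by
      apply trace_transpose
      intro y z
      rw [Module.End.mul_apply, hs_symm, hM_skew, LinearMap.neg_apply, inner_neg_right]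
      rfl
    rw [map_neg, LinearMap.trace_mul_comm] at this
    rw [LinearMap.trace_mul_comm]
    linarith
  have hss : LinearMap.trace ℝ H (s * s) = 0 := by
    have e : (mulI H * L) * (mulI H * L + t) = s * s + s * (k + t) + k * s + k * (k + t) := by
      rw [hsk]; noncomm_ring
    rw [hLy, e, map_add, map_add, map_add, hsM, trace_mul_eq_zero_of_anticommute hkJ hsJ,
      trace_mul_eq_zero_of_anticommute hkJ hMJ] at htr
    linarith
  have hs0 : s = 0 := hs_symm.eq_zero_of_trace_mul_self hss
  constructor
  · rw [hs, smul_eq_zero_iff_right (by norm_num)] at hs0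
    exact eq_neg_of_add_eq_zero_left hs0
  · have hb : br (mulI H x) = nab (mulI H x) - (k + t) := by
      rw [ht', hs0]; abel
    have : br (mulI H x) = 0 := by
      apply IsSkewOp.eq_zero_of_isNilpotent _ (h.isNilpotent_br _)
      rw [hb]
      exact (h.metric _).sub hM_skew
    intro y
    rw [this]; rfl

/-- The center is invariant under the complex structure. -/
theorem central_mulI (y : H) : br (mulI H x) y = 0 := (h.central_mulI_aux hx).2 y

/-- Central elements are parallel. -/
theorem nab_central (w : H) : nab w x = 0 := by
  set L : Module.End ℝ H := nab.flip x with hL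
  have hskew : IsSkewOp L := h.flip_skew_of_central hx
  have hJL : mulI H * L = -(L * mulI H) := (h.central_mulI_aux hx).1
  have hLx : L x = 0 := by
    refine ext_inner_right ℝ fun w => ?_
    rw [hskew, inner_zero_left, neg_eq_zero, real_inner_comm]
    exact (h.metric w).inner_self x
  have hLJx : L (mulI H x) = 0 := by
    have := LinearMap.congr_fun hJL x
    rw [LinearMap.neg_apply, Module.End.mul_apply, Module.End.mul_apply, hLx, map_zero] at this
    rw [← neg_eq_zero, ← this]
  -- Pair symmetry replaces `R(x, J x)` by `R(z, w) x` paired with `J x`. This involves only `L`,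
  -- and its bracket term drops because `L (J x) = 0`. Since `L` anticommutes with `J`, the trace of
  -- `J R(x, J x)` then becomes `2 tr (L²)`.
  have hR : algCurv br nab x (mulI H x) = (2 : ℝ) • (L * mulI H * L) := by
    ext z
    refine ext_inner_right ℝ fun w => ?_
    have e1 : ∀ z, nab z (mulI H x) = mulI H (L z) := fun z => h.parallel z x
    have e2 : ∀ z, nab z x = L z := fun z => rfl
    rw [h.curv_pair, algCurv_apply, inner_sub_left, inner_sub_left, e2, e2, e2,
      h.metric z (L w), h.metric w (L z), e1, e1, hskew (br z w), hLJx, inner_zero_right,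
      LinearMap.smul_apply, real_inner_smul_left, Module.End.mul_apply, Module.End.mul_apply]
    have a₁ : ⟪L w, mulI H (L z)⟫_ℝ = -⟪L (mulI H (L z)), w⟫_ℝ := by rw [hskew, real_inner_comm]
    have a₂ : ⟪L z, mulI H (L w)⟫_ℝ = ⟪L (mulI H (L z)), w⟫_ℝ := by
      rw [hskew (mulI H (L z)), inner_mulI_left, neg_neg]
    linarith
  have htr := h.trace_mulI_curv_of_central hx
  rw [hR, mul_smul_comm, map_smul, show L * mulI H = -(mulI H * L) by rw [hJL, neg_neg], neg_mul,
    mul_neg, ← mul_assoc, ← mul_assoc, mulI_mul_mulI] at htr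
  have : LinearMap.trace ℝ H (L * L) = 0 := by
    simpa using htr
  exact LinearMap.congr_fun (hskew.eq_zero_of_trace_mul_self this) w

theorem nab_of_central : nab x = algTor br nab x := by
  ext y
  rw [algTor_apply, h.nab_central hx, hx]
  simp

/-- Pair symmetry reduces this to `R(z, w) x = 0`, which holds because `x` is parallel. -/
theorem curv_central (y : H) : algCurv br nab x y = 0 := by
  ext z
  refine ext_inner_right ℝ fun w => ?_
  rw [h.curv_pair]
  simp [algCurv_apply, h.nab_central hx]

theorem nab_comm_central (y z : H) : nab x (nab y z) = nab y (nab x z) := by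
  have := LinearMap.congr_fun (h.curv_central hx y) z
  rw [algCurv_apply, hx, map_zero] at this
  simpa [sub_eq_zero] using this

/-- The operator `nab x` thus carries exactly the `x`-component of the bracket; Jacobi identities
can be tested against `x` in terms of `nab x`. -/
theorem inner_br_central (y z : H) : ⟪br y z, x⟫_ℝ = -⟪nab x y, z⟫_ℝ := by
  have hb : br y z = nab y z - nab z y - algTor br nab y z := by rw [algTor_apply]; abel
  rw [hb, inner_sub_left, inner_sub_left, h.metric y, h.metric z, h.nab_central hx,
    h.nab_central hx, h.nab_of_central hx, ← h.inner_tor_rotate]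
  simp

/-- The operator of a central element is a derivation of the torsion. -/
theorem nab_central_tor (y z : H) : nab x (algTor br nab y z)
    = algTor br nab (nab x y) z + algTor br nab y (nab x z) := by
  refine ext_inner_right ℝ fun w => ?_
  have hb : ∀ y z, br y z = nab y z - nab z y - algTor br nab y z := by
    intro y z; rw [algTor_apply]; abel
  have hP : ∀ a b c, ⟪nab x a, nab b c⟫_ℝ = ⟪nab x c, nab b a⟫_ℝ := by
    intro a b c
    rw [← neg_neg ⟪nab x a, nab b c⟫_ℝ, ← h.metric b, ← h.nab_comm_central hx, h.metric x, neg_neg,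
      real_inner_comm]
  -- The component of the Jacobi identity along `x`. Once the inner brackets are expanded, the `nab`
  -- terms cancel in pairs by `hP`, leaving only the torsion.
  have hjac : ⟪br y (br z w), x⟫_ℝ + ⟪br z (br w y), x⟫_ℝ + ⟪br w (br y z), x⟫_ℝ = 0 := by
    rw [h.jacobi y z w, h.skew w (br y z), h.skew y w, map_neg, inner_add_left, inner_neg_left,
      inner_neg_left]
    ring
  rw [h.inner_br_central hx, h.inner_br_central hx, h.inner_br_central hx, hb z w, hb w y,
    hb y z] at hjac
  simp only [inner_sub_right] at hjac
  have c₁ : ⟪algTor br nab (nab x y) z, w⟫_ℝ = ⟪nab x y, algTor br nab z w⟫_ℝ := by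
    rw [h.inner_tor_rotate, real_inner_comm]
  have c₂ : ⟪algTor br nab y (nab x z), w⟫_ℝ = ⟪nab x z, algTor br nab w y⟫_ℝ := by
    rw [h.inner_tor_rotate, h.inner_tor_rotate, real_inner_comm]
  rw [h.metric, inner_add_left, real_inner_comm, c₁, c₂]
  linarith [hP y z w, hP z w y, hP w y z]

end Central

end IsKahlerLikeAlgebra

end KahlerLikeAlgebra

/-! ### Weights of the center and the structure of the bracket -/

section KahlerLikeAlgebraStructure

attribute [local instance] InnerProductSpace.complexToReal

namespace IsKahlerLikeAlgebra

variable {H : Type*} [NormedAddCommGroup H] [InnerProductSpace ℂ H]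
  {br nab : H →ₗ[ℝ] H →ₗ[ℝ] H}

/-- The vectors on which every central element `x` acts by `κ x` times the complex structure. -/
def weightSpace (br nab : H →ₗ[ℝ] H →ₗ[ℝ] H) (κ : H → ℝ) : Submodule ℝ H where
  carrier := {y | ∀ x ∈ LinearMap.ker br, nab x y = κ x • mulI H y}
  add_mem' := fun hy hz x hx => by simp only [map_add, smul_add, hy x hx, hz x hx]
  zero_mem' := fun x _ => by simp
  smul_mem' := fun c y hy x hx => by simp only [map_smul, hy x hx, smul_comm c]

theorem mem_ker_iff {x : H} : x ∈ LinearMap.ker br ↔ ∀ y, br x y = 0 := by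
  rw [LinearMap.mem_ker, LinearMap.ext_iff]; rfl

theorem br_eq (br nab : H →ₗ[ℝ] H →ₗ[ℝ] H) (x y : H) :
    br x y = nab x y - nab y x - algTor br nab x y := by
  rw [algTor_apply]; abel

variable (h : IsKahlerLikeAlgebra br nab)
include h

/-- A nonzero ideal contains a nonzero central element. -/
theorem exists_central_of_ideal {𝔞 : Submodule ℝ H} (hid : ∀ w, ∀ y ∈ 𝔞, br w y ∈ 𝔞) {y : H}
    (hy : y ∈ 𝔞) (hy0 : y ≠ 0) : ∃ c ∈ 𝔞, c ≠ 0 ∧ c ∈ LinearMap.ker br := by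
  obtain ⟨k, hk⟩ := h.nilpotent
  replace hk : ∀ l : List H, l.length = k → l.foldr (fun a b => br a b) y = 0 :=
    fun l hl => hk l hl y
  induction k generalizing y with
  | zero => exact absurd (hk [] rfl) hy0
  | succ k ih =>
    by_cases hc : ∀ w, br w y = 0
    · exact ⟨y, hy, hy0, mem_ker_iff.2 fun w => by rw [h.skew, hc, neg_zero]⟩
    · push Not at hc
      obtain ⟨w, hw⟩ := hc
      refine ih (hid w y hy) hw fun l hl => ?_
      -- Appending `w` at the end makes it the innermost bracket, so shorter words applied to `[w,
      -- y]` vanish.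
      have := hk (l ++ [w]) (by simp [hl])
      simpa using this

omit h in
theorem br_mem_of_parallel {𝔞 : Submodule ℝ H} (hn : ∀ w, ∀ y ∈ 𝔞, nab w y ∈ 𝔞)
    (hT : ∀ x ∈ 𝔞, ∀ y ∈ 𝔞, algTor br nab x y ∈ 𝔞) {x y : H} (hx : x ∈ 𝔞) (hy : y ∈ 𝔞) :
    br x y ∈ 𝔞 := by
  rw [br_eq br nab]
  exact 𝔞.sub_mem (𝔞.sub_mem (hn _ _ hy) (hn _ _ hx)) (hT _ hx _ hy)

/-- For a parallel subspace `𝔞` closed under the torsion, `nab` and the torsion agree on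
`𝔞 × 𝔞ᗮ`. -/
theorem nab_eq_tor_of_parallel {𝔞 : Submodule ℝ H} (hn : ∀ w, ∀ y ∈ 𝔞, nab w y ∈ 𝔞)
    (hT : ∀ x ∈ 𝔞, ∀ y ∈ 𝔞, algTor br nab x y ∈ 𝔞) {x y : H} (hx : x ∈ 𝔞) (hy : y ∈ 𝔞ᗮ) :
    nab x y = algTor br nab x y := by
  set f : Module.End ℝ H := nab x - algTor br nab x with hf
  have hfs : IsSkewOp f := (h.metric x).sub (h.torsion x)
  have hperp : ∀ z ∈ 𝔞ᗮ, f z ∈ 𝔞ᗮ := by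
    intro z hz
    rw [Submodule.mem_orthogonal']
    intro u hu
    rw [hfs, neg_eq_zero]
    exact Submodule.inner_left_of_mem_orthogonal (𝔞.sub_mem (hn _ _ hu) (hT _ hx _ hu)) hz
  have hmod : ∀ m : ℕ, (f ^ m) y ∈ 𝔞ᗮ ∧ ((br x : Module.End ℝ H) ^ m) y - (f ^ m) y ∈ 𝔞 := by
    intro m
    induction m with
    | zero => simpa using hy
    | succ m ih =>
      rw [pow_succ', pow_succ', Module.End.mul_apply, Module.End.mul_apply]
      refine ⟨hperp _ ih.1, ?_⟩
      have e : (br x) (((br x : Module.End ℝ H) ^ m) y) - f ((f ^ m) y)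
          = br x (((br x : Module.End ℝ H) ^ m) y - (f ^ m) y) - nab ((f ^ m) y) x := by
        rw [map_sub, br_eq br nab x ((f ^ m) y), hf, LinearMap.sub_apply]
        abel
      rw [e]
      exact 𝔞.sub_mem (br_mem_of_parallel hn hT hx ih.2) (hn _ _ hx)
  obtain ⟨k, hk⟩ := h.isNilpotent_br x
  have h0 : (f ^ k) y = 0 := by
    have := hmod k
    rw [hk, LinearMap.zero_apply, zero_sub, neg_mem_iff] at this
    rw [← inner_self_eq_zero (𝕜 := ℝ)]
    exact Submodule.inner_right_of_mem_orthogonal this.2 this.1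
  have := hfs.apply_eq_zero_of_pow k y h0
  rwa [hf, LinearMap.sub_apply, sub_eq_zero] at this

theorem br_eq_neg_nab_of_parallel {𝔞 : Submodule ℝ H} (hn : ∀ w, ∀ y ∈ 𝔞, nab w y ∈ 𝔞)
    (hT : ∀ x ∈ 𝔞, ∀ y ∈ 𝔞, algTor br nab x y ∈ 𝔞) {x y : H} (hx : x ∈ 𝔞) (hy : y ∈ 𝔞ᗮ) :
    br x y = -nab y x := by
  rw [br_eq br nab, h.nab_eq_tor_of_parallel hn hT hx hy]
  abel

/-- The torsion is of type `(2,1) + (1,2)`. -/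
theorem inner_tor_type (x y z : H) : ⟪algTor br nab x y, z⟫_ℝ
    = ⟪algTor br nab (mulI H x) (mulI H y), z⟫_ℝ + ⟪algTor br nab (mulI H x) y, mulI H z⟫_ℝ
      + ⟪algTor br nab x (mulI H y), mulI H z⟫_ℝ := by
  have e : algTor br nab x y = algTor br nab (mulI H x) (mulI H y)
      - mulI H (algTor br nab (mulI H x) y) - mulI H (algTor br nab x (mulI H y)) := by
    have hi := h.integrable x y
    simp only [br_eq br nab, h.parallel, map_sub, mulI_mulI] at hi
    rw [← sub_eq_zero, ← hi]
    abel
  rw [e, inner_sub_left, inner_sub_left, inner_mulI_left, inner_mulI_left]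
  ring

/-- The first Bianchi identity in terms of the torsion. -/
theorem bianchi_tor (x y z : H) :
    (nab x (algTor br nab y z) + algTor br nab x (br y z))
      + (nab y (algTor br nab z x) + algTor br nab y (br z x))
      + (nab z (algTor br nab x y) + algTor br nab z (br x y)) = 0 := by
  have hb := h.bianchi x y z
  have hj : br x (br y z) + br y (br z x) + br z (br x y) = 0 := by
    rw [h.jacobi x y z, h.skew z (br x y), h.skew z x, map_neg]
    abel
  -- Each term is split into second covariant derivatives and an iterated bracket; cyclically, these
  -- are the curvature sum minus the Jacobi sum.
  have key : ∀ x y z : H, nab x (algTor br nab y z) + algTor br nab x (br y z)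
      = nab x (nab y z) - nab x (nab z y) - nab (br y z) x - br x (br y z) := by
    intro x y z
    have : nab x (algTor br nab y z) = nab x (nab y z) - nab x (nab z y) - nab x (br y z) := by
      rw [algTor_apply, map_sub, map_sub]
    rw [this, algTor_apply]
    abel
  rw [key, key, key]
  rw [algCurv_apply, algCurv_apply, algCurv_apply] at hb
  rw [← sub_eq_zero.2 (hb.trans hj.symm)]
  abel

theorem mulI_mem_weightSpace {κ : H → ℝ} {y : H} (hy : y ∈ weightSpace br nab κ) :
    mulI H y ∈ weightSpace br nab κ := by
  intro x hx
  rw [h.parallel, hy x hx, map_smul]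

variable [FiniteDimensional ℂ H]

theorem nab_mem_weightSpace {κ : H → ℝ} {y : H} (hy : y ∈ weightSpace br nab κ) (w : H) :
    nab w y ∈ weightSpace br nab κ := by
  intro x hx
  rw [h.nab_comm_central (mem_ker_iff.1 hx), hy x hx, map_smul, h.parallel]

theorem nab_central_apply_central {x y : H} (hy : y ∈ LinearMap.ker br) : nab x y = 0 :=
  h.nab_central (mem_ker_iff.1 hy) x

theorem mulI_mem_ker {x : H} (hx : x ∈ LinearMap.ker br) : mulI H x ∈ LinearMap.ker br :=
  mem_ker_iff.2 (h.central_mulI (mem_ker_iff.1 hx))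

theorem inner_tor_central {x : H} (hx : x ∈ LinearMap.ker br) (y z : H) :
    ⟪algTor br nab y z, x⟫_ℝ = ⟪nab x y, z⟫_ℝ := by
  rw [h.nab_of_central (mem_ker_iff.1 hx), ← h.inner_tor_rotate]

/-- A vector killed by all central elements is central. -/
theorem mem_ker_of_forall_nab {y : H} (hy : ∀ x ∈ LinearMap.ker br, nab x y = 0) :
    y ∈ LinearMap.ker br := by
  set 𝔷 := LinearMap.ker br with h𝔷
  -- The candidate counterexamples: vectors of weight zero orthogonal to the center. They form a
  -- parallel ideal, which would meet the center if it were nonzero.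
  set 𝔞 : Submodule ℝ H := 𝔷ᗮ ⊓ weightSpace br nab 0 with h𝔞
  have hw : ∀ {y}, y ∈ weightSpace br nab 0 ↔ ∀ x ∈ 𝔷, nab x y = 0 := by
    intro y
    refine forall₂_congr fun x _ => ?_
    rw [Pi.zero_apply, zero_smul]
  have hn : ∀ w, ∀ y ∈ 𝔞, nab w y ∈ 𝔞 := by
    intro w y hy
    refine ⟨?_, h.nab_mem_weightSpace hy.2 w⟩
    rw [SetLike.mem_coe, Submodule.mem_orthogonal']
    intro u hu
    rw [h.metric, h.nab_central_apply_central hu, inner_zero_right, neg_zero]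
  have hT : ∀ x ∈ 𝔞, ∀ y ∈ 𝔞, algTor br nab x y ∈ 𝔞 := by
    intro x hx y hy
    refine ⟨?_, hw.2 fun u hu => ?_⟩
    · rw [SetLike.mem_coe, Submodule.mem_orthogonal']
      intro u hu
      rw [h.inner_tor_central hu, hw.1 hx.2 u hu, inner_zero_left]
    · rw [h.nab_central_tor (mem_ker_iff.1 hu), hw.1 hx.2 u hu, hw.1 hy.2 u hu]
      simp
  have hid : ∀ w, ∀ y ∈ 𝔞, br w y ∈ 𝔞 := by
    intro w y hy
    obtain ⟨a, ha, a', ha', rfl⟩ := Submodule.exists_add_mem_mem_orthogonal (K := 𝔞) w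
    rw [map_add, LinearMap.add_apply]
    refine 𝔞.add_mem (br_mem_of_parallel hn hT ha hy) ?_
    rw [h.skew, h.br_eq_neg_nab_of_parallel hn hT hy ha', neg_neg]
    exact hn _ _ hy
  obtain ⟨a, ha, a', ha', rfl⟩ := Submodule.exists_add_mem_mem_orthogonal (K := 𝔷) y
  have ha'0 : a' = 0 := by
    by_contra hne
    have ha'𝔞 : a' ∈ 𝔞 := by
      refine ⟨ha', hw.2 fun x hx => ?_⟩
      have := hy x hx
      rwa [map_add, h.nab_central_apply_central ha, zero_add] at this
    obtain ⟨c, hc, hc0, hcz⟩ := h.exists_central_of_ideal hid ha'𝔞 hne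
    exact hc0 (inner_self_eq_zero.1 (Submodule.inner_right_of_mem_orthogonal (𝕜 := ℝ) hcz hc.1))
  rw [ha'0, add_zero]
  exact ha

/-! ### Nonzero weights -/

section Weight

variable {κ : H → ℝ} {x₀ : H} (hx₀ : x₀ ∈ LinearMap.ker br) (hκ : κ x₀ ≠ 0)
include hx₀ hκ

/-- The skew operator `nab x₀` kills the center, which is stable under `J`, but is a nonzero
multiple of `J` on the weight space. -/
theorem inner_weight_central {y x : H} (hy : y ∈ weightSpace br nab κ)
    (hx : x ∈ LinearMap.ker br) : ⟪y, x⟫_ℝ = 0 := by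
  have e := h.metric x₀ y (mulI H x)
  rw [h.nab_central_apply_central (h.mulI_mem_ker hx), inner_zero_right, neg_zero, hy x₀ hx₀,
    real_inner_smul_left, inner_mulI_mulI] at e
  exact (mul_eq_zero.1 e).resolve_left hκ

/-- On the weight space `nab x₀` is `κ x₀` times `J`; as a skew derivation of the torsion it gives
the identity `D`: inserting `J` into each of the three slots sums to zero. Applying `D` with one `J`
already inserted and adding the three results gives `3 T = 2 T` for a torsion of type `(2,1) +
(1,2)`. -/
theorem inner_tor_weight {x y z : H} (hx : x ∈ weightSpace br nab κ)
    (hy : y ∈ weightSpace br nab κ) (hz : z ∈ weightSpace br nab κ) :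
    ⟪algTor br nab x y, z⟫_ℝ = 0 := by
  have D : ∀ x ∈ weightSpace br nab κ, ∀ y ∈ weightSpace br nab κ, ∀ z ∈ weightSpace br nab κ,
      ⟪algTor br nab (mulI H x) y, z⟫_ℝ + ⟪algTor br nab x (mulI H y), z⟫_ℝ
        + ⟪algTor br nab x y, mulI H z⟫_ℝ = 0 := by
    intro x hx y hy z hz
    have e := h.metric x₀ (algTor br nab x y) z
    rw [h.nab_central_tor (mem_ker_iff.1 hx₀), hx x₀ hx₀, hy x₀ hx₀, hz x₀ hx₀, inner_add_left,
      map_smul, map_smul, LinearMap.smul_apply, real_inner_smul_left, real_inner_smul_left,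
      real_inner_smul_right] at e
    refine (mul_eq_zero.1 (?_ : κ x₀ * _ = 0)).resolve_left hκ
    linarith
  have d₁ := D _ (h.mulI_mem_weightSpace hx) y hy z hz
  have d₂ := D x hx _ (h.mulI_mem_weightSpace hy) z hz
  have d₃ := D x hx y hy _ (h.mulI_mem_weightSpace hz)
  rw [mulI_mulI] at d₁ d₂ d₃
  rw [map_neg] at d₁ d₂
  rw [LinearMap.neg_apply, inner_neg_left] at d₁
  rw [inner_neg_left] at d₂
  rw [inner_neg_right] at d₃
  have t := h.inner_tor_type x y z
  linarith

/-- The torsion form of the Bianchi identity, paired with `u`: since weight spaces are parallel,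
every term containing a covariant derivative is a torsion with all three arguments of the same
weight, hence zero. -/
theorem sum_inner_tor_weight {x y z u : H} (hx : x ∈ weightSpace br nab κ)
    (hy : y ∈ weightSpace br nab κ) (hz : z ∈ weightSpace br nab κ)
    (hu : u ∈ weightSpace br nab κ) :
    ⟪algTor br nab x u, algTor br nab y z⟫_ℝ + ⟪algTor br nab y u, algTor br nab z x⟫_ℝ
      + ⟪algTor br nab z u, algTor br nab x y⟫_ℝ = 0 := by
  have key : ∀ x ∈ weightSpace br nab κ, ∀ y ∈ weightSpace br nab κ, ∀ z ∈ weightSpace br nab κ,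
      ⟪nab x (algTor br nab y z) + algTor br nab x (br y z), u⟫_ℝ
        = ⟪algTor br nab x u, algTor br nab y z⟫_ℝ := by
    intro x hx y hy z hz
    rw [inner_add_left, h.metric, h.inner_tor_weight hx₀ hκ hy hz (h.nab_mem_weightSpace hu x),
      neg_zero, zero_add, ← h.inner_tor_rotate u x, h.tor_swap u x, inner_neg_left,
      br_eq br nab y z, inner_sub_right, inner_sub_right,
      h.inner_tor_weight hx₀ hκ hx hu (h.nab_mem_weightSpace hz y),
      h.inner_tor_weight hx₀ hκ hx hu (h.nab_mem_weightSpace hy z)]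
    ring
  have hb := congrArg (fun v => ⟪v, u⟫_ℝ) (h.bianchi_tor x y z)
  simp only [inner_zero_left] at hb
  rw [inner_add_left, inner_add_left, key x hx y hy z hz, key y hy z hz x hx,
    key z hz x hx y hy] at hb
  exact hb

omit hx₀ hκ in
-- The derivation property of `nab u` kills `T(x, J x)` for each central `u`, and such vectors are
-- central.
theorem tor_mulI_mem_ker {x : H} (hx : x ∈ weightSpace br nab κ) :
    algTor br nab x (mulI H x) ∈ LinearMap.ker br := by
  refine h.mem_ker_of_forall_nab fun u hu => ?_
  rw [h.nab_central_tor (mem_ker_iff.1 hu), hx u hu, h.mulI_mem_weightSpace hx u hu, mulI_mulI]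
  simp [h.tor_self]

omit hx₀ hκ in
theorem inner_tor_mulI_central {x u : H} (hx : x ∈ weightSpace br nab κ)
    (hu : u ∈ LinearMap.ker br) :
    ⟪algTor br nab x (mulI H x), u⟫_ℝ = κ u * ‖x‖ ^ 2 := by
  rw [h.inner_tor_central hu, hx u hu, real_inner_smul_left, inner_mulI_mulI,
    real_inner_self_eq_norm_sq]

omit h hx₀ hκ [FiniteDimensional ℂ H] in
theorem eq_of_forall_inner_mem {K : Submodule ℝ H} {u v : H} (hu : u ∈ K) (hv : v ∈ K)
    (huv : ∀ w ∈ K, ⟪u, w⟫_ℝ = ⟪v, w⟫_ℝ) : u = v := by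
  rw [← sub_eq_zero, ← inner_self_eq_zero (𝕜 := ℝ), inner_sub_left, sub_eq_zero]
  exact huv _ (K.sub_mem hu hv)

omit hx₀ hκ in
-- Polarization: `T(x, J x)` is central and depends only on `‖x‖²`, which is additive on orthogonal
-- vectors.
theorem tor_mulI_comm_of_orthogonal {x y : H} (hx : x ∈ weightSpace br nab κ)
    (hy : y ∈ weightSpace br nab κ) (hxy : ⟪x, y⟫_ℝ = 0) :
    algTor br nab (mulI H x) y = algTor br nab x (mulI H y) := by
  have e : algTor br nab (x + y) (mulI H (x + y)) = algTor br nab x (mulI H x)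
      + algTor br nab y (mulI H y) + algTor br nab x (mulI H y) - algTor br nab (mulI H x) y := by
    rw [h.tor_swap (mulI H x) y, map_add, map_add, map_add, LinearMap.add_apply,
      LinearMap.add_apply]
    abel
  have hn : ‖x + y‖ ^ 2 = ‖x‖ ^ 2 + ‖y‖ ^ 2 := by
    rw [norm_add_sq_real, hxy]; ring
  have hm := h.tor_mulI_mem_ker ((weightSpace br nab κ).add_mem hx hy)
  have : algTor br nab (x + y) (mulI H (x + y)) = algTor br nab x (mulI H x)
      + algTor br nab y (mulI H y) := by
    refine eq_of_forall_inner_mem hm (Submodule.add_mem _ (h.tor_mulI_mem_ker hx)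
      (h.tor_mulI_mem_ker hy)) fun w hw => ?_
    rw [h.inner_tor_mulI_central ((weightSpace br nab κ).add_mem hx hy) hw, inner_add_left,
      h.inner_tor_mulI_central hx hw, h.inner_tor_mulI_central hy hw, hn]
    ring
  rw [this, add_sub_assoc, left_eq_add, sub_eq_zero] at e
  exact e.symm

/-- Apply `sum_inner_tor_weight` to `x, J x, y` and `J y`. The commutation rules for `T` turn it
into `‖T(x, J y)‖² + ‖T(x, y)‖² + ‖y‖² ‖T(x, J x)‖² = 0`, and `T(x, J x) ≠ 0` because its
`x₀`-component is `κ x₀`. -/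
theorem eq_zero_of_orthogonal_weight {x y : H} (hx : x ∈ weightSpace br nab κ) (hx1 : ‖x‖ = 1)
    (hy : y ∈ weightSpace br nab κ) (hxy : ⟪x, y⟫_ℝ = 0) (hxJy : ⟪x, mulI H y⟫_ℝ = 0) : y = 0 := by
  have hJx := h.mulI_mem_weightSpace hx
  have hJy := h.mulI_mem_weightSpace hy
  have hs := h.sum_inner_tor_weight hx₀ hκ hx hJx hy hJy
  have e₁ := h.tor_mulI_comm_of_orthogonal hx hy hxy
  have e₂ := h.tor_mulI_comm_of_orthogonal hx hJy hxJy
  rw [mulI_mulI, map_neg] at e₂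
  have e₃ : algTor br nab y (mulI H y) = ‖y‖ ^ 2 • algTor br nab x (mulI H x) := by
    refine eq_of_forall_inner_mem (h.tor_mulI_mem_ker hy)
      (Submodule.smul_mem _ _ (h.tor_mulI_mem_ker hx)) fun w hw => ?_
    rw [real_inner_smul_left, h.inner_tor_mulI_central hx hw, h.inner_tor_mulI_central hy hw, hx1]
    ring
  rw [e₁, e₂, e₃, h.tor_swap y x, inner_neg_left, inner_neg_right, neg_neg, real_inner_smul_left,
    real_inner_self_eq_norm_sq, real_inner_self_eq_norm_sq, real_inner_self_eq_norm_sq] at hs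
  by_contra hne
  have ht : algTor br nab x (mulI H x) ≠ 0 := by
    intro h0
    have := h.inner_tor_mulI_central hx hx₀
    rw [h0, inner_zero_left, hx1] at this
    apply hκ
    linarith
  have p : 0 < ‖y‖ ^ 2 * ‖algTor br nab x (mulI H x)‖ ^ 2 := by positivity
  nlinarith [sq_nonneg ‖algTor br nab x (mulI H y)‖, sq_nonneg ‖algTor br nab x y‖]

/-- Nonzero weights are simple. -/
theorem weight_eq_span {x y : H} (hx : x ∈ weightSpace br nab κ) (hx1 : ‖x‖ = 1)
    (hy : y ∈ weightSpace br nab κ) : ∃ a b : ℝ, y = a • x + b • mulI H x := by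
  refine ⟨⟪x, y⟫_ℝ, ⟪mulI H x, y⟫_ℝ, ?_⟩
  rw [← sub_eq_zero]
  have hxx : ⟪x, x⟫_ℝ = 1 := by rw [real_inner_self_eq_norm_sq, hx1]; norm_num
  have hxJ : ⟪x, mulI H x⟫_ℝ = 0 := by rw [real_inner_comm, inner_mulI_self]
  refine h.eq_zero_of_orthogonal_weight hx₀ hκ hx hx1 (Submodule.sub_mem _ hy (Submodule.add_mem _
    (Submodule.smul_mem _ _ hx) (Submodule.smul_mem _ _ (h.mulI_mem_weightSpace hx)))) ?_ ?_
  · rw [inner_sub_right, inner_add_right, real_inner_smul_right, real_inner_smul_right, hxx, hxJ]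
    ring
  · rw [map_sub, map_add, map_smul, map_smul, mulI_mulI, inner_sub_right, inner_add_right,
      real_inner_smul_right, real_inner_smul_right, inner_neg_right, hxx, hxJ, inner_mulI_left]
    ring

omit hx₀ hκ in
theorem weight_sup_parallel : ∀ w, ∀ y ∈ weightSpace br nab κ ⊔ LinearMap.ker br,
    nab w y ∈ weightSpace br nab κ ⊔ LinearMap.ker br := by
  intro w y hy
  obtain ⟨a, ha, x, hx, rfl⟩ := Submodule.mem_sup.1 hy
  rw [map_add, h.nab_central_apply_central hx, add_zero]
  exact Submodule.mem_sup_left (h.nab_mem_weightSpace ha w)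

theorem weight_sup_tor {e : H} (he : e ∈ weightSpace br nab κ) (he1 : ‖e‖ = 1) :
    ∀ x ∈ weightSpace br nab κ ⊔ LinearMap.ker br, ∀ y ∈ weightSpace br nab κ ⊔ LinearMap.ker br,
      algTor br nab x y ∈ weightSpace br nab κ ⊔ LinearMap.ker br := by
  have hz : ∀ u ∈ LinearMap.ker br, ∀ y ∈ weightSpace br nab κ ⊔ LinearMap.ker br,
      algTor br nab u y ∈ weightSpace br nab κ ⊔ LinearMap.ker br := by
    intro u hu y hy
    rw [← h.nab_of_central (mem_ker_iff.1 hu)]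
    exact h.weight_sup_parallel u y hy
  intro x hx y hy
  obtain ⟨a, ha, u, hu, rfl⟩ := Submodule.mem_sup.1 hx
  rw [map_add, LinearMap.add_apply]
  refine Submodule.add_mem _ ?_ (hz u hu y hy)
  obtain ⟨b, hb, v, hv, rfl⟩ := Submodule.mem_sup.1 hy
  rw [map_add]
  refine Submodule.add_mem _ ?_ ?_
  · obtain ⟨a₁, a₂, rfl⟩ := h.weight_eq_span hx₀ hκ he he1 ha
    obtain ⟨b₁, b₂, rfl⟩ := h.weight_eq_span hx₀ hκ he he1 hb
    have : algTor br nab (a₁ • e + a₂ • mulI H e) (b₁ • e + b₂ • mulI H e)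
        = (a₁ * b₂ - a₂ * b₁) • algTor br nab e (mulI H e) := by
      simp only [map_add, map_smul, LinearMap.add_apply, LinearMap.smul_apply, h.tor_self,
        h.tor_swap (mulI H e) e]
      module
    rw [this]
    exact Submodule.mem_sup_right (Submodule.smul_mem _ _ (h.tor_mulI_mem_ker he))
  · rw [h.tor_swap]
    exact Submodule.neg_mem _ (hz v hv _ (Submodule.mem_sup_left ha))

/-- The weight line together with the center is a subalgebra, so `c = [e, J e]` is `α e + β J e`
plus a central vector. Then `c` is an eigenvector of `ad e` and of `ad (J e)` with eigenvalues `β`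
and `-α`, and nilpotency forces both to vanish. -/
theorem br_mulI_mem_ker {e : H} (he : e ∈ weightSpace br nab κ) (he1 : ‖e‖ = 1) :
    br e (mulI H e) ∈ LinearMap.ker br := by
  have hmem := br_mem_of_parallel (h.weight_sup_parallel)
    (h.weight_sup_tor hx₀ hκ he he1) (Submodule.mem_sup_left he)
    (Submodule.mem_sup_left (h.mulI_mem_weightSpace he))
  obtain ⟨y, hy, x, hx, hc⟩ := Submodule.mem_sup.1 hmem
  obtain ⟨α, β, rfl⟩ := h.weight_eq_span hx₀ hκ he he1 hy
  have hx' := mem_ker_iff.1 hx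
  set c := br e (mulI H e) with hcdef
  by_cases hc0 : c = 0
  · rw [hc0]; exact Submodule.zero_mem _
  have eig : ∀ (u : H) (t : ℝ), br u c = t • c → t = 0 := by
    intro u t hu
    obtain ⟨k, hk⟩ := h.isNilpotent_br u
    have : ∀ m : ℕ, ((br u : Module.End ℝ H) ^ m) c = t ^ m • c := by
      intro m
      induction m with
      | zero => simp
      | succ m ih => rw [pow_succ', Module.End.mul_apply, ih, map_smul, hu, smul_smul, pow_succ]
    have := this k
    rw [hk, LinearMap.zero_apply, eq_comm, smul_eq_zero_iff_left hc0] at this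
    by_contra ht
    exact pow_ne_zero k ht this
  have hβ : β = 0 := by
    refine eig e β ?_
    rw [← hc, map_add, map_add, map_smul, map_smul, h.br_self, h.skew e x, hx', ← hcdef, hc]
    simp
  have hα : -α = 0 := by
    refine eig (mulI H e) (-α) ?_
    rw [← hc, map_add, map_add, map_smul, map_smul, h.br_self, h.skew _ x, hx', h.skew _ e,
      ← hcdef, hc]
    simp
  rw [neg_eq_zero] at hα
  rw [← hc, hα, hβ]
  simpa using hx

end Weight

/-! ### Interaction of two orthogonal weight lines -/

section TwoWeights

variable {κ μ : H → ℝ} {x₀ y₀ : H} (hx₀ : x₀ ∈ LinearMap.ker br) (hκ : κ x₀ ≠ 0)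
  (hy₀ : y₀ ∈ LinearMap.ker br) (hμ : μ y₀ ≠ 0) {e f : H} (he : e ∈ weightSpace br nab κ)
  (he1 : ‖e‖ = 1) (hf : f ∈ weightSpace br nab μ) (hf1 : ‖f‖ = 1)
  (hef : ⟪e, f⟫_ℝ = 0) (heJf : ⟪e, mulI H f⟫_ℝ = 0)
include hx₀ hκ hy₀ hμ he he1 hf hf1 hef heJf

theorem weight_orthogonal {x y : H} (hx : x ∈ weightSpace br nab κ)
    (hy : y ∈ weightSpace br nab μ) : ⟪x, y⟫_ℝ = 0 := by
  obtain ⟨a₁, a₂, rfl⟩ := h.weight_eq_span hx₀ hκ he he1 hx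
  obtain ⟨b₁, b₂, rfl⟩ := h.weight_eq_span hy₀ hμ hf hf1 hy
  simp only [inner_add_left, inner_add_right, real_inner_smul_left, real_inner_smul_right,
    hef, heJf, inner_mulI_left, mulI_mulI, inner_neg_right]
  ring

theorem mem_orthogonal_sup {y : H} (hy : y ∈ weightSpace br nab μ) :
    y ∈ (weightSpace br nab κ ⊔ LinearMap.ker br)ᗮ := by
  rw [Submodule.mem_orthogonal]
  intro u hu
  obtain ⟨a, ha, x, hx, rfl⟩ := Submodule.mem_sup.1 hu
  rw [inner_add_left, h.weight_orthogonal hx₀ hκ hy₀ hμ he he1 hf hf1 hef heJf ha hy,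
    real_inner_comm, h.inner_weight_central hy₀ hμ hy hx, add_zero]

/-- Each line plus the center is parallel and closed under torsion, so `[x, y]` equals both `-nab y
x` and `nab x y`. It lies in two orthogonal weight spaces, hence is zero. -/
theorem nab_weight_weight {x y : H} (hx : x ∈ weightSpace br nab κ)
    (hy : y ∈ weightSpace br nab μ) : br x y = 0 ∧ nab x y = 0 ∧ nab y x = 0 := by
  have hfe : ⟪f, e⟫_ℝ = 0 := by rw [real_inner_comm, hef]
  have hfJe : ⟪f, mulI H e⟫_ℝ = 0 := by rw [real_inner_comm, inner_mulI_left, heJf, neg_zero]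
  have hyo := h.mem_orthogonal_sup hx₀ hκ hy₀ hμ he he1 hf hf1 hef heJf hy
  have hxo := h.mem_orthogonal_sup hy₀ hμ hx₀ hκ hf hf1 he he1 hfe hfJe hx
  have e₁ := h.br_eq_neg_nab_of_parallel (h.weight_sup_parallel)
    (h.weight_sup_tor hx₀ hκ he he1) (Submodule.mem_sup_left hx) hyo
  have e₂ := h.br_eq_neg_nab_of_parallel (h.weight_sup_parallel)
    (h.weight_sup_tor hy₀ hμ hf hf1) (Submodule.mem_sup_left hy) hxo
  have hb : br x y = 0 := by
    have m₁ : br x y ∈ weightSpace br nab κ := by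
      rw [e₁]; exact Submodule.neg_mem _ (h.nab_mem_weightSpace hx y)
    have m₂ : br x y ∈ weightSpace br nab μ := by
      rw [h.skew, e₂, neg_neg]; exact h.nab_mem_weightSpace hy x
    exact inner_self_eq_zero.1
      (h.weight_orthogonal hx₀ hκ hy₀ hμ he he1 hf hf1 hef heJf m₁ m₂)
  refine ⟨hb, ?_, ?_⟩
  · rw [h.skew, e₂, neg_neg] at hb; exact hb
  · rw [e₁, neg_eq_zero] at hb; exact hb

/-- In the Bianchi identity for `e, J e, f` all mixed products vanish; only `nab [e, J e] f`
survives. -/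
theorem weight_br_mulI : μ (br e (mulI H e)) = 0 := by
  have hJe := h.mulI_mem_weightSpace he
  have W := fun {x y : H} => h.nab_weight_weight (x := x) (y := y)
    hx₀ hκ hy₀ hμ he he1 hf hf1 hef heJf
  have hb := h.bianchi e (mulI H e) f
  simp only [algCurv_apply, (W he hf).1, (W he hf).2.1, (W he hf).2.2, (W hJe hf).1,
    (W hJe hf).2.1, (W hJe hf).2.2, h.skew f e, (W (h.nab_mem_weightSpace he (mulI H e)) hf).2.2,
    (W (h.nab_mem_weightSpace hJe e) hf).2.2, map_zero, neg_zero, LinearMap.zero_apply, sub_zero,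
    zero_sub, add_zero, neg_eq_zero] at hb
  rw [hf _ (h.br_mulI_mem_ker hx₀ hκ he he1), smul_eq_zero] at hb
  refine hb.resolve_right fun h0 => ?_
  rw [← norm_eq_zero, norm_mulI, hf1] at h0
  exact one_ne_zero h0

end TwoWeights

end IsKahlerLikeAlgebra

end KahlerLikeAlgebraStructure

/-! ### Simultaneous diagonalization -/

section JointEigenbasis

/-- Pairwise commuting symmetric operators have a joint orthonormal eigenbasis. -/
theorem exists_orthonormalBasis_joint_eigenvector {H : Type*} [NormedAddCommGroup H]
    [InnerProductSpace ℂ H] [FiniteDimensional ℂ H] {ι : Type*} {T : ι → Module.End ℂ H}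
    (hT : ∀ i, (T i).IsSymmetric) (hC : Pairwise (Function.onFun Commute T)) :
    ∃ (b : OrthonormalBasis (Fin (Module.finrank ℂ H)) ℂ H)
      (α : Fin (Module.finrank ℂ H) → ι → ℝ), ∀ j i, T i (b j) = (α j i : ℂ) • b j := by
  classical
  have hI := LinearMap.IsSymmetric.directSum_isInternal_of_pairwise_commute hT hC
  have hO := LinearMap.IsSymmetric.orthogonalFamily_iInf_eigenspaces hT
  set V : (ι → ℂ) → Submodule ℂ H := fun γ => ⨅ i, Module.End.eigenspace (T i) (γ i) with hV
  have hI' := DirectSum.isInternal_ne_bot_iff.2 hI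
  -- The joint eigenvalues range over all of `ι → ℂ`; independence leaves only finitely many nonzero
  -- joint eigenspaces.
  have : Finite {γ // V γ ≠ ⊥} :=
    (WellFoundedGT.finite_ne_bot_of_iSupIndep hI.submodule_iSupIndep).to_subtype
  have := Fintype.ofFinite {γ // V γ ≠ ⊥}
  have hO' : OrthogonalFamily ℂ (fun γ : {γ // V γ ≠ ⊥} => V γ) fun γ => (V γ).subtypeₗᵢ :=
    hO.comp Subtype.val_injective
  refine ⟨hI'.subordinateOrthonormalBasis rfl hO',
    fun j i => ((hI'.subordinateOrthonormalBasisIndex rfl j hO').1 i).re, fun j i => ?_⟩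
  set b := hI'.subordinateOrthonormalBasis rfl hO' j with hb
  set γ := (hI'.subordinateOrthonormalBasisIndex rfl j hO').1
  have hmem : b ∈ V γ := hI'.subordinateOrthonormalBasis_subordinate rfl j hO'
  have hi : b ∈ Module.End.eigenspace (T i) (γ i) := (Submodule.mem_iInf _).1 hmem i
  have hne : b ≠ 0 := (hI'.subordinateOrthonormalBasis rfl hO').orthonormal.ne_zero j
  have hreal : conj (γ i) = γ i :=
    (hT i).conj_eigenvalue_eq_self (Module.End.hasEigenvalue_of_hasEigenvector ⟨hi, hne⟩)
  rw [Complex.conj_eq_iff_re.1 hreal]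
  exact Module.End.mem_eigenspace_iff.1 hi

end JointEigenbasis

/-! ### The unitary basis that diagonalizes the bracket -/

section KahlerLikeAlgebraBasis

attribute [local instance] InnerProductSpace.complexToReal

theorem complex_smul_eq {H : Type*} [NormedAddCommGroup H] [InnerProductSpace ℂ H] (c : ℂ) (y : H) :
    c • y = c.re • y + c.im • mulI H y := by
  change _ = _ + c.im • Complex.I • y
  rw [← Complex.coe_smul, ← Complex.coe_smul, smul_smul, ← add_smul, Complex.re_add_im]

theorem re_inner_complex {H : Type*} [NormedAddCommGroup H] [InnerProductSpace ℂ H] (x y : H) :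
    (inner ℂ x y).re = ⟪x, y⟫_ℝ := rfl

theorem im_inner_complex {H : Type*} [NormedAddCommGroup H] [InnerProductSpace ℂ H] (x y : H) :
    (inner ℂ x y).im = ⟪mulI H x, y⟫_ℝ := by
  rw [← re_inner_complex]
  change _ = (inner ℂ (Complex.I • x) y).re
  rw [inner_smul_left]
  simp

namespace IsKahlerLikeAlgebra

variable {H : Type*} [NormedAddCommGroup H] [InnerProductSpace ℂ H]
  {br nab : H →ₗ[ℝ] H →ₗ[ℝ] H} (h : IsKahlerLikeAlgebra br nab)

/-- The symmetric complex linear operator `√-1 • nab x`. -/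
noncomputable def nabI (x : H) : Module.End ℂ H where
  toFun y := mulI H (nab x y)
  map_add' y z := by rw [map_add, map_add]
  map_smul' c y := by
    rw [RingHom.id_apply, complex_smul_eq, complex_smul_eq, map_add, map_add, map_smul, map_smul,
      map_smul, map_smul, h.parallel]

theorem nabI_apply (x y : H) : h.nabI x y = mulI H (nab x y) := rfl

theorem nabI_isSymmetric (x : H) : (h.nabI x).IsSymmetric := by
  intro y z
  apply Complex.ext
  · rw [re_inner_complex, re_inner_complex, nabI_apply, nabI_apply, inner_mulI_left, h.metric,
      h.parallel, neg_neg]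
  · rw [im_inner_complex, im_inner_complex, nabI_apply, nabI_apply, inner_mulI_mulI, mulI_mulI,
      inner_neg_left, h.metric, neg_neg]

variable [FiniteDimensional ℂ H]
include h

theorem exists_weightBasis : ∃ (b : OrthonormalBasis (Fin (Module.finrank ℂ H)) ℂ H)
    (κ : Fin (Module.finrank ℂ H) → H → ℝ), ∀ j, b j ∈ weightSpace br nab (κ j) := by
  classical
  obtain ⟨b, α, hb⟩ := exists_orthonormalBasis_joint_eigenvector
    (T := fun x : LinearMap.ker br => h.nabI x) (fun x => h.nabI_isSymmetric x) (by
      intro x y _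
      refine LinearMap.ext fun z => ?_
      simp only [Module.End.mul_apply, nabI_apply, h.parallel]
      rw [h.nab_comm_central (mem_ker_iff.1 x.2)])
  -- From `J (nab x b) = α b` follows `nab x b = -α J b`. Weights matter only on the center, so `0`
  -- elsewhere is arbitrary.
  refine ⟨b, fun j x => if hx : x ∈ LinearMap.ker br then -α j ⟨x, hx⟩ else 0, fun j x hx => ?_⟩
  have e := congrArg (mulI H) (hb j ⟨x, hx⟩)
  rw [nabI_apply, mulI_mulI, complex_smul_eq, Complex.ofReal_im, zero_smul, add_zero, map_smul,
    Complex.ofReal_re] at e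
  beta_reduce
  rw [dif_pos hx, neg_smul, ← e, neg_neg]

/-- The structure of nilpotent Lie algebras with Kähler-like Strominger connection. -/
theorem exists_basis : ∃ b : OrthonormalBasis (Fin (Module.finrank ℂ H)) ℂ H,
    (∀ x y, br x y = ∑ i, (conj (inner ℂ (b i) x) * inner ℂ (b i) y).im • br (b i) (mulI H (b i))) ∧
    (∀ i j, i ≠ j → ⟪br (b i) (mulI H (b i)), br (b j) (mulI H (b j))⟫_ℝ = 0) ∧
    (∀ i j, br (b i) (mulI H (b i)) ≠ 0 → inner ℂ (b i) (br (b j) (mulI H (b j))) = 0) := by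
  obtain ⟨b, κ, hb⟩ := h.exists_weightBasis
  have hb1 : ∀ i, ‖b i‖ = 1 := fun i => b.orthonormal.1 i
  have hbij : ∀ i j, i ≠ j → ⟪b i, b j⟫_ℝ = 0 := fun i j hij => by
    rw [← re_inner_complex, b.orthonormal.2 hij, Complex.zero_re]
  have hbij' : ∀ i j, i ≠ j → ⟪b i, mulI H (b j)⟫_ℝ = 0 := fun i j hij => by
    rw [← neg_eq_zero, ← inner_mulI_left, ← im_inner_complex, b.orthonormal.2 hij, Complex.zero_im]
  -- A basis vector whose weight vanishes on the center is itself central.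
  have hdich : ∀ i, b i ∈ LinearMap.ker br ∨ ∃ x ∈ LinearMap.ker br, κ i x ≠ 0 := by
    intro i
    by_contra! hc
    refine hc.1 (h.mem_ker_of_forall_nab fun x hx => ?_)
    rw [hb i x hx, hc.2 x hx, zero_smul]
  have hzero : ∀ i, b i ∈ LinearMap.ker br → ∀ y, br (b i) y = 0 := fun i hi => mem_ker_iff.1 hi
  have hzero' : ∀ i, b i ∈ LinearMap.ker br → ∀ y, br (mulI H (b i)) y = 0 :=
    fun i hi => mem_ker_iff.1 (h.mulI_mem_ker hi)
  have hker : ∀ i, br (b i) (mulI H (b i)) ∈ LinearMap.ker br := by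
    intro i
    rcases hdich i with hi | ⟨x, hx, hκ⟩
    · rw [hzero i hi]; exact Submodule.zero_mem _
    · exact h.br_mulI_mem_ker hx hκ (hb i) (hb1 i)
  refine ⟨b, fun x y => ?_, fun i j hij => ?_, fun i j hi => ?_⟩
  · have hij : ∀ i j, i ≠ j → ∀ a c : ℂ, br (a • b i) (c • b j) = 0 := by
      intro i j hne a c
      rw [complex_smul_eq, complex_smul_eq]
      rcases hdich i with hi | ⟨x, hx, hκ⟩
      · simp [hzero i hi, hzero' i hi]
      rcases hdich j with hj | ⟨y, hy, hμ⟩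
      · simp [h.skew _ (b j), h.skew _ (mulI H (b j)), hzero j hj, hzero' j hj]
      · exact (h.nab_weight_weight hx hκ hy hμ (hb i) (hb1 i) (hb j) (hb1 j) (hbij i j hne)
          (hbij' i j hne) (Submodule.add_mem _ (Submodule.smul_mem _ _ (hb i))
            (Submodule.smul_mem _ _ (h.mulI_mem_weightSpace (hb i))))
          (Submodule.add_mem _ (Submodule.smul_mem _ _ (hb j))
            (Submodule.smul_mem _ _ (h.mulI_mem_weightSpace (hb j))))).1
    have hii : ∀ i, ∀ a c : ℂ, br (a • b i) (c • b i)
        = (conj a * c).im • br (b i) (mulI H (b i)) := by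
      intro i a c
      rw [complex_smul_eq, complex_smul_eq]
      simp only [map_add, map_smul, LinearMap.add_apply, LinearMap.smul_apply, h.br_self,
        h.skew (mulI H (b i)) (b i), Complex.mul_im, Complex.conj_re, Complex.conj_im]
      module
    conv_lhs => rw [← b.sum_repr' x, ← b.sum_repr' y]
    rw [map_sum]
    refine Finset.sum_congr rfl fun i _ => ?_
    rw [map_sum, LinearMap.sum_apply,
      Finset.sum_eq_single i (fun j _ hj => hij j i hj _ _) (by simp), hii]
  · rcases hdich i with hi | ⟨x, hx, hκ⟩
    · rw [hzero i hi, inner_zero_left]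
    rcases hdich j with hj | ⟨y, hy, hμ⟩
    · rw [hzero j hj, inner_zero_right]
    -- Up to sign the inner product of `c i` and `c j` is the weight of `b i` evaluated at `c j`,
    -- which is zero.
    rw [h.inner_br_central (mem_ker_iff.1 (hker j)), hb i _ (hker j),
      h.weight_br_mulI hy hμ hx hκ (hb j) (hb1 j) (hb i) (hb1 i) (hbij j i hij.symm)
        (hbij' j i hij.symm)]
    simp
  · rcases hdich i with hi' | ⟨x, hx, hκ⟩
    · exact absurd (hzero i hi' _) hi
    apply Complex.ext
    · rw [re_inner_complex, h.inner_weight_central hx hκ (hb i) (hker j)]; rfl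
    · rw [im_inner_complex,
        h.inner_weight_central hx hκ (h.mulI_mem_weightSpace (hb i)) (hker j)]; rfl

end IsKahlerLikeAlgebra

end KahlerLikeAlgebraBasis

/-! ### Orthonormal bases adapted to a family of vectors -/

section NormalForms

variable {H : Type*} [NormedAddCommGroup H] [InnerProductSpace ℂ H]

/-- The first `r` vectors carry the nonzero brackets and must be kept; the Gram-Schmidt vectors go
last, because the nonzero rows of the normal forms are the bottom ones. -/
theorem exists_orthonormalBasis_extension_of_tail {n r d : ℕ} (b : OrthonormalBasis (Fin n) ℂ H)
    {w : Fin d → H} (hw : Orthonormal ℂ w)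
    (hbw : ∀ i : Fin n, i.val < r → ∀ m, inner ℂ (b i) (w m) = 0) (hrd : r + d ≤ n) :
    ∃ b' : OrthonormalBasis (Fin n) ℂ H, (∀ i : Fin n, i.val < r → b' i = b i) ∧
      ∀ (i : Fin n) (m : Fin d), i.val = n - d + m → b' i = w m := by
  have : FiniteDimensional ℂ H := b.toBasis.finiteDimensional_of_finite
  set v : Fin n → H := fun i => if i.val < r then b i else
    if hi : n - d ≤ i.val then w ⟨i.val - (n - d), by omega⟩ else 0 with hv
  set s : Set (Fin n) := {i | i.val < r ∨ n - d ≤ i.val} with hs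
  have h₁ : ∀ i : Fin n, i.val < r → v i = b i := fun i hi => by simp [hv, hi]
  have h₂ : ∀ i : Fin n, ∀ hi : n - d ≤ i.val, v i = w ⟨i.val - (n - d), by omega⟩ := by
    intro i hi
    have : ¬ i.val < r := by omega
    simp only [hv, if_neg this, dif_pos hi]
  have ho : Orthonormal ℂ (s.domRestrict v) := by
    constructor
    · rintro ⟨i, hi | hi⟩
      · rw [Set.domRestrict_apply, h₁ i hi]; exact b.orthonormal.1 i
      · rw [Set.domRestrict_apply, h₂ i hi]; exact hw.1 _
    · rintro ⟨i, hi⟩ ⟨j, hj⟩ hij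
      have hij' : i ≠ j := fun e => hij (Subtype.ext e)
      rw [Set.domRestrict_apply, Set.domRestrict_apply]
      rcases hi with hi | hi <;> rcases hj with hj | hj
      · rw [h₁ i hi, h₁ j hj]; exact b.orthonormal.2 hij'
      · rw [h₁ i hi, h₂ j hj]; exact hbw i hi _
      · rw [h₂ i hi, h₁ j hj, inner_eq_zero_symm]; exact hbw j hj _
      · rw [h₂ i hi, h₂ j hj]
        refine hw.2 fun e => hij' (Fin.ext ?_)
        have := congrArg Fin.val e
        simp only at this
        omega
  obtain ⟨b', hb'⟩ := ho.exists_orthonormalBasis_extension_of_card_eq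
    (Module.finrank_eq_card_basis b.toBasis)
  refine ⟨b', fun i hi => ?_, fun i m him => ?_⟩
  · rw [hb' i (Or.inl hi), h₁ i hi]
  · have hi : n - d ≤ i.val := by omega
    rw [hb' i (Or.inr hi), h₂ i hi]
    congr 1
    apply Fin.ext
    simp only
    omega

/-- This bound drives the case distinction: it limits both the rank and the number of nonzero
columns. -/
theorem card_add_card_le_of_orthonormal {n r d : ℕ} (b : OrthonormalBasis (Fin n) ℂ H)
    {w : Fin d → H} (hw : Orthonormal ℂ w)
    (hbw : ∀ i : Fin n, i.val < r → ∀ m, inner ℂ (b i) (w m) = 0) (hr : r ≤ n) : r + d ≤ n := by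
  have : FiniteDimensional ℂ H := b.toBasis.finiteDimensional_of_finite
  have ho : Orthonormal ℂ (Sum.elim (fun i : Fin r => b (Fin.castLE hr i)) w) := by
    constructor
    · rintro (i | i)
      · exact b.orthonormal.1 _
      · exact hw.1 _
    · rintro (i | i) (j | j) hij
      · refine b.orthonormal.2 fun e => hij ?_
        rw [Fin.castLE_injective hr e]
      · exact hbw _ i.2 _
      · rw [inner_eq_zero_symm]; exact hbw _ j.2 _
      · exact hw.2 fun e => hij (by rw [e])
  have := ho.linearIndependent.fintype_card_le_finrank
  rw [Module.finrank_eq_card_basis b.toBasis] at this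
  simpa using this

/-- One step of the Gram-Schmidt process. -/
theorem exists_unit_of_notMem_span {d : ℕ} {w : Fin d → H} (hw : Orthonormal ℂ w) {x : H}
    (hx : x ∉ Submodule.span ℂ (Set.range w)) :
    ∃ (v : H) (l : ℝ), 0 < l ∧ ‖v‖ = 1 ∧ (∀ m, inner ℂ (w m) v = 0) ∧
      x = ∑ m, (inner ℂ (w m) x : ℂ) • w m + (l : ℂ) • v ∧ inner ℂ v x = (l : ℂ) ∧
      ∀ y, (∀ m, inner ℂ y (w m) = 0) → inner ℂ y x = 0 → inner ℂ y v = 0 := by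
  set u := x - ∑ m, (inner ℂ (w m) x : ℂ) • w m with hu
  have hmem : ∑ m, (inner ℂ (w m) x : ℂ) • w m ∈ Submodule.span ℂ (Set.range w) :=
    Submodule.sum_mem _ fun m _ => Submodule.smul_mem _ _ (Submodule.subset_span ⟨m, rfl⟩)
  have hu0 : u ≠ 0 := fun e => hx (by rw [sub_eq_zero.1 (hu.symm.trans e)]; exact hmem)
  have hl : 0 < ‖u‖ := norm_pos_iff.2 hu0
  have hl' : (‖u‖ : ℂ) ≠ 0 := by exact_mod_cast hl.ne'
  have hwu : ∀ m, inner ℂ (w m) u = 0 := by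
    intro m
    rw [hu, inner_sub_right, hw.inner_right_fintype, sub_self]
  have hxu : x = ∑ m, (inner ℂ (w m) x : ℂ) • w m + u := by rw [hu]; abel
  have hv : (‖u‖ : ℂ) • ((‖u‖ : ℂ)⁻¹ • u) = u := by rw [smul_smul, mul_inv_cancel₀ hl', one_smul]
  refine ⟨(‖u‖ : ℂ)⁻¹ • u, ‖u‖, hl, ?_, fun m => ?_, ?_, ?_, fun y hy hyx => ?_⟩
  · rw [norm_smul, norm_inv, Complex.norm_real, norm_norm, inv_mul_cancel₀ hl.ne']
  · rw [inner_smul_right, hwu, mul_zero]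
  · rw [hv]; exact hxu
  · conv_lhs => rw [hxu]
    rw [inner_smul_left, inner_add_right, inner_sum, Finset.sum_eq_zero, zero_add,
      inner_self_eq_norm_sq_to_K]
    · simp only [map_inv₀, Complex.conj_ofReal]
      field_simp
      simp
    · intro m _
      rw [inner_smul_right, inner_eq_zero_symm.1 (hwu m), mul_zero]
  · have hyu : inner ℂ y u = 0 := by
      rw [hu, inner_sub_right, hyx, inner_sum,
        Finset.sum_eq_zero fun m _ => by rw [inner_smul_right, hy, mul_zero], sub_zero]
    rw [inner_smul_right, hyu, mul_zero]

theorem inner_eq_zero_of_mem_span {d : ℕ} {w : Fin d → H} {x y : H}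
    (hx : x ∈ Submodule.span ℂ (Set.range w)) (hy : ∀ m, inner ℂ y (w m) = 0) :
    inner ℂ y x = 0 := by
  induction hx using Submodule.span_induction with
  | mem z hz => obtain ⟨m, rfl⟩ := hz; exact hy m
  | zero => exact inner_zero_right _
  | add a c _ _ ha hc => rw [inner_add_right, ha, hc, add_zero]
  | smul t a _ ha => rw [inner_smul_right, ha, mul_zero]

theorem eq_sum_of_mem_span {d : ℕ} {w : Fin d → H} (hw : Orthonormal ℂ w) {x : H}
    (hx : x ∈ Submodule.span ℂ (Set.range w)) : x = ∑ m, (inner ℂ (w m) x : ℂ) • w m := by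
  rw [← sub_eq_zero, ← inner_self_eq_zero (𝕜 := ℂ)]
  refine inner_eq_zero_of_mem_span (w := w) (Submodule.sub_mem _ hx (Submodule.sum_mem _ fun m _ =>
    Submodule.smul_mem _ _ (Submodule.subset_span ⟨m, rfl⟩))) fun m => ?_
  rw [inner_eq_zero_symm, inner_sub_right, hw.inner_right_fintype, sub_self]

/-- A basis adapted to a family of vectors `k` in the span of an orthonormal family `w`. -/
theorem exists_adapted_basis {n r d : ℕ} (b : OrthonormalBasis (Fin n) ℂ H)
    {w : Fin d → H} (hw : Orthonormal ℂ w)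
    (hbw : ∀ i : Fin n, i.val < r → ∀ m, inner ℂ (b i) (w m) = 0) (hrd : r + d ≤ n) {k : ℕ → H}
    (hk : ∀ j, k j ∈ Submodule.span ℂ (Set.range w)) :
    ∃ b' : OrthonormalBasis (Fin n) ℂ H, (∀ i : Fin n, i.val < r → b' i = b i) ∧
      (∀ (i : Fin n) j, i.val < n - d → inner ℂ (b' i) (k j) = 0) ∧
      ∀ (i : Fin n) (m : Fin d) j, i.val = n - d + m → inner ℂ (b' i) (k j) = inner ℂ (w m) (k j) := by
  obtain ⟨b', h₁, h₂⟩ := exists_orthonormalBasis_extension_of_tail b hw hbw hrd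
  refine ⟨b', h₁, fun i j hi => inner_eq_zero_of_mem_span (hk j) fun m => ?_,
    fun i m j hi => by rw [h₂ i m hi]⟩
  have hm : n - d + m.val < n := by omega
  rw [← h₂ ⟨n - d + m.val, hm⟩ m rfl]
  exact b'.orthonormal.2 fun e => by rw [e] at hi; simp at hi

theorem isNormalForm_zero {n : ℕ} (hn₂ : 2 ≤ n) (hn₆ : n ≤ 6) : IsNormalForm n 0 := by
  interval_cases n
  · refine ⟨0, le_rfl, ?_⟩
    ext i j; fin_cases i <;> fin_cases j <;> simp
  · refine ⟨0, 0, le_rfl, ?_⟩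
    ext i j; fin_cases i <;> fin_cases j <;> simp
  all_goals
    refine Or.inl ⟨0, 0, le_rfl, ?_⟩
    ext i j; fin_cases i <;> fin_cases j <;> simp

end NormalForms

/-! ### Gram-Schmidt reduction to the list -/

section NormalForms

variable {H : Type*} [NormedAddCommGroup H] [InnerProductSpace ℂ H]

theorem eq_I_mul_im {z : ℂ} (hz : z.re = 0) : z = Complex.I * z.im := by
  apply Complex.ext <;> simp [hz]

theorem orthonormal_one {w₀ : H} (h₀ : ‖w₀‖ = 1) : Orthonormal ℂ ![w₀] := by
  refine ⟨fun i => ?_, fun i j hij => absurd (Subsingleton.elim i j) hij⟩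
  rw [Subsingleton.elim i 0]; exact h₀

theorem orthonormal_two {w₀ w₁ : H} (h₀ : ‖w₀‖ = 1) (h₁ : ‖w₁‖ = 1) (h₀₁ : inner ℂ w₀ w₁ = 0) :
    Orthonormal ℂ ![w₀, w₁] := by
  rw [orthonormal_iff_ite]
  simp [Fin.forall_fin_succ, inner_self_eq_norm_sq_to_K, h₀, h₁, h₀₁, inner_eq_zero_symm.1 h₀₁]

theorem orthonormal_three {w₀ w₁ w₂ : H} (h₀ : ‖w₀‖ = 1) (h₁ : ‖w₁‖ = 1) (h₂ : ‖w₂‖ = 1)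
    (h₀₁ : inner ℂ w₀ w₁ = 0) (h₀₂ : inner ℂ w₀ w₂ = 0) (h₁₂ : inner ℂ w₁ w₂ = 0) :
    Orthonormal ℂ ![w₀, w₁, w₂] := by
  rw [orthonormal_iff_ite]
  simp [Fin.forall_fin_succ, inner_self_eq_norm_sq_to_K, h₀, h₁, h₂, h₀₁, h₀₂, h₁₂,
    inner_eq_zero_symm.1 h₀₁, inner_eq_zero_symm.1 h₀₂, inner_eq_zero_symm.1 h₁₂]

/-- All columns are multiples of `w₀`, the first real and the others imaginary. Two nonzero
imaginary multiples are not orthogonal over the reals, so `r ≤ 2`; for `n = 2` the bound `r + 1 ≤ n`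
leaves one column. -/
theorem isNormalForm_of_span_one {n r : ℕ} (hn₂ : 2 ≤ n) (hn₆ : n ≤ 6)
    (b : OrthonormalBasis (Fin n) ℂ H) {k : ℕ → H} (hr : r ≤ n) (hk : ∀ j, k j ≠ 0 ↔ j < r)
    (hkO : ∀ i j, i ≠ j → (inner ℂ (k i) (k j)).re = 0) {w₀ : H} {l : ℝ} (hl : 0 < l)
    (hw₀ : ‖w₀‖ = 1) (e₀ : inner ℂ w₀ (k 0) = (l : ℂ)) (hbw : ∀ i : Fin n, i.val < r → inner ℂ (b i) w₀ = 0)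
    (ha : ∀ j, 1 ≤ j → (inner ℂ w₀ (k j)).re = 0)
    (hspan : ∀ j, k j ∈ Submodule.span ℂ (Set.range ![w₀])) :
    ∃ b' : OrthonormalBasis (Fin n) ℂ H, (∀ i : Fin n, i.val < r → b' i = b i) ∧
      IsNormalForm n (Matrix.of fun i j => inner ℂ (b' i) (k j)) := by
  have hw := orthonormal_one hw₀
  have hbw' : ∀ i : Fin n, i.val < r → ∀ m, inner ℂ (b i) (![w₀] m) = 0 := by
    intro i hi m
    rw [Subsingleton.elim m 0]; exact hbw i hi
  have hrd := card_add_card_le_of_orthonormal b hw hbw' hr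
  have hk' : ∀ j, k j = (inner ℂ w₀ (k j) : ℂ) • w₀ := by
    intro j
    have := eq_sum_of_mem_span hw (hspan j)
    simpa using this
  have hr₂ : r ≤ 2 := by
    by_contra! hlt
    have h₁₂ := hkO 1 2 (by norm_num)
    rw [hk' 1, hk' 2, inner_smul_left, inner_smul_right, inner_self_eq_norm_sq_to_K, hw₀,
      eq_I_mul_im (ha 1 le_rfl), eq_I_mul_im (ha 2 (by norm_num))] at h₁₂
    simp at h₁₂
    rcases h₁₂ with h | h
    · refine (hk 1).2 (by omega) ?_
      rw [hk' 1, eq_I_mul_im (ha 1 le_rfl), h]; simp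
    · refine (hk 2).2 (by omega) ?_
      rw [hk' 2, eq_I_mul_im (ha 2 (by norm_num)), h]; simp
  have hk0 : ∀ j, r ≤ j → k j = 0 := fun j hj => by
    by_contra hne
    exact absurd ((hk j).1 hne) (by omega)
  have e₁ := eq_I_mul_im (ha 1 le_rfl)
  have e₂ : ∀ j, 2 ≤ j → inner ℂ w₀ (k j) = 0 := fun j hj => by
    rw [hk0 j (by omega), inner_zero_right]
  obtain ⟨b', hb', hz, hrow⟩ := exists_adapted_basis b hw hbw' hrd hspan
  refine ⟨b', hb', ?_⟩
  interval_cases n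
  · refine ⟨l, hl.le, ?_⟩
    have e₁ : inner ℂ w₀ (k 1) = 0 := by rw [hk0 1 (by omega), inner_zero_right]
    ext i j; fin_cases i
    · exact (hz _ _ (by norm_num)).trans (by fin_cases j <;> rfl)
    · exact (hrow _ 0 _ (by norm_num)).trans (by fin_cases j <;> simp [e₀, e₁])
  · refine ⟨l, (inner ℂ w₀ (k 1)).im, hl.le, ?_⟩
    ext i j; fin_cases i
    on_goal 3 => exact (hrow _ 0 _ (by norm_num)).trans (by fin_cases j <;> simp [e₀, ← e₁, e₂])
    all_goals exact (hz _ _ (by norm_num)).trans (by fin_cases j <;> rfl)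
  · refine Or.inl ⟨l, (inner ℂ w₀ (k 1)).im, hl.le, ?_⟩
    ext i j; fin_cases i
    on_goal 4 => exact (hrow _ 0 _ (by norm_num)).trans (by fin_cases j <;> simp [e₀, ← e₁, e₂])
    all_goals exact (hz _ _ (by norm_num)).trans (by fin_cases j <;> rfl)
  · refine Or.inl ⟨l, (inner ℂ w₀ (k 1)).im, hl.le, ?_⟩
    ext i j; fin_cases i
    on_goal 5 => exact (hrow _ 0 _ (by norm_num)).trans (by fin_cases j <;> simp [e₀, ← e₁, e₂])
    all_goals exact (hz _ _ (by norm_num)).trans (by fin_cases j <;> rfl)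
  · refine Or.inl ⟨l, (inner ℂ w₀ (k 1)).im, hl.le, ?_⟩
    ext i j; fin_cases i
    on_goal 6 => exact (hrow _ 0 _ (by norm_num)).trans (by fin_cases j <;> simp [e₀, ← e₁, e₂])
    all_goals exact (hz _ _ (by norm_num)).trans (by fin_cases j <;> rfl)

/-- Here `2 ≤ r ≤ n - 2`, so `n ≥ 4` and there are at most four nonzero columns. The quadratic
relation in dimension six is the real orthogonality of the last two of them. -/
theorem isNormalForm_of_span_two {n r : ℕ} (hn₆ : n ≤ 6)
    (b : OrthonormalBasis (Fin n) ℂ H) {k : ℕ → H} (hr : r ≤ n) (hr₁ : 1 < r)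
    (hk : ∀ j, k j ≠ 0 ↔ j < r)
    (hkO : ∀ i j, i ≠ j → (inner ℂ (k i) (k j)).re = 0) {w₀ w₁ : H} {l₁ l₂ a : ℝ} (hl₁ : 0 < l₁)
    (hl₂ : 0 < l₂) (hw₀ : ‖w₀‖ = 1) (hw₁ : ‖w₁‖ = 1) (hw₀₁ : inner ℂ w₀ w₁ = 0)
    (e₀₀ : inner ℂ w₀ (k 0) = (l₁ : ℂ)) (e₁₀ : inner ℂ w₁ (k 0) = 0)
    (e₀₁ : inner ℂ w₀ (k 1) = Complex.I * (a : ℂ)) (e₁₁ : inner ℂ w₁ (k 1) = (l₂ : ℂ))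
    (hbw₀ : ∀ i : Fin n, i.val < r → inner ℂ (b i) w₀ = 0)
    (hbw₁ : ∀ i : Fin n, i.val < r → inner ℂ (b i) w₁ = 0)
    {p q : ℕ → ℝ} (e₀ : ∀ j, 2 ≤ j → inner ℂ w₀ (k j) = Complex.I * (p j : ℂ))
    (e₁ : ∀ j, 2 ≤ j → inner ℂ w₁ (k j) = Complex.I * (q j : ℂ) - a * p j / l₂)
    (hspan : ∀ j, k j ∈ Submodule.span ℂ (Set.range ![w₀, w₁])) :
    ∃ b' : OrthonormalBasis (Fin n) ℂ H, (∀ i : Fin n, i.val < r → b' i = b i) ∧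
      IsNormalForm n (Matrix.of fun i j => inner ℂ (b' i) (k j)) := by
  have hw := orthonormal_two hw₀ hw₁ hw₀₁
  have hbw' : ∀ i : Fin n, i.val < r → ∀ m, inner ℂ (b i) (![w₀, w₁] m) = 0 := by
    intro i hi m
    fin_cases m
    · exact hbw₀ i hi
    · exact hbw₁ i hi
  have hrd := card_add_card_le_of_orthonormal b hw hbw' hr
  have hk' : ∀ j, k j = (inner ℂ w₀ (k j) : ℂ) • w₀ + (inner ℂ w₁ (k j) : ℂ) • w₁ := by
    intro j
    have := eq_sum_of_mem_span hw (hspan j)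
    simpa [Fin.sum_univ_two] using this
  have h₂₃ : p 2 * p 3 + q 2 * q 3 + (a * p 2 / l₂) * (a * p 3 / l₂) = 0 := by
    have h := hkO 2 3 (by norm_num)
    rw [hk' 2, hk' 3, e₀ 2 le_rfl, e₀ 3 (by norm_num), e₁ 2 le_rfl, e₁ 3 (by norm_num),
      inner_add_left, inner_add_right, inner_add_right, inner_smul_left, inner_smul_right,
      inner_smul_left, inner_smul_right, inner_smul_left, inner_smul_right, inner_smul_left,
      inner_smul_right, inner_self_eq_norm_sq_to_K, inner_self_eq_norm_sq_to_K, hw₀, hw₁, hw₀₁,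
      inner_eq_zero_symm.1 hw₀₁] at h
    have c₂ : (a * p 2 / l₂ : ℂ) = ((a * p 2 / l₂ : ℝ) : ℂ) := by push_cast; rfl
    have c₃ : (a * p 3 / l₂ : ℂ) = ((a * p 3 / l₂ : ℝ) : ℂ) := by push_cast; rfl
    rw [c₂, c₃] at h
    simp [-Complex.ofReal_div, -Complex.ofReal_mul] at h
    linarith
  have hk0 : ∀ j, r ≤ j → k j = 0 := fun j hj => by
    by_contra hne
    exact absurd ((hk j).1 hne) (by omega)
  have hz₀ : ∀ j, r ≤ j → inner ℂ w₀ (k j) = 0 := fun j hj => by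
    rw [hk0 j (by omega), inner_zero_right]
  have hz₁ : ∀ j, r ≤ j → inner ℂ w₁ (k j) = 0 := fun j hj => by
    rw [hk0 j (by omega), inner_zero_right]
  obtain ⟨b', hb', hz, hrow⟩ := exists_adapted_basis b hw hbw' hrd hspan
  refine ⟨b', hb', ?_⟩
  have hn₄ : 4 ≤ n := by omega
  interval_cases n
  · refine Or.inr ⟨l₁, l₂, a, hl₁, hl₂, ?_⟩
    ext i j; fin_cases i
    on_goal 3 =>
      exact (hrow _ 0 _ (by norm_num)).trans
        (by fin_cases j <;> simp [e₀₀, e₀₁, hz₀ 2 (by omega), hz₀ 3 (by omega)])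
    on_goal 3 =>
      exact (hrow _ 1 _ (by norm_num)).trans
        (by fin_cases j <;> simp [e₁₀, e₁₁, hz₁ 2 (by omega), hz₁ 3 (by omega)])
    all_goals exact (hz _ _ (by norm_num)).trans (by fin_cases j <;> rfl)
  · refine Or.inr ⟨l₁, l₂, a, p 2, q 2, hl₁, hl₂, ?_⟩
    ext i j; fin_cases i
    on_goal 4 =>
      exact (hrow _ 0 _ (by norm_num)).trans
        (by fin_cases j <;> simp [e₀₀, e₀₁, e₀ 2, hz₀ 3 (by omega), hz₀ 4 (by omega)])
    on_goal 4 =>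
      exact (hrow _ 1 _ (by norm_num)).trans
        (by fin_cases j <;> simp [e₁₀, e₁₁, e₁ 2, hz₁ 3 (by omega), hz₁ 4 (by omega)])
    all_goals exact (hz _ _ (by norm_num)).trans (by fin_cases j <;> rfl)
  · refine Or.inr (Or.inl ⟨l₁, l₂, a, p 2, p 3, q 2, q 3, hl₁, hl₂, h₂₃, ?_⟩)
    ext i j; fin_cases i
    on_goal 5 =>
      exact (hrow _ 0 _ (by norm_num)).trans
        (by fin_cases j <;> simp [e₀₀, e₀₁, e₀ 2, e₀ 3, hz₀ 4 (by omega), hz₀ 5 (by omega)])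
    on_goal 5 =>
      exact (hrow _ 1 _ (by norm_num)).trans
        (by fin_cases j <;> simp [e₁₀, e₁₁, e₁ 2, e₁ 3, hz₁ 4 (by omega), hz₁ 5 (by omega)])
    all_goals exact (hz _ _ (by norm_num)).trans (by fin_cases j <;> rfl)

theorem isNormalForm_of_span_three (b : OrthonormalBasis (Fin 6) ℂ H) {k : ℕ → H}
    (hk : ∀ j, 3 ≤ j → k j = 0) {w₀ w₁ w₂ : H} {l₁ l₂ l₃ a p q : ℝ} (hl₁ : 0 < l₁)
    (hl₂ : 0 < l₂) (hl₃ : 0 < l₃) (hw : Orthonormal ℂ ![w₀, w₁, w₂])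
    (hbw : ∀ i : Fin 6, i.val < 3 → ∀ m, inner ℂ (b i) (![w₀, w₁, w₂] m) = 0)
    (e₀₀ : inner ℂ w₀ (k 0) = (l₁ : ℂ)) (e₁₀ : inner ℂ w₁ (k 0) = 0)
    (e₂₀ : inner ℂ w₂ (k 0) = 0) (e₀₁ : inner ℂ w₀ (k 1) = Complex.I * (a : ℂ))
    (e₁₁ : inner ℂ w₁ (k 1) = (l₂ : ℂ)) (e₂₁ : inner ℂ w₂ (k 1) = 0)
    (e₀₂ : inner ℂ w₀ (k 2) = Complex.I * (p : ℂ))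
    (e₁₂ : inner ℂ w₁ (k 2) = Complex.I * (q : ℂ) - a * p / l₂)
    (e₂₂ : inner ℂ w₂ (k 2) = (l₃ : ℂ))
    (hspan : ∀ j, k j ∈ Submodule.span ℂ (Set.range ![w₀, w₁, w₂])) :
    ∃ b' : OrthonormalBasis (Fin 6) ℂ H, (∀ i : Fin 6, i.val < 3 → b' i = b i) ∧
      IsNormalForm 6 (Matrix.of fun i j => inner ℂ (b' i) (k j)) := by
  obtain ⟨b', hb', hz, hrow⟩ := exists_adapted_basis b hw hbw (by norm_num) hspan
  refine ⟨b', hb', Or.inr (Or.inr ⟨l₁, l₂, l₃, a, p, q, hl₁, hl₂, hl₃, ?_⟩)⟩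
  ext i j; fin_cases i
  on_goal 4 =>
    exact (hrow _ 0 _ (by norm_num)).trans
      (by fin_cases j <;> simp [e₀₀, e₀₁, e₀₂, hk])
  on_goal 4 =>
    exact (hrow _ 1 _ (by norm_num)).trans
      (by fin_cases j <;> simp [e₁₀, e₁₁, e₁₂, hk])
  on_goal 4 =>
    exact (hrow _ 2 _ (by norm_num)).trans
      (by fin_cases j <;> simp [e₂₀, e₂₁, e₂₂, hk])
  all_goals exact (hz _ _ (by norm_num)).trans (by fin_cases j <;> rfl)

/-- Gram-Schmidt on the columns. Orthogonality to `k 0 = l₁ w₀` makes every later `w₀`-component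
imaginary, and orthogonality to `k 1 = i a w₀ + l₂ w₁` fixes the real part of the `w₁`-components as
`-a p / l₂`, where `p` is the imaginary part of the `w₀`-component. -/
theorem exists_isNormalForm_of_sorted {n r : ℕ} (hn₂ : 2 ≤ n) (hn₆ : n ≤ 6)
    (b : OrthonormalBasis (Fin n) ℂ H) {k : ℕ → H} (hr : r ≤ n) (hr₀ : 0 < r)
    (hk : ∀ j, k j ≠ 0 ↔ j < r)
    (hkO : ∀ i j, i ≠ j → (inner ℂ (k i) (k j)).re = 0)
    (hbk : ∀ i : Fin n, i.val < r → ∀ j, inner ℂ (b i) (k j) = 0)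
    (hdich : (∀ j, k j ∈ Submodule.span ℂ {k 0}) ∨ 1 < r ∧ k 1 ∉ Submodule.span ℂ {k 0}) :
    ∃ b' : OrthonormalBasis (Fin n) ℂ H, (∀ i : Fin n, i.val < r → b' i = b i) ∧
      IsNormalForm n (Matrix.of fun i j => inner ℂ (b' i) (k j)) := by
  have hk0 : ∀ j, r ≤ j → k j = 0 := fun j hj => by
    by_contra hne
    exact absurd ((hk j).1 hne) (by omega)
  obtain ⟨w₀, l₁, hl₁, hw₀, -, hx₀, e₀₀, hy₀⟩ := exists_unit_of_notMem_span
    (w := (![] : Fin 0 → H)) ⟨fun i => i.elim0, fun i => i.elim0⟩ (x := k 0)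
    (by simpa using (hk 0).2 hr₀)
  have hx₀' : k 0 = (l₁ : ℂ) • w₀ := by simpa using hx₀
  replace hy₀ : ∀ y, inner ℂ y (k 0) = 0 → inner ℂ y w₀ = 0 :=
    fun y hy => hy₀ y (fun m => m.elim0) hy
  have hl₁' : (l₁ : ℂ) ≠ 0 := by exact_mod_cast hl₁.ne'
  have hspan₀ : Submodule.span ℂ (Set.range ![w₀]) = Submodule.span ℂ {k 0} := by
    rw [hx₀', Submodule.span_singleton_smul_eq (IsUnit.mk0 _ hl₁')]
    simp
  have ha : ∀ j, 1 ≤ j → (inner ℂ w₀ (k j)).re = 0 := by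
    intro j hj
    have := hkO 0 j (by omega)
    rw [hx₀', inner_smul_left, Complex.conj_ofReal, Complex.re_ofReal_mul] at this
    exact (mul_eq_zero.1 this).resolve_left hl₁.ne'
  have hbw₀ : ∀ i : Fin n, i.val < r → inner ℂ (b i) w₀ = 0 := fun i hi => hy₀ _ (hbk i hi 0)
  rw [← hspan₀] at hdich
  rcases hdich with hsp | ⟨hr₁, hsp⟩
  · exact isNormalForm_of_span_one hn₂ hn₆ b hr hk hkO hl₁ hw₀ e₀₀ hbw₀ ha hsp
  obtain ⟨w₁, l₂, hl₂, hw₁, hw₀₁, hx₁, e₁₁, hy₁⟩ :=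
    exists_unit_of_notMem_span (orthonormal_one hw₀) hsp
  replace hw₀₁ : inner ℂ w₀ w₁ = 0 := hw₀₁ 0
  replace hx₁ : k 1 = (inner ℂ w₀ (k 1) : ℂ) • w₀ + (l₂ : ℂ) • w₁ := by simpa using hx₁
  have hl₂' : (l₂ : ℂ) ≠ 0 := by exact_mod_cast hl₂.ne'
  have e₀₁ := eq_I_mul_im (ha 1 le_rfl)
  set a := (inner ℂ w₀ (k 1)).im
  have e₁₀ : inner ℂ w₁ (k 0) = 0 := by
    rw [hx₀', inner_smul_right, inner_eq_zero_symm.1 hw₀₁, mul_zero]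
  have hbw₁ : ∀ i : Fin n, i.val < r → inner ℂ (b i) w₁ = 0 := fun i hi =>
    hy₁ _ (fun m => by rw [Subsingleton.elim m 0]; exact hbw₀ i hi) (hbk i hi 1)
  have e₀ : ∀ j, 2 ≤ j → inner ℂ w₀ (k j) = Complex.I * ((inner ℂ w₀ (k j)).im : ℂ) :=
    fun j hj => eq_I_mul_im (ha j (by omega))
  have e₁ : ∀ j, 2 ≤ j → inner ℂ w₁ (k j) = Complex.I * ((inner ℂ w₁ (k j)).im : ℂ)
      - a * ((inner ℂ w₀ (k j)).im : ℂ) / l₂ := by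
    intro j hj
    have h := hkO 1 j (by omega)
    rw [hx₁, inner_add_left, inner_smul_left, inner_smul_left, e₀ j hj, e₀₁] at h
    simp at h
    have hre : (inner ℂ w₁ (k j)).re = -(a * (inner ℂ w₀ (k j)).im / l₂) := by
      field_simp
      linarith
    have c : (a * ((inner ℂ w₀ (k j)).im : ℂ) / l₂ : ℂ)
        = ((a * (inner ℂ w₀ (k j)).im / l₂ : ℝ) : ℂ) := by push_cast; rfl
    rw [c]
    apply Complex.ext
    · rw [hre]; simp [-Complex.ofReal_div, -Complex.ofReal_mul]
    · simp [-Complex.ofReal_div, -Complex.ofReal_mul]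
  by_cases hsp₂ : ∀ j, k j ∈ Submodule.span ℂ (Set.range ![w₀, w₁])
  · exact isNormalForm_of_span_two hn₆ b hr hr₁ hk hkO hl₁ hl₂ hw₀ hw₁ hw₀₁ e₀₀ e₁₀ e₀₁ e₁₁ hbw₀
      hbw₁ e₀ e₁ hsp₂
  push Not at hsp₂
  obtain ⟨m, hm⟩ := hsp₂
  obtain ⟨w₂, l₃, hl₃, hw₂, hw₀₁₂, hx₂, e₂₂, hy₂⟩ :=
    exists_unit_of_notMem_span (orthonormal_two hw₀ hw₁ hw₀₁) hm
  have hw₀₂ : inner ℂ w₀ w₂ = 0 := hw₀₁₂ 0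
  have hw₁₂ : inner ℂ w₁ w₂ = 0 := hw₀₁₂ 1
  have m₀ : w₀ ∈ Submodule.span ℂ (Set.range ![w₀, w₁]) := Submodule.subset_span ⟨0, rfl⟩
  have m₁ : w₁ ∈ Submodule.span ℂ (Set.range ![w₀, w₁]) := Submodule.subset_span ⟨1, rfl⟩
  have hm0 : m ≠ 0 := by
    rintro rfl
    exact hm (hx₀' ▸ Submodule.smul_mem _ _ m₀)
  have hm1 : m ≠ 1 := by
    rintro rfl
    apply hm
    rw [hx₁]
    exact Submodule.add_mem _ (Submodule.smul_mem _ _ m₀) (Submodule.smul_mem _ _ m₁)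
  have hmr : m < r := (hk m).1 fun e => hm (e ▸ Submodule.zero_mem _)
  have hbw : ∀ i : Fin n, i.val < r → ∀ m, inner ℂ (b i) (![w₀, w₁, w₂] m) = 0 := by
    intro i hi t
    fin_cases t
    · exact hbw₀ i hi
    · exact hbw₁ i hi
    · refine hy₂ _ (fun t => ?_) (hbk i hi m)
      fin_cases t
      · exact hbw₀ i hi
      · exact hbw₁ i hi
  have hw := orthonormal_three hw₀ hw₁ hw₂ hw₀₁ hw₀₂ hw₁₂
  have hrd := card_add_card_le_of_orthonormal b hw hbw hr
  -- Rank three gives `r + 3 ≤ n ≤ 6`, while `m < r` differs from `0` and `1`; so everything is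
  -- forced.
  obtain rfl : m = 2 := by omega
  obtain rfl : r = 3 := by omega
  obtain rfl : n = 6 := by omega
  have s₀ : w₀ ∈ Submodule.span ℂ (Set.range ![w₀, w₁, w₂]) := Submodule.subset_span ⟨0, rfl⟩
  have s₁ : w₁ ∈ Submodule.span ℂ (Set.range ![w₀, w₁, w₂]) := Submodule.subset_span ⟨1, rfl⟩
  have s₂ : w₂ ∈ Submodule.span ℂ (Set.range ![w₀, w₁, w₂]) := Submodule.subset_span ⟨2, rfl⟩
  refine isNormalForm_of_span_three b hk0 hl₁ hl₂ hl₃ hw hbw e₀₀ e₁₀ ?_ e₀₁ e₁₁ ?_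
    (e₀ 2 le_rfl) (e₁ 2 le_rfl) e₂₂ fun j => ?_
  · rw [hx₀', inner_smul_right, inner_eq_zero_symm.1 hw₀₂, mul_zero]
  · rw [hx₁, inner_add_right, inner_smul_right, inner_smul_right, inner_eq_zero_symm.1 hw₀₂,
      inner_eq_zero_symm.1 hw₁₂, mul_zero, mul_zero, add_zero]
  · match j with
    | 0 => rw [hx₀']; exact Submodule.smul_mem _ _ s₀
    | 1 => rw [hx₁]; exact Submodule.add_mem _ (Submodule.smul_mem _ _ s₀) (Submodule.smul_mem _ _ s₁)
    | 2 =>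
      rw [hx₂, Fin.sum_univ_two]
      exact Submodule.add_mem _ (Submodule.add_mem _ (Submodule.smul_mem _ _ s₀)
        (Submodule.smul_mem _ _ s₁)) (Submodule.smul_mem _ _ s₂)
    | j + 3 => rw [hk0 _ (by omega)]; exact Submodule.zero_mem _

/-- A family `K` as in the structure theorem can be brought to normal form. -/
theorem exists_isNormalForm {n : ℕ} (hn₂ : 2 ≤ n) (hn₆ : n ≤ 6)
    (b : OrthonormalBasis (Fin n) ℂ H) {K : Fin n → H}
    (hO : ∀ i j, i ≠ j → (inner ℂ (K i) (K j)).re = 0)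
    (hZ : ∀ i j, K i ≠ 0 → inner ℂ (b i) (K j) = 0) :
    ∃ (b' : OrthonormalBasis (Fin n) ℂ H) (σ : Equiv.Perm (Fin n)),
      (∀ i, K (σ i) ≠ 0 → b' i = b (σ i)) ∧
      IsNormalForm n (Matrix.of fun i j => inner ℂ (b' i) (K (σ j))) := by
  classical
  set r := Fintype.card {i // K i ≠ 0} with hr
  have hrn : r ≤ n := by
    have : Fintype.card {i // K i ≠ 0} ≤ Fintype.card (Fin n) := Fintype.card_subtype_le _
    rwa [Fintype.card_fin] at this
  have hcard : Fintype.card {i : Fin n // i.val < r} = Fintype.card {i // K i ≠ 0} := by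
    rw [← hr, Fintype.card_subtype]
    simp [Fin.card_filter_val_lt, hrn]
  set e := Fintype.equivOfCardEq hcard
  set σ := e.extendSubtype with hσ
  have hσr : ∀ i, K (σ i) ≠ 0 ↔ i.val < r := by
    intro i
    refine ⟨fun h => ?_, fun h => e.extendSubtype_mem i h⟩
    by_contra hlt
    exact e.extendSubtype_not_mem i hlt h
  rcases Nat.eq_zero_or_pos r with hr0 | hr0
  · have hK : ∀ i, K (σ i) = 0 := fun i => by
      by_contra h
      exact absurd ((hσr i).1 h) (by omega)
    refine ⟨b, σ, fun i hi => absurd (hK i) hi, ?_⟩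
    convert isNormalForm_zero hn₂ hn₆
    ext i j
    simp [hK]
  have hdich : ∃ τ : Equiv.Perm (Fin n), (∀ i, K (τ i) ≠ 0 ↔ i.val < r) ∧
      ((∀ j, K (τ j) ∈ Submodule.span ℂ {K (τ ⟨0, by omega⟩)}) ∨
        1 < r ∧ K (τ ⟨1, by omega⟩) ∉ Submodule.span ℂ {K (τ ⟨0, by omega⟩)}) := by
    by_cases hc : ∀ j, K (σ j) ∈ Submodule.span ℂ {K (σ ⟨0, by omega⟩)}
    · exact ⟨σ, hσr, Or.inl hc⟩
    push Not at hc
    obtain ⟨m, hm⟩ := hc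
    have hm0 : m ≠ ⟨0, by omega⟩ := by
      rintro rfl
      exact hm (Submodule.mem_span_singleton_self _)
    have hm0' : m.val ≠ 0 := fun e => hm0 (Fin.ext e)
    have hmr : m.val < r := (hσr m).1 fun e => hm (e ▸ Submodule.zero_mem _)
    -- A column independent of the first is moved to second place; both positions lie among the
    -- nonzero columns.
    refine ⟨(Equiv.swap ⟨1, by omega⟩ m).trans σ, fun i => ?_, Or.inr ⟨by omega, ?_⟩⟩
    · rw [Equiv.trans_apply, hσr]
      rcases eq_or_ne i ⟨1, by omega⟩ with rfl | h1
      · rw [Equiv.swap_apply_left]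
        exact ⟨fun _ => by simp only; omega, fun _ => hmr⟩
      rcases eq_or_ne i m with rfl | h2
      · rw [Equiv.swap_apply_right]
        exact ⟨fun _ => hmr, fun _ => by simp only; omega⟩
      · rw [Equiv.swap_apply_of_ne_of_ne h1 h2]
    · rw [Equiv.trans_apply, Equiv.trans_apply, Equiv.swap_apply_left,
        Equiv.swap_apply_of_ne_of_ne (by simp) hm0.symm]
      exact hm
  obtain ⟨τ, hτr, hτ⟩ := hdich
  -- Padding by zero columns lets the reduction speak of columns `0, 1, 2, 3` uniformly in `n`.
  set k : ℕ → H := fun j => if hj : j < n then K (τ ⟨j, hj⟩) else 0 with hk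
  have hkv : ∀ j : Fin n, k j.val = K (τ j) := fun j => by simp [hk]
  have hkz : ∀ j, n ≤ j → k j = 0 := fun j hj => by simp [hk, hj]
  obtain ⟨b', hb', hnf⟩ := exists_isNormalForm_of_sorted hn₂ hn₆ (b.reindex τ.symm) (k := k) hrn hr0
    (fun j => by
      rcases lt_or_ge j n with hj | hj
      · rw [hkv ⟨j, hj⟩, hτr]
      · rw [hkz j hj]
        exact ⟨fun h => absurd rfl h, fun h => by omega⟩)
    (fun i j hij => by
      rcases lt_or_ge i n with hi | hi
      · rcases lt_or_ge j n with hj | hj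
        · rw [hkv ⟨i, hi⟩, hkv ⟨j, hj⟩]
          refine hO _ _ fun h => hij ?_
          exact congrArg Fin.val (τ.injective h)
        · rw [hkz j hj]; simp
      · rw [hkz i hi]; simp)
    (fun i hi j => by
      rw [OrthonormalBasis.reindex_apply, Equiv.symm_symm]
      rcases lt_or_ge j n with hj | hj
      · rw [hkv ⟨j, hj⟩]
        exact hZ _ _ ((hτr i).2 hi)
      · rw [hkz j hj]; simp)
    (by
      rw [hkv ⟨0, by omega⟩, hkv ⟨1, by omega⟩]
      refine hτ.imp_left fun h j => ?_
      rcases lt_or_ge j n with hj | hj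
      · rw [hkv ⟨j, hj⟩]; exact h _
      · rw [hkz j hj]; exact Submodule.zero_mem _)
  refine ⟨b', τ, fun i hi => ?_, ?_⟩
  · rw [hb' i ((hτr i).1 hi), OrthonormalBasis.reindex_apply, Equiv.symm_symm]
  · convert hnf using 1
    ext i j
    rw [Matrix.of_apply, Matrix.of_apply, hkv]

end NormalForms

/-! ### The Hermitian product of a diagonal bracket -/

section DiagonalBracket

attribute [local instance] InnerProductSpace.complexToReal

variable {H : Type*} [NormedAddCommGroup H] [InnerProductSpace ℂ H] {ι : Type*} [Fintype ι]

/-- The product `(x, y) ↦ -∑ j, ⟪c j, x⟫ y_j √-1 b j`. -/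
noncomputable def diagonalProduct (b : OrthonormalBasis ι ℂ H) (c : ι → H) : H →ₗ[ℝ] H →ₗ[ℝ] H :=
  LinearMap.mk₂ ℝ (fun x y => -∑ j, ⟪c j, x⟫_ℝ • (inner ℂ (b j) y : ℂ) • mulI H (b j))
    (fun x x' y => by
      simp only [inner_add_right, add_smul, Finset.sum_add_distrib, neg_add])
    (fun t x y => by
      simp only [real_inner_smul_right, mul_smul, Finset.smul_sum, smul_neg])
    (fun x y y' => by
      simp only [inner_add_right, add_smul, smul_add, Finset.sum_add_distrib, neg_add])
    (fun t x y => by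
      simp only [← Complex.coe_smul t, inner_smul_right, mul_smul, Finset.smul_sum, smul_neg]
      simp only [Complex.coe_smul, smul_comm t])

theorem diagonalProduct_apply (b : OrthonormalBasis ι ℂ H) (c : ι → H) (x y : H) :
    diagonalProduct b c x y
      = -∑ j, ⟪c j, x⟫_ℝ • (inner ℂ (b j) y : ℂ) • mulI H (b j) := rfl

theorem mulI_eq_smul (x : H) : mulI H x = Complex.I • x := rfl

theorem inner_basis_diagonalProduct (b : OrthonormalBasis ι ℂ H) (c : ι → H) (x y : H) (j : ι) :
    inner ℂ (b j) (diagonalProduct b c x y)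
      = -((⟪c j, x⟫_ℝ : ℝ) : ℂ) * Complex.I * inner ℂ (b j) y := by
  classical
  rw [diagonalProduct_apply, inner_neg_right, inner_sum, Finset.sum_eq_single j]
  · rw [← Complex.coe_smul, inner_smul_right, inner_smul_right, mulI_eq_smul, inner_smul_right,
      inner_self_eq_norm_sq_to_K, b.orthonormal.1]
    simp
    ring
  · intro i _ hij
    rw [← Complex.coe_smul, inner_smul_right, inner_smul_right, mulI_eq_smul, inner_smul_right,
      b.orthonormal.2 hij.symm]
    simp
  · simp

theorem ext_inner_basis (b : OrthonormalBasis ι ℂ H) {x y : H}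
    (hxy : ∀ j, inner ℂ (b j) x = inner ℂ (b j) y) : x = y := by
  rw [← b.sum_repr' x, ← b.sum_repr' y]
  exact Finset.sum_congr rfl fun j _ => by rw [hxy]

theorem real_inner_eq_sum (b : OrthonormalBasis ι ℂ H) (x y : H) :
    ⟪x, y⟫_ℝ = ∑ j, (conj (inner ℂ (b j) x) * inner ℂ (b j) y).re := by
  rw [← re_inner_complex, ← b.sum_inner_mul_inner, Complex.re_sum]
  refine Finset.sum_congr rfl fun j _ => ?_
  rw [inner_conj_symm]

theorem inner_diagonalProduct (b : OrthonormalBasis ι ℂ H) (c : ι → H) (x y z : H) :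
    ⟪diagonalProduct b c x y, z⟫_ℝ
      = -∑ j, ⟪c j, x⟫_ℝ * (conj (inner ℂ (b j) y) * inner ℂ (b j) z).im := by
  rw [real_inner_eq_sum b, ← Finset.sum_neg_distrib]
  refine Finset.sum_congr rfl fun j _ => ?_
  rw [inner_basis_diagonalProduct]
  simp
  ring

theorem diagonalProduct_mulI (b : OrthonormalBasis ι ℂ H) (c : ι → H) (x y : H) :
    diagonalProduct b c x (mulI H y) = mulI H (diagonalProduct b c x y) := by
  refine ext_inner_basis b fun j => ?_
  rw [inner_basis_diagonalProduct, mulI_eq_smul, mulI_eq_smul, inner_smul_right, inner_smul_right,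
    inner_basis_diagonalProduct]
  ring

theorem im_conj_mul_comm (a b : ℂ) : (conj a * b).im = -(conj b * a).im := by
  simp
  ring

theorem diagonalProduct_skew (b : OrthonormalBasis ι ℂ H) (c : ι → H) (x : H) :
    IsSkewOp (diagonalProduct b c x) := by
  intro y z
  rw [inner_diagonalProduct, real_inner_comm, inner_diagonalProduct, ← Finset.sum_neg_distrib,
    neg_neg]
  refine Finset.sum_congr rfl fun j _ => ?_
  rw [im_conj_mul_comm]
  ring

variable {br : H →ₗ[ℝ] H →ₗ[ℝ] H} {b : OrthonormalBasis ι ℂ H} {c : ι → H}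
  (hbr : ∀ x y, br x y = ∑ i, (conj (inner ℂ (b i) x) * inner ℂ (b i) y).im • c i)
include hbr

/-- Paired with `z`, the torsion is minus the cyclic sum over `x, y, z` of `∑ j, ⟪c j, x⟫ Im(conj
y_j * z_j)`, which is visibly alternating. -/
theorem algTor_diagonalProduct_skew (x : H) : IsSkewOp (algTor br (diagonalProduct b c) x) := by
  have hb : ∀ x y z, ⟪br x y, z⟫_ℝ
      = ∑ j, ⟪c j, z⟫_ℝ * (conj (inner ℂ (b j) x) * inner ℂ (b j) y).im := by
    intro x y z
    rw [hbr, sum_inner]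
    exact Finset.sum_congr rfl fun j _ => by rw [real_inner_smul_left, mul_comm]
  intro y z
  rw [real_inner_comm, IsKahlerLikeAlgebra.algTor_apply, IsKahlerLikeAlgebra.algTor_apply,
    inner_sub_right, inner_sub_right, inner_sub_right, inner_sub_right,
    real_inner_comm _ z, real_inner_comm _ z, real_inner_comm _ z, real_inner_comm _ y,
    real_inner_comm _ y, real_inner_comm _ y, hb, hb,
    inner_diagonalProduct, inner_diagonalProduct, inner_diagonalProduct, inner_diagonalProduct]
  rw [← sub_eq_zero]
  simp only [← Finset.sum_neg_distrib, ← Finset.sum_sub_distrib]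
  refine Finset.sum_eq_zero fun j _ => ?_
  rw [im_conj_mul_comm (inner ℂ (b j) z) (inner ℂ (b j) y)]
  ring

/-- The diagonal operators commute, so only the bracket term contributes, and orthogonality of the
`c i` isolates `‖c j‖²`. -/
theorem algCurv_diagonalProduct (hc : ∀ i j, i ≠ j → ⟪c i, c j⟫_ℝ = 0) (x y z : H) (j : ι) :
    inner ℂ (b j) (algCurv br (diagonalProduct b c) x y z)
      = ((conj (inner ℂ (b j) x) * inner ℂ (b j) y).im * ‖c j‖ ^ 2 : ℝ) * Complex.I
        * inner ℂ (b j) z := by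
  classical
  have e : ⟪c j, br x y⟫_ℝ = (conj (inner ℂ (b j) x) * inner ℂ (b j) y).im * ‖c j‖ ^ 2 := by
    rw [hbr, inner_sum, Finset.sum_eq_single j]
    · rw [real_inner_smul_right, real_inner_self_eq_norm_sq]
    · intro i _ hij
      rw [real_inner_smul_right, hc j i hij.symm, mul_zero]
    · simp
  rw [IsKahlerLikeAlgebra.algCurv_apply, inner_sub_right, inner_sub_right,
    inner_basis_diagonalProduct, inner_basis_diagonalProduct, inner_basis_diagonalProduct,
    inner_basis_diagonalProduct, inner_basis_diagonalProduct, e]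
  ring

/-- In each coordinate this is the identity `Im(ū v) w + Im(v̄ w) u + Im(w̄ u) v = 0` for complex
numbers. -/
theorem bianchi_diagonalProduct (hc : ∀ i j, i ≠ j → ⟪c i, c j⟫_ℝ = 0) (x y z : H) :
    algCurv br (diagonalProduct b c) x y z + algCurv br (diagonalProduct b c) y z x
      + algCurv br (diagonalProduct b c) z x y = 0 := by
  refine ext_inner_basis b fun j => ?_
  rw [inner_add_right, inner_add_right, algCurv_diagonalProduct hbr hc,
    algCurv_diagonalProduct hbr hc, algCurv_diagonalProduct hbr hc, inner_zero_right]
  generalize (inner ℂ (b j) x : ℂ) = u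
  generalize (inner ℂ (b j) y : ℂ) = v
  generalize (inner ℂ (b j) z : ℂ) = w
  apply Complex.ext
  · simp
    ring
  · simp
    ring

end DiagonalBracket

set_option maxHeartbeats 2000000 in
/-- The columns of a normal form are orthogonal for the real inner product. -/
theorem IsNormalForm.sum_re_eq_zero {n : ℕ} {A : Matrix (Fin n) (Fin n) ℂ} (hA : IsNormalForm n A)
    {i j : Fin n} (hij : i ≠ j) : ∑ k, (conj (A k i) * A k j).re = 0 := by
  match n, A, i, j, hij, hA with
  | 0, _, i, _, _, _ => exact i.elim0
  | 1, _, _, _, _, hA => exact hA.elim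
  | n + 7, _, _, _, _, hA => exact hA.elim
  | 2, A, i, j, hij, hA =>
    obtain ⟨l, -, rfl⟩ := hA
    fin_cases i <;> fin_cases j <;> first | exact absurd rfl hij | simp [Fin.sum_univ_succ]
  | 3, A, i, j, hij, hA =>
    obtain ⟨l, a, -, rfl⟩ := hA
    fin_cases i <;> fin_cases j <;> first | exact absurd rfl hij | simp [Fin.sum_univ_succ]
  | 4, A, i, j, hij, .inl hA =>
    obtain ⟨l, a, -, rfl⟩ := hA
    fin_cases i <;> fin_cases j <;> first | exact absurd rfl hij | simp [Fin.sum_univ_succ]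
  | 4, A, i, j, hij, .inr hA =>
    obtain ⟨l₁, l₂, a, -, h₂, rfl⟩ := hA
    fin_cases i <;> fin_cases j <;> first | exact absurd rfl hij | simp [Fin.sum_univ_succ]
  | 5, A, i, j, hij, .inl hA =>
    obtain ⟨l, a, -, rfl⟩ := hA
    fin_cases i <;> fin_cases j <;> first | exact absurd rfl hij | simp [Fin.sum_univ_succ]
  | 5, A, i, j, hij, .inr hA =>
    obtain ⟨l₁, l₂, a, p, q, -, h₂, rfl⟩ := hA
    -- The quotient is kept as one real number, so that real parts simplify and `e'` closes the
    -- goals linearly.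
    have e : (a * p / l₂ : ℂ) = ((a * p / l₂ : ℝ) : ℂ) := by push_cast; rfl
    have e' : l₂ * (a * p / l₂) = a * p := by field_simp
    rw [e]
    fin_cases i <;> fin_cases j <;>
      first
      | exact absurd rfl hij
      | (simp [Fin.sum_univ_succ, -Complex.ofReal_div, -Complex.ofReal_mul]; done)
      | (simp [Fin.sum_univ_succ, -Complex.ofReal_div, -Complex.ofReal_mul]; linarith)
  | 6, A, i, j, hij, .inl hA =>
    obtain ⟨l, a, -, rfl⟩ := hA
    fin_cases i <;> fin_cases j <;> first | exact absurd rfl hij | simp [Fin.sum_univ_succ]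
  | 6, A, i, j, hij, .inr (.inl hA) =>
    obtain ⟨l₁, l₂, a, p, p', q, q', -, h₂, hrel, rfl⟩ := hA
    have e : (a * p / l₂ : ℂ) = ((a * p / l₂ : ℝ) : ℂ) := by push_cast; rfl
    have f : (a * p' / l₂ : ℂ) = ((a * p' / l₂ : ℝ) : ℂ) := by push_cast; rfl
    have e' : l₂ * (a * p / l₂) = a * p := by field_simp
    have f' : l₂ * (a * p' / l₂) = a * p' := by field_simp
    rw [e, f]
    fin_cases i <;> fin_cases j <;>
      first
      | exact absurd rfl hij
      | (simp [Fin.sum_univ_succ, -Complex.ofReal_div, -Complex.ofReal_mul]; done)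
      | (simp [Fin.sum_univ_succ, -Complex.ofReal_div, -Complex.ofReal_mul]; linarith)
  | 6, A, i, j, hij, .inr (.inr hA) =>
    obtain ⟨l₁, l₂, l₃, a, p, q, -, h₂, -, rfl⟩ := hA
    have e : (a * p / l₂ : ℂ) = ((a * p / l₂ : ℝ) : ℂ) := by push_cast; rfl
    have e' : l₂ * (a * p / l₂) = a * p := by field_simp
    rw [e]
    fin_cases i <;> fin_cases j <;>
      first
      | exact absurd rfl hij
      | (simp [Fin.sum_univ_succ, -Complex.ofReal_div, -Complex.ofReal_mul]; done)
      | (simp [Fin.sum_univ_succ, -Complex.ofReal_div, -Complex.ofReal_mul]; linarith)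

/-! ### Left invariant frames on a Lie group -/

section LeftInvariantFrame

variable {E : Type*} [NormedAddCommGroup E] [NormedSpace ℝ E]
  {G : Type*} [TopologicalSpace G] [ChartedSpace E G] [Group G] [LieGroup 𝓘(ℝ, E) ∞ G]

theorem mdifferentiableAt_leftMul (p q : G) :
    MDifferentiableAt 𝓘(ℝ, E) 𝓘(ℝ, E) (fun x : G => p * x) q :=
  (contMDiff_mul_left (I := 𝓘(ℝ, E)) (n := ∞)).contMDiffAt.mdifferentiableAt (by simp)

theorem isInvertible_mfderiv_mul_left (p q : G) :
    (mfderiv 𝓘(ℝ, E) 𝓘(ℝ, E) (fun x : G => p * x) q).IsInvertible := by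
  have A : (mfderiv 𝓘(ℝ, E) 𝓘(ℝ, E) (fun x : G => p⁻¹ * x) (p * q)).comp
      (mfderiv 𝓘(ℝ, E) 𝓘(ℝ, E) (fun x : G => p * x) q) = ContinuousLinearMap.id _ _ := by
    rw [← mfderiv_comp (I' := 𝓘(ℝ, E)) q (mdifferentiableAt_leftMul p⁻¹ (p * q))
      (mdifferentiableAt_leftMul p q)]
    have : (fun x : G => p⁻¹ * x) ∘ (fun x => p * x) = id := by ext x; simp
    rw [this, mfderiv_id]
  have A' : (mfderiv 𝓘(ℝ, E) 𝓘(ℝ, E) (fun x : G => p * x) q).comp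
      (mfderiv 𝓘(ℝ, E) 𝓘(ℝ, E) (fun x : G => p⁻¹ * x) (p * q)) = ContinuousLinearMap.id _ _ := by
    have h := mfderiv_comp (I := 𝓘(ℝ, E)) (I' := 𝓘(ℝ, E)) (I'' := 𝓘(ℝ, E)) (p * q)
      (mdifferentiableAt_leftMul p (p⁻¹ * (p * q)))
      (mdifferentiableAt_leftMul (E := E) p⁻¹ (p * q))
    have : (fun x : G => p * x) ∘ (fun x => p⁻¹ * x) = id := by ext x; simp
    rw [this, mfderiv_id, inv_mul_cancel_left p q] at h
    exact h.symm
  exact ⟨ContinuousLinearEquiv.equivOfInverse _ _ (fun x => congr($A x)) (fun x => congr($A' x)),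
    rfl⟩

/-- The field is the tangent map of multiplication applied to the smooth section `g ↦ ((g, 0), (1,
v))`. -/
theorem contMDiff_infty_mulInvariantVectorField (v : GroupLieAlgebra 𝓘(ℝ, E) G) :
    IsSmoothField (M := G) (mulInvariantVectorField v) := by
  let fg : G → TangentBundle 𝓘(ℝ, E) G := fun g => TotalSpace.mk' E g 0
  have sfg : ContMDiff 𝓘(ℝ, E) 𝓘(ℝ, E).tangent ∞ fg := contMDiff_zeroSection _ _
  let fv : G → TangentBundle 𝓘(ℝ, E) G := fun _ => TotalSpace.mk' E 1 v
  have sfv : ContMDiff 𝓘(ℝ, E) 𝓘(ℝ, E).tangent ∞ fv := contMDiff_const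
  have S₁ := sfg.prodMk sfv
  have S₂ := (contMDiff_equivTangentBundleProd_symm (n := ∞) (I := 𝓘(ℝ, E)) (M := G)
    (I' := 𝓘(ℝ, E)) (M' := G)).comp S₁
  have S₃ : ContMDiff (𝓘(ℝ, E).prod 𝓘(ℝ, E)).tangent 𝓘(ℝ, E).tangent ∞
      (tangentMap (𝓘(ℝ, E).prod 𝓘(ℝ, E)) 𝓘(ℝ, E) (fun p : G × G => p.1 * p.2)) :=
    ContMDiff.contMDiff_tangentMap (contMDiff_mul 𝓘(ℝ, E) ∞) (by simp)
  have S := S₃.comp S₂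
  unfold IsSmoothField
  convert S using 2 with g
  refine Bundle.TotalSpace.ext (by simp [fg, fv, tangentMap]) ?_
  refine heq_of_eq ?_
  have h := mfderiv_prod_eq_add_apply (I := 𝓘(ℝ, E)) (I' := 𝓘(ℝ, E)) (I'' := 𝓘(ℝ, E))
    (f := fun p : G × G => p.1 * p.2) (p := (g, 1)) (v := ((0 : TangentSpace 𝓘(ℝ, E) g), v))
    ((contMDiff_mul 𝓘(ℝ, E) ∞).mdifferentiableAt (by simp))
  refine Eq.trans ?_ h.symm
  rw [map_zero]
  exact (zero_add _).symm
end LeftInvariantFrame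

/-! ### Left invariant frames and the unitary model of the Lie algebra -/

section UnitaryModel

attribute [local instance] InnerProductSpace.complexToReal

variable {E : Type*} [NormedAddCommGroup E] [NormedSpace ℝ E]
  {G : Type*} [TopologicalSpace G] [ChartedSpace E G] [Group G] [LieGroup 𝓘(ℝ, E) ∞ G]
  {H : Type*} [NormedAddCommGroup H] [InnerProductSpace ℂ H]

/-- The derivative at the identity of the left translation by `p`. -/
noncomputable def leftTranslation (E : Type*) [NormedAddCommGroup E] [NormedSpace ℝ E]
    {G : Type*} [TopologicalSpace G] [ChartedSpace E G] [Group G] (p : G) :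
    GroupLieAlgebra 𝓘(ℝ, E) G →L[ℝ] TangentSpace 𝓘(ℝ, E) p :=
  mfderiv 𝓘(ℝ, E) 𝓘(ℝ, E) (fun x : G => p * x) 1

/-- The left invariant frame of the Lie group `G` which is induced by a linear isomorphism of the
Lie algebra of `G` with `H`. -/
noncomputable def leftFrame (Φ : GroupLieAlgebra 𝓘(ℝ, E) G ≃L[ℝ] H) (p : G) :
    H →L[ℝ] TangentSpace 𝓘(ℝ, E) p :=
  leftTranslation E p ∘L Φ.symm.toContinuousLinearMap

/-- The left invariant coframe of the Lie group `G` which is induced by a linear isomorphism of the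
Lie algebra of `G` with `H`. -/
noncomputable def leftCoframe (Φ : GroupLieAlgebra 𝓘(ℝ, E) G ≃L[ℝ] H) (p : G) :
    TangentSpace 𝓘(ℝ, E) p →L[ℝ] H :=
  Φ.toContinuousLinearMap ∘L (leftTranslation E p).inverse

/-- The bracket on `H` which corresponds to that of the Lie algebra of `G`. -/
noncomputable def modelBracket (Φ : GroupLieAlgebra 𝓘(ℝ, E) G ≃L[ℝ] H) [CompleteSpace E] :
    H →ₗ[ℝ] H →ₗ[ℝ] H :=
  LinearMap.mk₂ ℝ (fun x y => Φ ⁅Φ.symm x, Φ.symm y⁆)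
    (fun x x' y => by rw [map_add, add_lie, map_add])
    (fun c x y => by rw [map_smul, smul_lie, map_smul])
    (fun x y y' => by rw [map_add, lie_add, map_add])
    (fun c x y => by rw [map_smul, lie_smul, map_smul])

variable (Φ : GroupLieAlgebra 𝓘(ℝ, E) G ≃L[ℝ] H)

omit [LieGroup 𝓘(ℝ, E) ∞ G] in
theorem leftFrame_eq (x : H) :
    (fun p => leftFrame Φ p x) = mulInvariantVectorField (Φ.symm x) := rfl

omit [LieGroup 𝓘(ℝ, E) ∞ G] in
theorem leftFrame_apply (p : G) (x : H) :
    leftFrame Φ p x = leftTranslation E p (Φ.symm x) := rfl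

theorem isInvertible_leftTranslation (p : G) : (leftTranslation E p).IsInvertible := by
  have h := isInvertible_mfderiv_mul_left (E := E) p 1
  unfold leftTranslation
  obtain ⟨e, he⟩ := h
  exact ⟨e, he⟩

@[simp] theorem leftCoframe_leftFrame (p : G) (x : H) : leftCoframe Φ p (leftFrame Φ p x) = x := by
  have h : (leftTranslation E p).inverse (leftTranslation E p (Φ.symm x)) = Φ.symm x :=
    (isInvertible_leftTranslation p).inverse_apply_eq.2 rfl
  rw [leftFrame_apply, leftCoframe, ContinuousLinearMap.comp_apply, h]
  exact Φ.apply_symm_apply x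

@[simp] theorem leftFrame_leftCoframe (p : G) (v : TangentSpace 𝓘(ℝ, E) p) :
    leftFrame Φ p (leftCoframe Φ p v) = v := by
  have h := (isInvertible_leftTranslation (E := E) p).self_apply_inverse v
  rw [leftFrame_apply, leftCoframe, ContinuousLinearMap.comp_apply]
  exact (congrArg (leftTranslation E p) (Φ.symm_apply_apply _)).trans h

theorem leftCoframe_injective (p : G) : Function.Injective (leftCoframe Φ p) :=
  Function.LeftInverse.injective (leftFrame_leftCoframe Φ p)

theorem isSmoothField_leftFrame (x : H) : IsSmoothField (M := G) (fun p => leftFrame Φ p x) :=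
  contMDiff_infty_mulInvariantVectorField (Φ.symm x)

theorem leftTranslation_mul (a p : G) (v : GroupLieAlgebra 𝓘(ℝ, E) G) :
    leftTranslation E (a * p) v
      = mfderiv 𝓘(ℝ, E) 𝓘(ℝ, E) (fun x : G => a * x) p (leftTranslation E p v) := by
  have h := mfderiv_comp (I := 𝓘(ℝ, E)) (I' := 𝓘(ℝ, E)) (I'' := 𝓘(ℝ, E)) (1 : G)
    (mdifferentiableAt_leftMul (E := E) a (p * 1)) (mdifferentiableAt_leftMul p 1)
  have h' : (fun x : G => a * x) ∘ (fun x => p * x) = fun x => a * p * x := by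
    ext x; simp [mul_assoc]
  rw [h'] at h
  -- The chain rule produces the base point `p * 1`; the fibres are compared inside `E` to pass to
  -- `p`.
  have key : ∀ q, q = p → ∀ w : E, (mfderiv 𝓘(ℝ, E) 𝓘(ℝ, E) (fun x : G => a * x) q : E → E) w
      = (mfderiv 𝓘(ℝ, E) 𝓘(ℝ, E) (fun x : G => a * x) p : E → E) w := by
    rintro q rfl w; rfl
  exact congr($h v).trans (key _ (mul_one p) _)

theorem leftFrame_mul (a p : G) (x : H) :
    leftFrame Φ (a * p) x
      = mfderiv 𝓘(ℝ, E) 𝓘(ℝ, E) (fun x : G => a * x) p (leftFrame Φ p x) :=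
  leftTranslation_mul a p _

theorem leftCoframe_mul (a p : G) (v : TangentSpace 𝓘(ℝ, E) p) :
    leftCoframe Φ (a * p) (mfderiv 𝓘(ℝ, E) 𝓘(ℝ, E) (fun x : G => a * x) p v)
      = leftCoframe Φ p v := by
  have h := leftFrame_mul Φ a p (leftCoframe Φ p v)
  rw [leftFrame_leftCoframe] at h
  rw [← h, leftCoframe_leftFrame]

theorem mlieBracket_leftFrame [CompleteSpace E] (x y : H) :
    VectorField.mlieBracket 𝓘(ℝ, E) (fun p : G => leftFrame Φ p x) (fun p => leftFrame Φ p y)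
      = fun p => leftFrame Φ p (modelBracket Φ x y) := by
  have h := mulInvariantVector_mlieBracket (I := 𝓘(ℝ, E)) (G := G) (Φ.symm x) (Φ.symm y)
  rw [leftFrame_eq, leftFrame_eq, leftFrame_eq, ← h, modelBracket, LinearMap.mk₂_apply,
    Φ.symm_apply_apply, GroupLieAlgebra.bracket_def]

theorem contMDiffAt_metric (S : HermitianStructure E G) {X Y : VField E G} {n : ℕ∞ω} (hn : n ≤ ∞)
    {p : G}
    (hX : ContMDiffAt 𝓘(ℝ, E) 𝓘(ℝ, E).tangent n
      (fun p => (⟨p, X p⟩ : TangentBundle 𝓘(ℝ, E) G)) p)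
    (hY : ContMDiffAt 𝓘(ℝ, E) 𝓘(ℝ, E).tangent n
      (fun p => (⟨p, Y p⟩ : TangentBundle 𝓘(ℝ, E) G)) p) :
    ContMDiffAt 𝓘(ℝ, E) 𝓘(ℝ, ℝ) n (fun p => S.g.inner p (X p) (Y p)) p := by
  have h := ContMDiffAt.clm_bundle_apply₂ (F₃ := ℝ) (E₃ := Trivial G ℝ)
    ((S.g.contMDiff p).of_le hn) hX hY
  rw [contMDiffAt_section] at h
  exact h

theorem mdifferentiableAt_metric (S : HermitianStructure E G) {X Y : VField E G} {p : G}
    (hX : MDifferentiableAt 𝓘(ℝ, E) 𝓘(ℝ, E).tangent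
      (fun p => (⟨p, X p⟩ : TangentBundle 𝓘(ℝ, E) G)) p)
    (hY : MDifferentiableAt 𝓘(ℝ, E) 𝓘(ℝ, E).tangent
      (fun p => (⟨p, Y p⟩ : TangentBundle 𝓘(ℝ, E) G)) p) :
    MDifferentiableAt 𝓘(ℝ, E) 𝓘(ℝ, ℝ) (fun p => S.g.inner p (X p) (Y p)) p := by
  have h := MDifferentiableAt.clm_bundle_apply₂ (F₃ := ℝ) (E₃ := Trivial G ℝ)
    ((S.g.contMDiff p).mdifferentiableAt (by simp)) hX hY
  rw [mdifferentiableAt_section] at h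
  exact h

omit [Group G] [LieGroup 𝓘(ℝ, E) ∞ G] in
theorem mvfderiv_clm_comp_apply {F F' : Type*} [NormedAddCommGroup F] [NormedSpace ℝ F]
    [NormedAddCommGroup F'] [NormedSpace ℝ F'] (L : F →L[ℝ] F') {u : G → F} {p : G}
    (hu : MDifferentiableAt 𝓘(ℝ, E) 𝓘(ℝ, F) u p) (v : TangentSpace 𝓘(ℝ, E) p) :
    mvfderiv 𝓘(ℝ, E) (fun q => L (u q)) p v = L (mvfderiv 𝓘(ℝ, E) u p v) := by
  have h := mfderiv_comp p (L.mdifferentiableAt (x := u p)) hu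
  rw [ContinuousLinearMap.mfderiv_eq] at h
  exact congr($h v)

theorem contMDiffAt_mvfderiv_apply {F : Type*} [NormedAddCommGroup F] [NormedSpace ℝ F]
    {u : G → F} {X : VField E G} {p : G} (hu : ContMDiff 𝓘(ℝ, E) 𝓘(ℝ, F) ∞ u)
    (hX : ContMDiffAt 𝓘(ℝ, E) 𝓘(ℝ, E).tangent ∞
      (fun p => (⟨p, X p⟩ : TangentBundle 𝓘(ℝ, E) G)) p) :
    ContMDiffAt 𝓘(ℝ, E) 𝓘(ℝ, F) ∞ (fun q => mvfderiv 𝓘(ℝ, E) u q (X q)) p :=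
  ((contMDiff_snd_tangentBundle_modelSpace F 𝓘(ℝ, F)).contMDiffAt).comp p
    ((hu.contMDiff_tangentMap (m := ∞) (by simp)).contMDiffAt.comp p hX)

theorem IsSmoothField.mlieBracket [CompleteSpace E] {X Y : VField E G} (hX : IsSmoothField X)
    (hY : IsSmoothField Y) : IsSmoothField (VectorField.mlieBracket 𝓘(ℝ, E) X Y) := fun p =>
  haveI : IsManifold 𝓘(ℝ, E) ((⊤ : ℕ∞) + 1) G := inferInstanceAs (IsManifold 𝓘(ℝ, E) ∞ G)
  ContMDiffAt.mlieBracket_vectorField (m := ⊤) (n := ⊤) (hX p) (hY p) (by simp)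

/-- The commutator formula `X Y f - Y X f = [X, Y] f` is read off from the Jacobi identity for `X`,
`Y` and `f • W`, with `W` a left invariant field: after the identity for `W` is removed, the
coefficient of `W` remains. -/
theorem mvfderiv_comm_smul (Φ : GroupLieAlgebra 𝓘(ℝ, E) G ≃L[ℝ] H) [FiniteDimensional ℝ E] {X Y : VField E G}
    (hX : IsSmoothField X) (hY : IsSmoothField Y) {f : G → ℝ}
    (hf : ContMDiff 𝓘(ℝ, E) 𝓘(ℝ, ℝ) ∞ f) (p : G) (h : H) :
    mvfderiv 𝓘(ℝ, E) (fun q => mvfderiv 𝓘(ℝ, E) f q (Y q)) p (X p) • h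
      = (mvfderiv 𝓘(ℝ, E) (fun q => mvfderiv 𝓘(ℝ, E) f q (X q)) p (Y p)
        + mvfderiv 𝓘(ℝ, E) f p (VectorField.mlieBracket 𝓘(ℝ, E) X Y p)) • h := by
  apply (Function.LeftInverse.injective (leftCoframe_leftFrame Φ p))
  have h2 : minSmoothness ℝ 2 ≤ (∞ : ℕ∞ω) := by
    rw [minSmoothness_of_isRCLikeNormedField]; exact ENat.LEInfty.out
  set W : VField E G := fun q => leftFrame Φ q h with hW
  have sW : IsSmoothField W := isSmoothField_leftFrame Φ h
  have sd : ∀ {Z : VField E G}, IsSmoothField Z → ∀ {q}, MDifferentiableAt 𝓘(ℝ, E)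
      𝓘(ℝ, E).tangent (fun p => (⟨p, Z p⟩ : TangentBundle 𝓘(ℝ, E) G)) q :=
    fun {Z} hZ {q} => (hZ q).mdifferentiableAt (by simp)
  have sf : ∀ {q}, MDifferentiableAt 𝓘(ℝ, E) 𝓘(ℝ, ℝ) f q :=
    fun {q} => (hf q).mdifferentiableAt (by simp)
  have sdf : ∀ {Z : VField E G}, IsSmoothField Z → ∀ {q}, MDifferentiableAt 𝓘(ℝ, E) 𝓘(ℝ, ℝ)
      (fun q => mvfderiv 𝓘(ℝ, E) f q (Z q)) q := fun {Z} hZ {q} =>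
    (contMDiffAt_mvfderiv_apply hf (hZ q)).mdifferentiableAt (by simp)
  have sfW : IsSmoothField (f • W) := fun q => (hf q).smul_section (sW q)
  have e : ∀ {Z : VField E G}, VectorField.mlieBracket 𝓘(ℝ, E) Z (f • W)
      = (fun q => mvfderiv 𝓘(ℝ, E) f q (Z q)) • W + f • VectorField.mlieBracket 𝓘(ℝ, E) Z W :=
    fun {Z} => by
      ext q
      rw [VectorField.mlieBracket_smul_right sf (sd sW)]
      rfl
  have e2 : ∀ {Z Z' : VField E G}, IsSmoothField Z → IsSmoothField Z' →
      VectorField.mlieBracket 𝓘(ℝ, E) Z' (VectorField.mlieBracket 𝓘(ℝ, E) Z (f • W)) p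
        = (mvfderiv 𝓘(ℝ, E) (fun q => mvfderiv 𝓘(ℝ, E) f q (Z q)) p (Z' p) • W p
          + mvfderiv 𝓘(ℝ, E) f p (Z p) • VectorField.mlieBracket 𝓘(ℝ, E) Z' W p)
          + (mvfderiv 𝓘(ℝ, E) f p (Z' p) • VectorField.mlieBracket 𝓘(ℝ, E) Z W p
          + f p • VectorField.mlieBracket 𝓘(ℝ, E) Z' (VectorField.mlieBracket 𝓘(ℝ, E) Z W) p) :=
    fun {Z Z'} hZ hZ' => by
      have sZW := hZ.mlieBracket sW
      rw [e, VectorField.mlieBracket_add_right, VectorField.mlieBracket_smul_right (sdf hZ) (sd sW),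
        VectorField.mlieBracket_smul_right sf (sd sZW)]
      · exact (sdf hZ).smul_section (sd sW)
      · exact sf.smul_section (sd sZW)
  have l1 := VectorField.leibniz_identity_mlieBracket_apply ((hX p).of_le h2) ((hY p).of_le h2)
    ((sfW p).of_le h2)
  have l2 := VectorField.leibniz_identity_mlieBracket_apply ((hX p).of_le h2) ((hY p).of_le h2)
    ((sW p).of_le h2)
  rw [e2 hX hY, e2 hY hX, e, l2] at l1
  simp only [Pi.add_apply, Pi.smul_apply'] at l1
  simp only [map_smul]
  rw [← sub_eq_zero] at l1 ⊢
  rw [← l1]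
  change _ • W p - _ • W p = _
  module

/-- Reduced to real functions by pairing with each `h`; a nonzero `h` also serves as the vector to
be cancelled. -/
theorem mvfderiv_comm (Φ : GroupLieAlgebra 𝓘(ℝ, E) G ≃L[ℝ] H) [FiniteDimensional ℝ E]
    {X Y : VField E G}
    (hX : IsSmoothField X) (hY : IsSmoothField Y) {u : G → H}
    (hu : ContMDiff 𝓘(ℝ, E) 𝓘(ℝ, H) ∞ u) (p : G) :
    mvfderiv 𝓘(ℝ, E) (fun q => mvfderiv 𝓘(ℝ, E) u q (Y q)) p (X p)
      = mvfderiv 𝓘(ℝ, E) (fun q => mvfderiv 𝓘(ℝ, E) u q (X q)) p (Y p)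
        + mvfderiv 𝓘(ℝ, E) u p (VectorField.mlieBracket 𝓘(ℝ, E) X Y p) := by
  refine ext_inner_left ℝ fun h => ?_
  rcases eq_or_ne h 0 with rfl | hh
  · simp
  have hf : ContMDiff 𝓘(ℝ, E) 𝓘(ℝ, ℝ) ∞ (fun q => innerSL ℝ h (u q)) :=
    (innerSL ℝ h).contDiff.contMDiff.comp hu
  have key := smul_left_injective ℝ hh (mvfderiv_comm_smul Φ hX hY hf p h)
  have sdu : ∀ {Z : VField E G}, IsSmoothField Z → ∀ {q}, MDifferentiableAt 𝓘(ℝ, E) 𝓘(ℝ, H)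
      (fun q => mvfderiv 𝓘(ℝ, E) u q (Z q)) q := fun {Z} hZ {q} =>
    (contMDiffAt_mvfderiv_apply hu (hZ q)).mdifferentiableAt (by simp)
  simp only [mvfderiv_clm_comp_apply (innerSL ℝ h) ((hu _).mdifferentiableAt (by simp)),
    mvfderiv_clm_comp_apply (innerSL ℝ h) (sdu hX), mvfderiv_clm_comp_apply (innerSL ℝ h) (sdu hY),
    ← map_add] at key
  exact key

/-- `Φ` identifies the Lie algebra of `G`, with its Hermitian structure, with the complex inner
product space `H`. -/
structure IsUnitaryModel (S : LieHermitian E G) (Φ : GroupLieAlgebra 𝓘(ℝ, E) G ≃L[ℝ] H) :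
    Prop where
  inner : ∀ v w : GroupLieAlgebra 𝓘(ℝ, E) G, S.g.inner 1 v w = ⟪Φ v, Φ w⟫_ℝ
  J : ∀ v : GroupLieAlgebra 𝓘(ℝ, E) G, Φ (S.J 1 v) = mulI H (Φ v)

variable {Φ} {S : LieHermitian E G} (hΦ : IsUnitaryModel S Φ)

namespace IsUnitaryModel
include hΦ

theorem inner_leftFrame (p : G) (x y : H) :
    S.g.inner p (leftFrame Φ p x) (leftFrame Φ p y) = ⟪x, y⟫_ℝ := by
  have h := S.g_left p 1 (Φ.symm x) (Φ.symm y)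
  rw [hΦ.inner, Φ.apply_symm_apply, Φ.apply_symm_apply] at h
  rw [← h]
  have key : ∀ q, q = p → ∀ v w : E, (S.g.inner q : E →L[ℝ] E →L[ℝ] ℝ) v w
      = (S.g.inner p : E →L[ℝ] E →L[ℝ] ℝ) v w := by
    rintro q rfl v w; rfl
  exact (key _ (mul_one p) _ _).symm

theorem inner_eq (p : G) (v w : TangentSpace 𝓘(ℝ, E) p) :
    S.g.inner p v w = ⟪leftCoframe Φ p v, leftCoframe Φ p w⟫_ℝ := by
  rw [← hΦ.inner_leftFrame p, leftFrame_leftCoframe, leftFrame_leftCoframe]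

theorem J_leftFrame (p : G) (x : H) : S.J p (leftFrame Φ p x) = leftFrame Φ p (mulI H x) := by
  have h := S.J_left p 1 (Φ.symm x)
  have h' := hΦ.J (Φ.symm x)
  rw [Φ.apply_symm_apply] at h'
  rw [leftFrame_apply Φ p (mulI H x), ← h', Φ.symm_apply_apply]
  have key : ∀ q, q = p → ∀ v : E, (S.J q : E → E) v = (S.J p : E → E) v := by
    rintro q rfl v; rfl
  exact (key _ (mul_one p) _).symm.trans h

theorem leftCoframe_J (p : G) (v : TangentSpace 𝓘(ℝ, E) p) :
    leftCoframe Φ p (S.J p v) = mulI H (leftCoframe Φ p v) := by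
  rw [← leftFrame_leftCoframe Φ p v, hΦ.J_leftFrame, leftCoframe_leftFrame, leftCoframe_leftFrame]

/-- It expresses the coframe through the metric and smooth fields, from which its smoothness
follows. -/
theorem leftCoframe_eq_sum [FiniteDimensional ℂ H] (p : G) (v : TangentSpace 𝓘(ℝ, E) p) :
    leftCoframe Φ p v = ∑ i, S.g.inner p v (leftFrame Φ p (stdOrthonormalBasis ℝ H i))
      • stdOrthonormalBasis ℝ H i := by
  conv_lhs => rw [← (stdOrthonormalBasis ℝ H).sum_repr' (leftCoframe Φ p v)]
  refine Finset.sum_congr rfl fun i _ => ?_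
  rw [hΦ.inner_eq, leftCoframe_leftFrame, real_inner_comm]

theorem contMDiffAt_leftCoframe [FiniteDimensional ℂ H] {X : VField E G} {n : ℕ∞ω} (hn : n ≤ ∞)
    {p : G} (hX : ContMDiffAt 𝓘(ℝ, E) 𝓘(ℝ, E).tangent n
      (fun p => (⟨p, X p⟩ : TangentBundle 𝓘(ℝ, E) G)) p) :
    ContMDiffAt 𝓘(ℝ, E) 𝓘(ℝ, H) n (fun q => leftCoframe Φ q (X q)) p := by
  simp only [hΦ.leftCoframe_eq_sum]
  refine ContMDiffAt.sum fun i _ => ?_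
  exact (contMDiffAt_metric S.toHermitianStructure hn hX
    ((isSmoothField_leftFrame Φ _ p).of_le hn)).smul contMDiffAt_const

theorem mdifferentiableAt_leftCoframe [FiniteDimensional ℂ H] {X : VField E G}
    {p : G} (hX : MDifferentiableAt 𝓘(ℝ, E) 𝓘(ℝ, E).tangent
      (fun p => (⟨p, X p⟩ : TangentBundle 𝓘(ℝ, E) G)) p) :
    MDifferentiableAt 𝓘(ℝ, E) 𝓘(ℝ, H) (fun q => leftCoframe Φ q (X q)) p := by
  simp only [hΦ.leftCoframe_eq_sum]
  have h : ∀ i ∈ Finset.univ, MDifferentiableAt 𝓘(ℝ, E) 𝓘(ℝ, H) (fun q => S.g.inner q (X q)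
      (leftFrame Φ q (stdOrthonormalBasis ℝ H i)) • stdOrthonormalBasis ℝ H i) p := fun i _ =>
    (mdifferentiableAt_metric S.toHermitianStructure hX
      ((isSmoothField_leftFrame Φ _ p).mdifferentiableAt (by simp))).smul mdifferentiableAt_const
  convert MDifferentiableAt.sum h
  simp

omit hΦ in
theorem contMDiffAt_leftFrame [FiniteDimensional ℂ H] {u : G → H} {n : ℕ∞ω} (hn : n ≤ ∞)
    {p : G} (hu : ContMDiffAt 𝓘(ℝ, E) 𝓘(ℝ, H) n u p) :
    ContMDiffAt 𝓘(ℝ, E) 𝓘(ℝ, E).tangent n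
      (fun q => (⟨q, leftFrame Φ q (u q)⟩ : TangentBundle 𝓘(ℝ, E) G)) p := by
  have h : ∀ q, leftFrame Φ q (u q) = ∑ i, ⟪stdOrthonormalBasis ℝ H i, u q⟫_ℝ
      • leftFrame Φ q (stdOrthonormalBasis ℝ H i) := fun q => by
    conv_lhs => rw [← (stdOrthonormalBasis ℝ H).sum_repr' (u q)]
    rw [map_sum]
    simp only [map_smul]
  simp only [h]
  refine ContMDiffAt.sum_section (t := fun i q => ⟪stdOrthonormalBasis ℝ H i, u q⟫_ℝ
      • leftFrame Φ q (stdOrthonormalBasis ℝ H i)) fun i _ => ?_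
  exact ContMDiffAt.smul_section (s := fun q => leftFrame Φ q (stdOrthonormalBasis ℝ H i))
    (((innerSL ℝ (stdOrthonormalBasis ℝ H i)).contDiff.contMDiff.contMDiffAt).comp p hu)
    ((isSmoothField_leftFrame Φ _ p).of_le hn)

/-- This is the Maurer-Cartan equation. The bracket minus the derivative terms is tensorial in `X`
and `Y`, so both may be replaced by the left invariant fields with the same values at `p`. -/
theorem leftCoframe_mlieBracket [FiniteDimensional ℂ H] [FiniteDimensional ℝ E] {X Y : VField E G}
    {p : G} (hX : MDifferentiableAt 𝓘(ℝ, E) 𝓘(ℝ, E).tangent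
      (fun p => (⟨p, X p⟩ : TangentBundle 𝓘(ℝ, E) G)) p)
    (hY : MDifferentiableAt 𝓘(ℝ, E) 𝓘(ℝ, E).tangent
      (fun p => (⟨p, Y p⟩ : TangentBundle 𝓘(ℝ, E) G)) p) :
    leftCoframe Φ p (VectorField.mlieBracket 𝓘(ℝ, E) X Y p)
      = mvfderiv 𝓘(ℝ, E) (fun q => leftCoframe Φ q (Y q)) p (X p)
        - mvfderiv 𝓘(ℝ, E) (fun q => leftCoframe Φ q (X q)) p (Y p)
        + modelBracket Φ (leftCoframe Φ p (X p)) (leftCoframe Φ p (Y p)) := by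
  have hc : ∀ {f : G → ℝ} {X : VField E G}, (fun q => leftCoframe Φ q ((f • X) q))
      = f • fun q => leftCoframe Φ q (X q) := fun {f X} => by
    ext q; simp
  have hc' : ∀ {X X' : VField E G}, (fun q => leftCoframe Φ q ((X + X') q))
      = (fun q => leftCoframe Φ q (X q)) + fun q => leftCoframe Φ q (X' q) := fun {X X'} => by
    ext q; simp
  have key := TensorialAt.pointwise₂ (I := 𝓘(ℝ, E)) (F := E) (F' := E) (x := p) (A := H)
    (Φ := fun X Y : VField E G => leftCoframe Φ p (VectorField.mlieBracket 𝓘(ℝ, E) X Y p)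
      - mvfderiv 𝓘(ℝ, E) (fun q => leftCoframe Φ q (Y q)) p (X p)
      + mvfderiv 𝓘(ℝ, E) (fun q => leftCoframe Φ q (X q)) p (Y p))
    (fun Y hY => ⟨fun {f X} hf hX => ?_, fun {X X'} hX hX' => ?_⟩)
    (fun X hX => ⟨fun {f Y} hf hY => ?_, fun {Y Y'} hY hY' => ?_⟩)
    hX ((isSmoothField_leftFrame Φ (leftCoframe Φ p (X p)) p).mdifferentiableAt (by simp))
    hY ((isSmoothField_leftFrame Φ (leftCoframe Φ p (Y p)) p).mdifferentiableAt (by simp))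
    (leftFrame_leftCoframe Φ p _).symm (leftFrame_leftCoframe Φ p _).symm
  · simp only [leftCoframe_leftFrame, mvfderiv_const, zero_apply, sub_zero,
      add_zero, mlieBracket_leftFrame] at key
    rw [← key]
    abel
  · rw [VectorField.mlieBracket_smul_left hf hX, hc,
      mvfderiv_smul hf (hΦ.mdifferentiableAt_leftCoframe hX)]
    simp only [map_add, map_smul, add_apply, smul_apply, Pi.smul_apply',
      ContinuousLinearMap.smulRight_apply]
    module
  · rw [VectorField.mlieBracket_add_left hX hX', hc', mvfderiv_add
      (hΦ.mdifferentiableAt_leftCoframe hX) (hΦ.mdifferentiableAt_leftCoframe hX')]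
    simp only [map_add, add_apply, Pi.add_apply]
    abel
  · rw [VectorField.mlieBracket_smul_right hf hY, hc,
      mvfderiv_smul hf (hΦ.mdifferentiableAt_leftCoframe hY)]
    simp only [map_add, map_smul, add_apply, smul_apply, Pi.smul_apply',
      ContinuousLinearMap.smulRight_apply]
    module
  · rw [VectorField.mlieBracket_add_right hY hY', hc', mvfderiv_add
      (hΦ.mdifferentiableAt_leftCoframe hY) (hΦ.mdifferentiableAt_leftCoframe hY')]
    simp only [map_add, add_apply, Pi.add_apply]
    abel

/-- A left invariant form `v ↦ L (leftCoframe v)` has the exterior derivative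
`(X, Y) ↦ -L [X, Y]`. -/
theorem extDer_eq [FiniteDimensional ℂ H] [FiniteDimensional ℝ E] (L : H →L[ℝ] ℂ)
    {X Y : VField E G} (hX : IsSmoothField X) (hY : IsSmoothField Y) (p : G) :
    COneForm.extDer (fun q => L ∘L leftCoframe Φ q) X Y p
      = -L (modelBracket Φ (leftCoframe Φ p (X p)) (leftCoframe Φ p (Y p))) := by
  have hX' := (hX p).mdifferentiableAt (by simp)
  have hY' := (hY p).mdifferentiableAt (by simp)
  simp only [COneForm.extDer, ContinuousLinearMap.comp_apply]
  rw [hΦ.leftCoframe_mlieBracket hX' hY',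
    mvfderiv_clm_comp_apply L (hΦ.mdifferentiableAt_leftCoframe hX'),
    mvfderiv_clm_comp_apply L (hΦ.mdifferentiableAt_leftCoframe hY')]
  simp only [map_add, map_sub]
  abel

end IsUnitaryModel
end UnitaryModel

/-! ### Smooth endomorphism fields -/

section EndomorphismField

variable {E : Type*} [NormedAddCommGroup E] [NormedSpace ℝ E] [FiniteDimensional ℝ E]
  {M : Type*} [TopologicalSpace M] [ChartedSpace E M]

theorem contMDiffAt_clm_of_apply {F : Type*} [NormedAddCommGroup F] [NormedSpace ℝ F]
    {n : ℕ∞ω} {f : M → E →L[ℝ] F} {p : M}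
    (hf : ∀ i, ContMDiffAt 𝓘(ℝ, E) 𝓘(ℝ, F) n (fun q => f q (Module.finBasis ℝ E i)) p) :
    ContMDiffAt 𝓘(ℝ, E) 𝓘(ℝ, E →L[ℝ] F) n f p := by
  set b := Module.finBasis ℝ E
  have h : f = fun q => ∑ i, ContinuousLinearMap.smulRightL ℝ E F
      (LinearMap.toContinuousLinearMap (b.coord i)) (f q (b i)) := by
    ext q v
    have hv : f q v = f q (∑ i, b.repr v i • b i) := by rw [b.sum_repr]
    rw [hv, map_sum]
    simp
  rw [h]
  refine ContMDiffAt.sum fun i _ => ?_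
  exact (ContinuousLinearMap.smulRightL ℝ E F
    (LinearMap.toContinuousLinearMap (b.coord i))).contDiff.contMDiff.contMDiffAt.comp p (hf i)

/-- In a trivialization the endomorphism is determined by its values on the finite local frame, so
smoothness is tested there. -/
theorem contMDiffAt_endomorphism_of_apply [IsManifold 𝓘(ℝ, E) ∞ M]
    (A : (p : M) → TangentSpace 𝓘(ℝ, E) p →L[ℝ] TangentSpace 𝓘(ℝ, E) p) (p : M)
    (hA : ∀ X : VField E M, ContMDiffAt 𝓘(ℝ, E) 𝓘(ℝ, E).tangent ∞
        (fun p => (⟨p, X p⟩ : TangentBundle 𝓘(ℝ, E) M)) p →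
      ContMDiffAt 𝓘(ℝ, E) 𝓘(ℝ, E).tangent ∞
        (fun p => (⟨p, A p (X p)⟩ : TangentBundle 𝓘(ℝ, E) M)) p) :
    ContMDiffAt 𝓘(ℝ, E) (𝓘(ℝ, E).prod 𝓘(ℝ, E →L[ℝ] E)) ∞
      (fun p => (⟨p, A p⟩ : TotalSpace (E →L[ℝ] E)
        fun p : M => TangentSpace 𝓘(ℝ, E) p →L[ℝ] TangentSpace 𝓘(ℝ, E) p)) p := by
  rw [contMDiffAt_hom_bundle]
  refine ⟨contMDiffAt_id, contMDiffAt_clm_of_apply fun i => ?_⟩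
  set e := trivializationAt E (TangentSpace 𝓘(ℝ, E) (M := M)) p
  have hp : p ∈ e.baseSet := mem_baseSet_trivializationAt E _ p
  have h := hA _ (contMDiffAt_localFrame_of_mem (I := 𝓘(ℝ, E)) ∞ e (Module.finBasis ℝ E) i hp)
  rw [contMDiffAt_section] at h
  refine h.congr_of_eventuallyEq ?_
  filter_upwards [e.open_baseSet.mem_nhds hp] with q hq
  rw [e.localFrame_apply_of_mem_baseSet _ hq]
  simp only [ContinuousLinearMap.inCoordinates, ContinuousLinearMap.comp_apply]
  rw [Trivialization.continuousLinearMapAt_apply, Trivialization.coe_linearMapAt_of_mem _ hq]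
  rw [Trivialization.basisAt, Module.Basis.map_apply,
    Trivialization.symmL_apply]
  · rfl
  · exact hq

end EndomorphismField

/-! ### Left invariant connections, their torsion and curvature -/

section LeftConnection

attribute [local instance] InnerProductSpace.complexToReal

variable {E : Type*} [NormedAddCommGroup E] [NormedSpace ℝ E]
  {G : Type*} [TopologicalSpace G] [ChartedSpace E G]

theorem mvfderiv_bilinear_apply {F F' F'' : Type*} [NormedAddCommGroup F] [NormedSpace ℝ F]
    [NormedAddCommGroup F'] [NormedSpace ℝ F'] [NormedAddCommGroup F''] [NormedSpace ℝ F'']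
    (B : F →L[ℝ] F' →L[ℝ] F'') {u : G → F} {w : G → F'} {p : G}
    (hu : MDifferentiableAt 𝓘(ℝ, E) 𝓘(ℝ, F) u p) (hw : MDifferentiableAt 𝓘(ℝ, E) 𝓘(ℝ, F') w p)
    (v : TangentSpace 𝓘(ℝ, E) p) :
    mvfderiv 𝓘(ℝ, E) (fun q => B (u q) (w q)) p v
      = B (mvfderiv 𝓘(ℝ, E) u p v) (w p) + B (u p) (mvfderiv 𝓘(ℝ, E) w p v) := by
  have huw : HasMFDerivAt 𝓘(ℝ, E) 𝓘(ℝ, F × F') (fun q => (u q, w q)) p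
      ((mvfderiv 𝓘(ℝ, E) u p).prod (mvfderiv 𝓘(ℝ, E) w p)) :=
    ⟨hu.continuousAt.prodMk hw.continuousAt,
      hu.hasMFDerivAt.2.prodMk hw.hasMFDerivAt.2⟩
  have h := (B.isBoundedBilinearMap.hasFDerivAt (u p, w p)).hasMFDerivAt.comp (f := fun q => (u q, w q)) p huw
  have h' := h.mfderiv
  rw [add_comm]
  exact congr($h' v)

theorem contMDiffAt_bilinear {H : Type*} [NormedAddCommGroup H] [InnerProductSpace ℂ H]
    [FiniteDimensional ℂ H] (B : H →ₗ[ℝ] H →ₗ[ℝ] H) {u w : G → H} {p : G}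
    (hu : ContMDiffAt 𝓘(ℝ, E) 𝓘(ℝ, H) ∞ u p) (hw : ContMDiffAt 𝓘(ℝ, E) 𝓘(ℝ, H) ∞ w p) :
    ContMDiffAt 𝓘(ℝ, E) 𝓘(ℝ, H) ∞ (fun q => B (u q) (w q)) p :=
  (B.toContinuousBilinearMap.contDiff.contMDiff.contMDiffAt.comp p hu).clm_apply hw

variable [Group G] [LieGroup 𝓘(ℝ, E) ∞ G]
  {H : Type*} [NormedAddCommGroup H] [InnerProductSpace ℂ H] [FiniteDimensional ℂ H]
  {Φ : GroupLieAlgebra 𝓘(ℝ, E) G ≃L[ℝ] H} {S : LieHermitian E G}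

namespace IsUnitaryModel

/-- The left invariant connection on `G` which is given on the left invariant frame by the bilinear
map `nab`. -/
noncomputable def leftConnection (hΦ : IsUnitaryModel S Φ) (nab : H →ₗ[ℝ] H →ₗ[ℝ] H) :
    AffineConnection E G where
  toFun Y p := leftFrame Φ p ∘L (mvfderiv 𝓘(ℝ, E) (fun q => leftCoframe Φ q (Y q)) p
    + (LinearMap.toContinuousLinearMap (nab.flip (leftCoframe Φ p (Y p)))) ∘L leftCoframe Φ p)
  isCovariantDerivativeOnUniv := by
    refine ⟨fun {Y Y' p} hY hY' _ => ?_, fun {Y f p} hY hf _ => ?_⟩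
    · have hc : (fun q => leftCoframe Φ q ((Y + Y') q))
          = (fun q => leftCoframe Φ q (Y q)) + fun q => leftCoframe Φ q (Y' q) := by
        ext q; simp
      rw [hc, mvfderiv_add (hΦ.mdifferentiableAt_leftCoframe hY)
        (hΦ.mdifferentiableAt_leftCoframe hY')]
      ext v
      simp only [ContinuousLinearMap.comp_apply, add_apply, Pi.add_apply, map_add]
      simp
      abel
    · have hc : (fun q => leftCoframe Φ q ((f • Y) q)) = f • fun q => leftCoframe Φ q (Y q) := by
        ext q; simp
      rw [hc, mvfderiv_smul hf (hΦ.mdifferentiableAt_leftCoframe hY)]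
      ext v
      simp only [ContinuousLinearMap.comp_apply, add_apply, smul_apply, Pi.smul_apply', map_smul,
        map_add, ContinuousLinearMap.smulRight_apply, leftFrame_leftCoframe]
      simp
      abel

variable (hΦ : IsUnitaryModel S Φ) {nab : H →ₗ[ℝ] H →ₗ[ℝ] H}
include hΦ

theorem leftCoframe_leftConnection (X Y : VField E G) (p : G) :
    leftCoframe Φ p ((hΦ.leftConnection nab).cov X Y p)
      = mvfderiv 𝓘(ℝ, E) (fun q => leftCoframe Φ q (Y q)) p (X p)
        + nab (leftCoframe Φ p (X p)) (leftCoframe Φ p (Y p)) := by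
  change leftCoframe Φ p (leftFrame Φ p _) = _
  rw [leftCoframe_leftFrame]
  rfl

theorem contMDiff_leftCoframe {X : VField E G} (hX : IsSmoothField X) :
    ContMDiff 𝓘(ℝ, E) 𝓘(ℝ, H) ∞ (fun q => leftCoframe Φ q (X q)) :=
  fun p => hΦ.contMDiffAt_leftCoframe le_rfl (hX p)

theorem contMDiffAt_leftConnection {X Y : VField E G} (hY : IsSmoothField Y) {p : G}
    (hX : ContMDiffAt 𝓘(ℝ, E) 𝓘(ℝ, E).tangent ∞
      (fun p => (⟨p, X p⟩ : TangentBundle 𝓘(ℝ, E) G)) p) :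
    ContMDiffAt 𝓘(ℝ, E) 𝓘(ℝ, E).tangent ∞
      (fun p => (⟨p, (hΦ.leftConnection nab).cov X Y p⟩ : TangentBundle 𝓘(ℝ, E) G)) p :=
  contMDiffAt_leftFrame le_rfl ((contMDiffAt_mvfderiv_apply (hΦ.contMDiff_leftCoframe hY) hX).add
    (contMDiffAt_bilinear nab (hΦ.contMDiffAt_leftCoframe le_rfl hX)
      (hΦ.contMDiff_leftCoframe hY p)))

theorem leftCoframe_tor [FiniteDimensional ℝ E] {X Y : VField E G} (hX : IsSmoothField X)
    (hY : IsSmoothField Y) (p : G) :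
    leftCoframe Φ p ((hΦ.leftConnection nab).tor X Y p)
      = algTor (modelBracket Φ) nab (leftCoframe Φ p (X p)) (leftCoframe Φ p (Y p)) := by
  rw [AffineConnection.tor, map_sub, map_sub, hΦ.leftCoframe_leftConnection,
    hΦ.leftCoframe_leftConnection, hΦ.leftCoframe_mlieBracket
      ((hX p).mdifferentiableAt (by simp)) ((hY p).mdifferentiableAt (by simp)),
    IsKahlerLikeAlgebra.algTor_apply]
  abel

theorem leftCoframe_cov_cov {X Y Z : VField E G} (hY : IsSmoothField Y)
    (hZ : IsSmoothField Z) (p : G) :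
    leftCoframe Φ p ((hΦ.leftConnection nab).cov X ((hΦ.leftConnection nab).cov Y Z) p)
      = mvfderiv 𝓘(ℝ, E) (fun q => mvfderiv 𝓘(ℝ, E) (fun q => leftCoframe Φ q (Z q)) q (Y q)) p
          (X p)
        + (nab (mvfderiv 𝓘(ℝ, E) (fun q => leftCoframe Φ q (Y q)) p (X p)) (leftCoframe Φ p (Z p))
        + nab (leftCoframe Φ p (Y p)) (mvfderiv 𝓘(ℝ, E) (fun q => leftCoframe Φ q (Z q)) p (X p)))
        + nab (leftCoframe Φ p (X p))
          (mvfderiv 𝓘(ℝ, E) (fun q => leftCoframe Φ q (Z q)) p (Y p)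
            + nab (leftCoframe Φ p (Y p)) (leftCoframe Φ p (Z p))) := by
  have hcY := hΦ.contMDiff_leftCoframe hY
  have hcZ := hΦ.contMDiff_leftCoframe hZ
  have key : (fun q => leftCoframe Φ q ((hΦ.leftConnection nab).cov Y Z q))
      = (fun q => mvfderiv 𝓘(ℝ, E) (fun q => leftCoframe Φ q (Z q)) q (Y q))
        + fun q => nab.toContinuousBilinearMap (leftCoframe Φ q (Y q)) (leftCoframe Φ q (Z q)) := by
    ext q
    exact hΦ.leftCoframe_leftConnection Y Z q
  have hB : MDifferentiableAt 𝓘(ℝ, E) 𝓘(ℝ, H) (fun q => nab.toContinuousBilinearMap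
      (leftCoframe Φ q (Y q)) (leftCoframe Φ q (Z q))) p :=
    (contMDiffAt_bilinear nab (hcY p) (hcZ p)).mdifferentiableAt (by simp)
  rw [hΦ.leftCoframe_leftConnection, hΦ.leftCoframe_leftConnection, key, mvfderiv_add
    ((contMDiffAt_mvfderiv_apply hcZ (hY p)).mdifferentiableAt (by simp)) hB, add_apply,
    mvfderiv_bilinear_apply _ ((hcY p).mdifferentiableAt (by simp))
      ((hcZ p).mdifferentiableAt (by simp))]
  rfl

/-- All derivatives of the components of `X`, `Y`, `Z` cancel: second derivatives by
`mvfderiv_comm`, first ones by the Maurer-Cartan equation. -/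
theorem leftCoframe_curv [FiniteDimensional ℝ E] {X Y Z : VField E G} (hX : IsSmoothField X)
    (hY : IsSmoothField Y) (hZ : IsSmoothField Z) (p : G) :
    leftCoframe Φ p ((hΦ.leftConnection nab).curv X Y Z p)
      = algCurv (modelBracket Φ) nab (leftCoframe Φ p (X p)) (leftCoframe Φ p (Y p))
        (leftCoframe Φ p (Z p)) := by
  rw [AffineConnection.curv, map_sub, map_sub, hΦ.leftCoframe_cov_cov hY hZ,
    hΦ.leftCoframe_cov_cov hX hZ, hΦ.leftCoframe_leftConnection, hΦ.leftCoframe_mlieBracket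
      ((hX p).mdifferentiableAt (by simp)) ((hY p).mdifferentiableAt (by simp)),
    mvfderiv_comm Φ hX hY (hΦ.contMDiff_leftCoframe hZ), IsKahlerLikeAlgebra.algCurv_apply]
  simp only [map_add, map_sub, LinearMap.add_apply, LinearMap.sub_apply]
  abel

theorem isStrominger_leftConnection [FiniteDimensional ℝ E] (metric : ∀ x, IsSkewOp (nab x))
    (parallel : ∀ x y, nab x (mulI H y) = mulI H (nab x y))
    (torsion : ∀ x, IsSkewOp (algTor (modelBracket Φ) nab x)) :
    S.IsStrominger (hΦ.leftConnection nab) where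
  smooth := ⟨⟨fun {Y} hY p _ => (contMDiffAt_endomorphism_of_apply _ p fun X hX =>
    hΦ.contMDiffAt_leftConnection (contMDiffOn_univ.1 hY) hX).contMDiffWithinAt⟩⟩
  metric X Y Z hX hY hZ p := by
    have e : (fun q => S.g.inner q (Y q) (Z q))
        = fun q => innerSL ℝ (leftCoframe Φ q (Y q)) (leftCoframe Φ q (Z q)) := by
      ext q
      exact hΦ.inner_eq q _ _
    rw [e, mvfderiv_bilinear_apply _
      ((hΦ.contMDiff_leftCoframe hY p).mdifferentiableAt (by simp))
      ((hΦ.contMDiff_leftCoframe hZ p).mdifferentiableAt (by simp)), hΦ.inner_eq, hΦ.inner_eq,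
      hΦ.leftCoframe_leftConnection, hΦ.leftCoframe_leftConnection, inner_add_left, inner_add_right,
      metric]
    change ⟪(_ : H), _⟫_ℝ + ⟪(_ : H), _⟫_ℝ = _
    ring
  parallel_J X Y hX hY p := by
    apply leftCoframe_injective Φ p
    have e : (fun q => leftCoframe Φ q (S.J q (Y q)))
        = fun q => LinearMap.toContinuousLinearMap (mulI H) (leftCoframe Φ q (Y q)) := by
      ext q
      exact hΦ.leftCoframe_J q _
    rw [hΦ.leftCoframe_J, hΦ.leftCoframe_leftConnection, hΦ.leftCoframe_leftConnection, e,
      mvfderiv_clm_comp_apply _ ((hΦ.contMDiff_leftCoframe hY p).mdifferentiableAt (by simp)),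
      map_add, hΦ.leftCoframe_J, parallel]
    rfl
  skew_torsion X Y Z hX hY hZ p := by
    rw [hΦ.inner_eq, hΦ.inner_eq, hΦ.leftCoframe_tor hX hY, hΦ.leftCoframe_tor hX hZ, torsion,
      real_inner_comm]

theorem isStromingerKahlerLike [FiniteDimensional ℝ E] (metric : ∀ x, IsSkewOp (nab x))
    (parallel : ∀ x y, nab x (mulI H y) = mulI H (nab x y))
    (torsion : ∀ x, IsSkewOp (algTor (modelBracket Φ) nab x))
    (bianchi : ∀ x y z, algCurv (modelBracket Φ) nab x y z + algCurv (modelBracket Φ) nab y z x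
      + algCurv (modelBracket Φ) nab z x y = 0) :
    S.IsStromingerKahlerLike := by
  refine ⟨hΦ.leftConnection nab, hΦ.isStrominger_leftConnection metric parallel torsion,
    fun X Y Z W hX hY hZ hW p => ⟨?_, ?_⟩⟩
  · simp only [HermitianStructure.curv, hΦ.inner_eq, hΦ.leftCoframe_curv hX hY hZ,
      hΦ.leftCoframe_curv hY hZ hX, hΦ.leftCoframe_curv hZ hX hY]
    rw [← inner_add_left, ← inner_add_left, bianchi, inner_zero_left]
  · simp only [HermitianStructure.curv, hΦ.inner_eq, hΦ.leftCoframe_curv hX hY hZ,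
      hΦ.leftCoframe_curv hX hY (S.J_smooth Z hZ), hΦ.leftCoframe_J,
      IsKahlerLikeAlgebra.algCurv_apply, parallel, ← map_sub, inner_mulI_mulI]

end IsUnitaryModel

end LeftConnection

/-! ### The Strominger connection of a Lie-Hermitian manifold is left invariant -/

section StromingerLeftInvariant

attribute [local instance] InnerProductSpace.complexToReal

/-- A Hermitian product with totally skew torsion is determined by the bracket. -/
theorem hermitianProduct_unique {H : Type*} [NormedAddCommGroup H] [InnerProductSpace ℂ H]
    {br nab nab' : H →ₗ[ℝ] H →ₗ[ℝ] H}
    (metric : ∀ x, IsSkewOp (nab x)) (metric' : ∀ x, IsSkewOp (nab' x))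
    (parallel : ∀ x y, nab x (mulI H y) = mulI H (nab x y))
    (parallel' : ∀ x y, nab' x (mulI H y) = mulI H (nab' x y))
    (torsion : ∀ x, IsSkewOp (algTor br nab x)) (torsion' : ∀ x, IsSkewOp (algTor br nab' x)) :
    nab = nab' := by
  set d : H →ₗ[ℝ] H →ₗ[ℝ] H := nab - nab' with hd
  have dm : ∀ x y z, ⟪d x y, z⟫_ℝ = -⟪y, d x z⟫_ℝ := fun x => (metric x).sub (metric' x)
  have dJ : ∀ x y, d x (mulI H y) = mulI H (d x y) := fun x y => by
    simp only [hd, LinearMap.sub_apply, parallel, parallel', map_sub]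
  have dt : ∀ x y z, ⟪d x y - d y x, z⟫_ℝ = -⟪y, d x z - d z x⟫_ℝ := fun x y z => by
    have h1 := torsion x y z
    have h2 := torsion' x y z
    simp only [IsKahlerLikeAlgebra.algTor_apply, inner_sub_left, inner_sub_right] at h1 h2
    simp only [hd, LinearMap.sub_apply, inner_sub_left, inner_sub_right]
    linarith
  -- Metric skewness cancels two of the terms in the torsion condition; what is left is antisymmetry
  -- in the first two arguments.
  have ds : ∀ x y, d x y = -d y x := fun x y => by
    refine ext_inner_right ℝ fun z => ?_
    have h1 := dt z x y
    simp only [inner_sub_left, inner_sub_right] at h1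
    have h2 := dm z x y
    have h3 := dm x z y
    have h4 := dm y x z
    rw [inner_neg_left]
    have h5 := real_inner_comm x (d y z)
    have h6 := real_inner_comm z (d x y)
    linarith
  have dJl : ∀ x y, d (mulI H x) y = mulI H (d x y) := fun x y => by
    rw [ds, dJ, ds y x, map_neg, neg_neg]
  have cyc : ∀ x y z, ⟪d x y, z⟫_ℝ = ⟪d y z, x⟫_ℝ := fun x y z => by
    rw [ds x y, inner_neg_left, dm y x z, neg_neg, real_inner_comm]
  -- The totally skew form is complex linear in both arguments, so inserting `J` twice changes its
  -- sign; moving one `J` to the other side of the inner product shows that it does not.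
  have hz : ∀ x y z, ⟪d x y, z⟫_ℝ = 0 := fun x y z => by
    have h1 : ⟪d (mulI H x) (mulI H y), z⟫_ℝ = -⟪d x y, z⟫_ℝ := by
      rw [dJ, dJl, mulI_mulI, inner_neg_left]
    have h2 : ⟪d (mulI H x) (mulI H y), z⟫_ℝ = ⟪d x y, z⟫_ℝ := by
      rw [cyc, dJl, inner_mulI_mulI, ← cyc]
    linarith
  have h0 : d = 0 := by
    ext x y
    exact inner_self_eq_zero.1 (hz x y (d x y))
  exact sub_eq_zero.1 h0

variable {E : Type*} [NormedAddCommGroup E] [NormedSpace ℝ E]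
  {G : Type*} [TopologicalSpace G] [ChartedSpace E G] [Group G] [LieGroup 𝓘(ℝ, E) ∞ G]
  {H : Type*} [NormedAddCommGroup H] [InnerProductSpace ℂ H]

theorem foldr_modelBracket_eq_zero [CompleteSpace E] (Φ : GroupLieAlgebra 𝓘(ℝ, E) G ≃L[ℝ] H)
    (hnil : LieRing.IsNilpotent (GroupLieAlgebra 𝓘(ℝ, E) G)) :
    ∃ k, ∀ l : List H, l.length = k → ∀ y, l.foldr (fun a b => modelBracket Φ a b) y = 0 := by
  obtain ⟨k, hk⟩ := hnil.nilpotent_int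
  refine ⟨k, fun l hl y => ?_⟩
  have key : ∀ l : List H, Φ.symm (l.foldr (fun a b => modelBracket Φ a b) y)
      ∈ LieModule.lowerCentralSeries ℤ (GroupLieAlgebra 𝓘(ℝ, E) G)
        (GroupLieAlgebra 𝓘(ℝ, E) G) l.length := by
    intro l
    induction l with
    | nil => simp
    | cons a l ih =>
      rw [List.foldr_cons, List.length_cons, LieModule.lowerCentralSeries_succ, modelBracket,
        LinearMap.mk₂_apply, Φ.symm_apply_apply]
      exact LieSubmodule.lie_mem_lie (LieSubmodule.mem_top _) ih
  have h := key l
  rw [hl, hk, LieSubmodule.mem_bot] at h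
  exact (Φ.symm.map_eq_zero_iff).1 h

variable (Φ : GroupLieAlgebra 𝓘(ℝ, E) G ≃L[ℝ] H) (D : AffineConnection E G)

/-- The connection coefficients of `D` at `p` with respect to the left invariant frame. -/
noncomputable def leftCoefficients [FiniteDimensional ℝ E] (p : G) : H →ₗ[ℝ] H →ₗ[ℝ] H :=
  LinearMap.mk₂ ℝ (fun x y => leftCoframe Φ p (D.toFun (fun q => leftFrame Φ q y) p
    (leftFrame Φ p x)))
    (fun x x' y => by rw [map_add, map_add, map_add])
    (fun c x y => by rw [map_smul, map_smul, map_smul])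
    (fun x y y' => by
      have h : (fun q : G => leftFrame Φ q (y + y'))
          = (fun q => leftFrame Φ q y) + fun q => leftFrame Φ q y' := by
        ext q
        exact map_add (leftFrame Φ q) y y'
      rw [h, D.isCovariantDerivativeOnUniv.add
        ((isSmoothField_leftFrame Φ y p).mdifferentiableAt (by simp))
        ((isSmoothField_leftFrame Φ y' p).mdifferentiableAt (by simp)), add_apply, map_add])
    (fun c x y => by
      have h : (fun q : G => leftFrame Φ q (c • y))
          = (fun _ : G => c) • fun q => leftFrame Φ q y := by
        ext q
        exact map_smul (leftFrame Φ q) c y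
      rw [h, D.isCovariantDerivativeOnUniv.leibniz
        ((isSmoothField_leftFrame Φ y p).mdifferentiableAt (by simp)) mdifferentiableAt_const,
        mvfderiv_const]
      simp)

theorem cov_leftFrame [FiniteDimensional ℝ E] (p : G) (x y : H) :
    D.cov (fun q => leftFrame Φ q x) (fun q => leftFrame Φ q y) p
      = leftFrame Φ p (leftCoefficients Φ D p x y) :=
  (leftFrame_leftCoframe Φ p _).symm

variable {Φ D} {S : LieHermitian E G}

namespace IsUnitaryModel

/-- At every point the connection coefficients in the left invariant frame are a Hermitian product
with skew torsion for the same bracket. By uniqueness they are constant, so covariant derivatives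
and curvature of frame fields become algebraic. -/
theorem exists_isKahlerLikeAlgebra [FiniteDimensional ℝ E] (hΦ : IsUnitaryModel S Φ)
    (hS : S.IsStromingerKahlerLike) (hnil : LieRing.IsNilpotent (GroupLieAlgebra 𝓘(ℝ, E) G)) :
    ∃ nab, IsKahlerLikeAlgebra (modelBracket Φ) nab := by
  obtain ⟨D, hD, hK⟩ := hS
  have sm := fun x => isSmoothField_leftFrame (G := G) Φ x
  have eJ : ∀ x, (fun q => S.J q (leftFrame Φ q x)) = fun q => leftFrame Φ q (mulI H x) :=
    fun x => funext fun q => hΦ.J_leftFrame q x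
  have metric : ∀ p x, IsSkewOp (leftCoefficients Φ D p x) := fun p x y z => by
    have h := hD.metric _ _ _ (sm x) (sm y) (sm z) p
    simp only [hΦ.inner_leftFrame, cov_leftFrame, mvfderiv_const, zero_apply] at h
    linarith
  have parallel : ∀ p x y, leftCoefficients Φ D p x (mulI H y)
      = mulI H (leftCoefficients Φ D p x y) := fun p x y => by
    have h := hD.parallel_J _ _ (sm x) (sm y) p
    rw [eJ, cov_leftFrame, cov_leftFrame, hΦ.J_leftFrame] at h
    exact (Function.LeftInverse.injective (leftCoframe_leftFrame Φ p)) h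
  have tor : ∀ p x y, D.tor (fun q => leftFrame Φ q x) (fun q => leftFrame Φ q y) p
      = leftFrame Φ p (algTor (modelBracket Φ) (leftCoefficients Φ D p) x y) := fun p x y => by
    rw [AffineConnection.tor, cov_leftFrame, cov_leftFrame, mlieBracket_leftFrame,
      IsKahlerLikeAlgebra.algTor_apply, map_sub, map_sub]
  have torsion : ∀ p x, IsSkewOp (algTor (modelBracket Φ) (leftCoefficients Φ D p) x) :=
    fun p x y z => by
      have h := hD.skew_torsion _ _ _ (sm x) (sm y) (sm z) p
      rw [tor, tor, hΦ.inner_leftFrame, hΦ.inner_leftFrame] at h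
      rw [h, real_inner_comm]
  set nab := leftCoefficients Φ D 1
  have hnab : ∀ p, leftCoefficients Φ D p = nab := fun p =>
    hermitianProduct_unique (metric p) (metric 1) (parallel p) (parallel 1) (torsion p) (torsion 1)
  have cov : ∀ x y, D.cov (fun q => leftFrame Φ q x) (fun q => leftFrame Φ q y)
      = fun p => leftFrame Φ p (nab x y) := fun x y => funext fun p => by
    rw [cov_leftFrame, hnab]
  have curv : ∀ x y z p, D.curv (fun q => leftFrame Φ q x) (fun q => leftFrame Φ q y)
      (fun q => leftFrame Φ q z) p = leftFrame Φ p (algCurv (modelBracket Φ) nab x y z) :=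
    fun x y z p => by
      rw [AffineConnection.curv, mlieBracket_leftFrame, cov, cov, cov, cov, cov,
        IsKahlerLikeAlgebra.algCurv_apply, map_sub, map_sub]
  have skew : ∀ x y, modelBracket Φ x y = -modelBracket Φ y x := fun x y => by
    simp only [modelBracket, LinearMap.mk₂_apply]
    rw [← map_neg, lie_skew]
  refine ⟨nab, skew, fun x y z => ?_, foldr_modelBracket_eq_zero Φ hnil, fun x y => ?_, metric 1,
    parallel 1, torsion 1, fun x y z => ?_⟩
  · simp only [modelBracket, LinearMap.mk₂_apply, Φ.symm_apply_apply]
    rw [leibniz_lie, map_add]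
  · have h := S.J_integrable _ _ (sm x) (sm y) 1
    rw [eJ, eJ, mlieBracket_leftFrame, mlieBracket_leftFrame, mlieBracket_leftFrame,
      mlieBracket_leftFrame, hΦ.J_leftFrame, hΦ.J_leftFrame, ← map_sub, ← map_sub, ← map_sub] at h
    exact (Function.LeftInverse.injective (leftCoframe_leftFrame Φ 1)) (h.trans (map_zero _).symm)
  · refine ext_inner_right ℝ fun w => ?_
    have h := (hK _ _ _ _ (sm x) (sm y) (sm z) (sm w) 1).1
    simp only [HermitianStructure.curv, curv, hΦ.inner_leftFrame] at h
    rw [inner_add_left, inner_add_left, h, inner_zero_left]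

end IsUnitaryModel

end StromingerLeftInvariant

/-! ### Hermitian vector spaces and unitary coframes -/

section UnitaryCoframe

attribute [local instance] InnerProductSpace.complexToReal

theorem ofReal_im_conj_mul (x y : ℂ) :
    (((conj x * y).im : ℝ) : ℂ) = Complex.I / 2 * (x * conj y - y * conj x) := by
  apply Complex.ext <;> simp <;> ring

/-- A Euclidean vector space with orthogonal complex structure is isometric to `ℂⁿ`. -/
theorem exists_linearEquiv_euclideanSpace {V : Type*} [AddCommGroup V] [Module ℝ V]
    [FiniteDimensional ℝ V] {n : ℕ} (hn : Module.finrank ℝ V = 2 * n) (J : Module.End ℝ V)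
    (hJ : ∀ v, J (J v) = -v) (g : V →ₗ[ℝ] V →ₗ[ℝ] ℝ) (hg : ∀ v w, g v w = g w v)
    (hpos : ∀ v, v ≠ 0 → 0 < g v v) (hgJ : ∀ v w, g (J v) (J w) = g v w) :
    ∃ Ψ : V ≃ₗ[ℝ] EuclideanSpace ℂ (Fin n), (∀ v w, g v w = ⟪Ψ v, Ψ w⟫_ℝ) ∧
      ∀ v, Ψ (J v) = mulI _ (Ψ v) := by
  have hJ' : J * J = -1 := LinearMap.ext hJ
  let m : Module ℂ V := Module.compHom V (Complex.lift ⟨J, hJ'⟩ : ℂ →ₐ[ℝ] Module.End ℝ V).toRingHom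
  have hsmul : ∀ (c : ℂ) (v : V), c • v = c.re • v + c.im • J v := fun c v => by
    change (Complex.lift ⟨J, hJ'⟩ : ℂ →ₐ[ℝ] Module.End ℝ V) c v = _
    simp [Complex.lift_apply, Complex.liftAux_apply, Module.algebraMap_end_apply]
  have hgJ' : ∀ v w, g v (J w) = -g (J v) w := fun v w => by
    rw [← hgJ v, hJ, map_neg, neg_eq_iff_eq_neg, neg_neg]
  -- The inner product is conjugate linear on the left, so its imaginary part is `g (J v) w`.
  let core : InnerProductSpace.Core ℂ V :=
    { inner := fun v w => ⟨g v w, g (J v) w⟩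
      conj_inner_symm := fun v w => by
        apply Complex.ext
        · exact hg w v
        · simp only [Complex.conj_im]
          rw [hg (J w), hgJ', neg_neg]
      re_inner_nonneg := fun v => by
        rcases eq_or_ne v 0 with rfl | hv
        · simp
        · exact (hpos v hv).le
      definite := fun v hv => by
        by_contra h
        exact (hpos v h).ne' (congrArg Complex.re hv)
      add_left := fun u v w => by
        apply Complex.ext <;> simp
      smul_left := fun v w c => by
        apply Complex.ext
        · simp [hsmul]
        · simp [hsmul, hJ] }
  let _ : NormedAddCommGroup V := core.toNormedAddCommGroup
  let _ : InnerProductSpace ℂ V := InnerProductSpace.ofCore core.toCore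
  have : IsScalarTower ℝ ℂ V := ⟨fun r c v => by
    rw [hsmul, hsmul, smul_add, smul_smul, smul_smul]
    simp⟩
  have : FiniteDimensional ℂ V := Module.Finite.of_restrictScalars_finite ℝ ℂ V
  have hn' : Module.finrank ℂ V = n := by
    have := Module.finrank_mul_finrank ℝ ℂ V
    rw [Complex.finrank_real_complex, hn] at this
    omega
  let b : OrthonormalBasis (Fin n) ℂ V := (stdOrthonormalBasis ℂ V).reindex (finCongr hn')
  let Ψ : V ≃ₗ[ℝ] EuclideanSpace ℂ (Fin n) :=
    { b.repr.toLinearEquiv.toAddEquiv with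
      map_smul' := fun r v => by
        have h : r • v = (r : ℂ) • v := by rw [hsmul]; simp
        change b.repr (r • v) = r • b.repr v
        rw [h, map_smul]
        exact Complex.coe_smul r _ }
  refine ⟨Ψ, fun v w => ?_, fun v => ?_⟩
  · have h : (inner ℂ (b.repr v) (b.repr w) : ℂ) = inner ℂ v w := b.repr.inner_map_map v w
    change _ = (inner ℂ (b.repr v) (b.repr w) : ℂ).re
    rw [h]
    rfl
  · change b.repr (J v) = Complex.I • b.repr v
    rw [← map_smul, hsmul]
    simp

variable {n : ℕ} {G : Type*} [TopologicalSpace G]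
  [ChartedSpace (EuclideanSpace ℝ (Fin (2 * n))) G] [Group G]
  [LieGroup 𝓘(ℝ, EuclideanSpace ℝ (Fin (2 * n))) ∞ G]
  (S : LieHermitian (EuclideanSpace ℝ (Fin (2 * n))) G)

theorem exists_isUnitaryModel : ∃ Φ : GroupLieAlgebra 𝓘(ℝ, EuclideanSpace ℝ (Fin (2 * n))) G ≃L[ℝ]
    EuclideanSpace ℂ (Fin n), IsUnitaryModel S Φ := by
  have : FiniteDimensional ℝ (GroupLieAlgebra 𝓘(ℝ, EuclideanSpace ℝ (Fin (2 * n))) G) :=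
    inferInstanceAs (FiniteDimensional ℝ (EuclideanSpace ℝ (Fin (2 * n))))
  have : T2Space (GroupLieAlgebra 𝓘(ℝ, EuclideanSpace ℝ (Fin (2 * n))) G) :=
    inferInstanceAs (T2Space (EuclideanSpace ℝ (Fin (2 * n))))
  have hn : Module.finrank ℝ (GroupLieAlgebra 𝓘(ℝ, EuclideanSpace ℝ (Fin (2 * n))) G) = 2 * n :=
    finrank_euclideanSpace_fin
  obtain ⟨Ψ, h₁, h₂⟩ := exists_linearEquiv_euclideanSpace hn (S.J 1).toLinearMap (S.J_sq 1)
    (LinearMap.mk₂ ℝ (fun v w => S.g.inner 1 v w) (by simp) (by simp) (by simp) (by simp))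
    (S.g.symm 1) (S.g.pos 1) (S.compatible 1)
  exact ⟨Ψ.toContinuousLinearEquiv, h₁, h₂⟩

variable {S}

theorem exists_coframe_isNormalForm (hn₂ : 2 ≤ n) (hn₆ : n ≤ 6)
    (hnil : LieRing.IsNilpotent (GroupLieAlgebra 𝓘(ℝ, EuclideanSpace ℝ (Fin (2 * n))) G))
    (hS : S.IsStromingerKahlerLike) :
    ∃ (φ : Fin n → COneForm (EuclideanSpace ℝ (Fin (2 * n))) G) (A : Matrix (Fin n) (Fin n) ℂ),
      S.IsLeftInvariantUnitaryCoframe φ ∧ COneForm.StructureEquations φ A ∧ IsNormalForm n A := by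
  obtain ⟨Φ, hΦ⟩ := exists_isUnitaryModel S
  obtain ⟨nab, hnab⟩ := hΦ.exists_isKahlerLikeAlgebra hS hnil
  obtain ⟨b, hbr, hO, hZ⟩ : ∃ b : OrthonormalBasis (Fin n) ℂ (EuclideanSpace ℂ (Fin n)),
      (∀ x y, modelBracket Φ x y = ∑ i, (conj (inner ℂ (b i) x) * inner ℂ (b i) y).im
        • modelBracket Φ (b i) (mulI _ (b i))) ∧
      (∀ i j, i ≠ j → ⟪modelBracket Φ (b i) (mulI _ (b i)),
        modelBracket Φ (b j) (mulI _ (b j))⟫_ℝ = 0) ∧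
      (∀ i j, modelBracket Φ (b i) (mulI _ (b i)) ≠ 0 →
        inner ℂ (b i) (modelBracket Φ (b j) (mulI _ (b j))) = 0) := by
    have h := hnab.exists_basis
    rwa [finrank_euclideanSpace_fin] at h
  set c : Fin n → EuclideanSpace ℂ (Fin n) := fun i => modelBracket Φ (b i) (mulI _ (b i)) with hc
  -- The convention `g = ∑ (φ ⊗ φ̄ + φ̄ ⊗ φ)` requires `φ_i = ⟨b_i, ·⟩ / √2`.
  set s : ℂ := ((1 / √2 : ℝ) : ℂ) with hs
  have hss : s * s = 1 / 2 := by
    rw [hs, ← Complex.ofReal_mul, one_div_mul_one_div, Real.mul_self_sqrt (by norm_num)]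
    norm_num
  have hsc : conj s = s := Complex.conj_ofReal _
  -- Here `dφ_k = -φ_k ∘ [·, ·]`, and `Im(conj x * y) = (i / 2) (x ȳ - y x̄)` is `i` times `φ ∧ φ̄`.
  -- So the coefficients are the coordinates of `-i c / √2`.
  set K : Fin n → EuclideanSpace ℂ (Fin n) := fun i => (-Complex.I * s) • c i with hK
  have hK0 : ∀ i, K i ≠ 0 → c i ≠ 0 := fun i h h' => h (by simp only [hK, h', smul_zero])
  obtain ⟨b', σ, hb', hA⟩ := exists_isNormalForm hn₂ hn₆ b (K := K)
    (fun i j hij => by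
      have e : (inner ℂ (K i) (K j) : ℂ) = 1 / 2 * inner ℂ (c i) (c j) := by
        simp only [hK, inner_smul_left, inner_smul_right, map_mul, map_neg, Complex.conj_I, hsc]
        linear_combination (-Complex.I * Complex.I * inner ℂ (c i) (c j)) * hss
          - 1 / 2 * inner ℂ (c i) (c j) * Complex.I_mul_I
      have h := hO i j hij
      rw [← re_inner_complex] at h
      rw [e, show (1 / 2 : ℂ) = ((1 / 2 : ℝ) : ℂ) by norm_num, Complex.re_ofReal_mul, h, mul_zero])
    (fun i j h => by
      simp only [hK]
      rw [inner_smul_right, hZ i j (hK0 i h), mul_zero])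
  set L : Fin n → EuclideanSpace ℂ (Fin n) →L[ℝ] ℂ :=
    fun i => (s • innerSL ℂ (b' i)).restrictScalars ℝ with hL
  have hLa : ∀ i x, L i x = s * inner ℂ (b' i) x := fun i x => rfl
  refine ⟨fun i p => L i ∘L leftCoframe Φ p, _, ⟨fun i a p v => ?_, fun i p v => ?_, fun p v w => ?_⟩,
    fun k X Y hX hY p => ?_, hA⟩
  · rw [ContinuousLinearMap.comp_apply, ContinuousLinearMap.comp_apply]
    exact congrArg (L i) (leftCoframe_mul Φ a p v)
  · rw [ContinuousLinearMap.comp_apply, ContinuousLinearMap.comp_apply, hΦ.leftCoframe_J, hLa, hLa,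
      mulI_eq_smul, inner_smul_right]
    ring
  · rw [hΦ.inner_eq, real_inner_eq_sum b', Complex.ofReal_sum]
    refine Finset.sum_congr rfl fun i _ => ?_
    simp only [ContinuousLinearMap.comp_apply, hLa, map_mul, hsc]
    generalize (inner ℂ (b' i) (leftCoframe Φ p v) : ℂ) = x
    generalize (inner ℂ (b' i) (leftCoframe Φ p w) : ℂ) = y
    rw [Complex.re_eq_add_conj, map_mul, Complex.conj_conj]
    linear_combination (-x * conj y - conj x * y) * hss
  · rw [hΦ.extDer_eq _ hX hY, hbr, ← Equiv.sum_comp σ, map_sum, ← Finset.sum_neg_distrib]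
    refine Finset.sum_congr rfl fun i _ => ?_
    rw [map_smul, hLa, Matrix.of_apply]
    simp only [COneForm.wedgeConj, ContinuousLinearMap.comp_apply, hLa, map_mul, hsc]
    -- The new basis agrees with the old one only where the column is nonzero; the other terms
    -- vanish anyway.
    rcases eq_or_ne (K (σ i)) 0 with h0 | h0
    · have hc0 : c (σ i) = 0 := by
        have hs0 : s ≠ 0 := fun h => by simp [h] at hss
        exact (smul_eq_zero.1 h0).resolve_left (mul_ne_zero (neg_ne_zero.2 Complex.I_ne_zero) hs0)
      rw [h0]
      simp only [hc] at hc0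
      rw [hc0]
      simp
    · have e : modelBracket Φ (b (σ i)) (mulI _ (b (σ i))) = c (σ i) := rfl
      rw [e, ← hb' i h0]
      simp only [hK, inner_smul_right]
      generalize (inner ℂ (b' k) (c (σ i)) : ℂ) = t
      generalize (inner ℂ (b' i) (leftCoframe Φ p (X p)) : ℂ) = x
      generalize (inner ℂ (b' i) (leftCoframe Φ p (Y p)) : ℂ) = y
      rw [Complex.real_smul, ofReal_im_conj_mul]
      linear_combination (Complex.I * s * t * (x * conj y - y * conj x)) * hss

theorem isStromingerKahlerLike_of_coframe
    {φ : Fin n → COneForm (EuclideanSpace ℝ (Fin (2 * n))) G} {A : Matrix (Fin n) (Fin n) ℂ}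
    (hφ : S.IsLeftInvariantUnitaryCoframe φ) (hA : COneForm.StructureEquations φ A)
    (hnf : IsNormalForm n A) : S.IsStromingerKahlerLike := by
  have : FiniteDimensional ℝ (GroupLieAlgebra 𝓘(ℝ, EuclideanSpace ℝ (Fin (2 * n))) G) :=
    inferInstanceAs (FiniteDimensional ℝ (EuclideanSpace ℝ (Fin (2 * n))))
  have : T2Space (GroupLieAlgebra 𝓘(ℝ, EuclideanSpace ℝ (Fin (2 * n))) G) :=
    inferInstanceAs (T2Space (EuclideanSpace ℝ (Fin (2 * n))))
  have hn : Module.finrank ℝ (GroupLieAlgebra 𝓘(ℝ, EuclideanSpace ℝ (Fin (2 * n))) G) = 2 * n :=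
    finrank_euclideanSpace_fin
  have hn' : Module.finrank ℝ (EuclideanSpace ℂ (Fin n)) = 2 * n := by
    have := Module.finrank_mul_finrank ℝ ℂ (EuclideanSpace ℂ (Fin n))
    rw [Complex.finrank_real_complex, finrank_euclideanSpace_fin] at this
    exact this.symm
  set s : ℂ := ((√2 : ℝ) : ℂ) with hs
  have hss : s * s = 2 := by
    rw [hs, ← Complex.ofReal_mul, Real.mul_self_sqrt (by norm_num)]
    norm_num
  have hs0 : s ≠ 0 := fun h => by simp [h] at hss
  have hsc : conj s = s := Complex.conj_ofReal _
  let Ψ : GroupLieAlgebra 𝓘(ℝ, EuclideanSpace ℝ (Fin (2 * n))) G →ₗ[ℝ] EuclideanSpace ℂ (Fin n) :=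
    { toFun := fun v => WithLp.toLp 2 fun k => s * φ k 1 v
      map_add' := fun v w => by ext k; simp [mul_add]
      map_smul' := fun r v => by ext k; simp [mul_left_comm] }
  have hΨ : ∀ v k, Ψ v k = s * φ k 1 v := fun v k => rfl
  have hinner : ∀ v w, S.g.inner 1 v w = ⟪Ψ v, Ψ w⟫_ℝ := fun v w => by
    apply Complex.ofReal_injective
    rw [hφ.unitary, ← re_inner_complex, PiLp.inner_apply, Complex.re_sum, Complex.ofReal_sum]
    refine Finset.sum_congr rfl fun k _ => ?_
    rw [hΨ, hΨ, RCLike.inner_apply, Complex.re_eq_add_conj]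
    simp only [map_mul, hsc, Complex.conj_conj]
    linear_combination (-φ k 1 w * conj (φ k 1 v) / 2 - φ k 1 v * conj (φ k 1 w) / 2) * hss
  have hinj : Function.Injective Ψ := by
    rw [← LinearMap.ker_eq_bot, LinearMap.ker_eq_bot']
    intro v hv
    by_contra h0
    have h := S.g.pos 1 v h0
    rw [hinner, hv, inner_zero_left] at h
    exact h.false
  let Φ : GroupLieAlgebra 𝓘(ℝ, EuclideanSpace ℝ (Fin (2 * n))) G ≃L[ℝ] EuclideanSpace ℂ (Fin n) :=
    (LinearEquiv.ofInjectiveOfFinrankEq Ψ hinj (hn.trans hn'.symm)).toContinuousLinearEquiv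
  have hΦΨ : ∀ v, Φ v = Ψ v := fun v => rfl
  have hΦ : IsUnitaryModel S Φ := ⟨hinner, fun v => by
    ext k
    rw [hΦΨ, hΦΨ, hΨ, hφ.type_one_zero, mulI_eq_smul, PiLp.smul_apply, hΨ, smul_eq_mul]
    ring⟩
  have hlf : ∀ k p x, φ k p (leftFrame Φ p x) = s⁻¹ * x k := fun k p x => by
    have h := hφ.left_invariant k p 1 (Φ.symm x)
    have key : ∀ q, q = p → ∀ w : EuclideanSpace ℝ (Fin (2 * n)),
        (φ k q : EuclideanSpace ℝ (Fin (2 * n)) →L[ℝ] ℂ) w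
          = (φ k p : EuclideanSpace ℝ (Fin (2 * n)) →L[ℝ] ℂ) w := by
      rintro q rfl w; rfl
    have h' : φ k p (leftFrame Φ p x) = φ k 1 (Φ.symm x) := (key _ (mul_one p) _).symm.trans h
    have hx : s * φ k 1 (Φ.symm x) = x k := by
      rw [← hΨ, ← hΦΨ, Φ.apply_symm_apply]
    rw [h', ← hx, inv_mul_cancel_left₀ hs0]
  let L : Fin n → EuclideanSpace ℂ (Fin n) →L[ℝ] ℂ := fun k =>
    (s⁻¹ • EuclideanSpace.proj k : EuclideanSpace ℂ (Fin n) →L[ℂ] ℂ).restrictScalars ℝ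
  have hL : ∀ k, φ k = fun p => L k ∘L leftCoframe Φ p := fun k => by
    ext p v
    conv_lhs => rw [← leftFrame_leftCoframe Φ p v, hlf]
    rfl
  let b : OrthonormalBasis (Fin n) ℂ (EuclideanSpace ℂ (Fin n)) := EuclideanSpace.basisFun (Fin n) ℂ
  have hb : ∀ i (x : EuclideanSpace ℂ (Fin n)), (inner ℂ (b i) x : ℂ) = x i := fun i x => by
    simp [b, EuclideanSpace.inner_single_left]
  -- Inverse of the previous normalization: `A = -i c / √2` gives `c = i √2 A`, columnwise.
  let c : Fin n → EuclideanSpace ℂ (Fin n) := fun i => WithLp.toLp 2 fun k => s * Complex.I * A k i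
  have hc : ∀ i k, c i k = s * Complex.I * A k i := fun i k => rfl
  have hbr : ∀ x y, modelBracket Φ x y
      = ∑ i, (conj (inner ℂ (b i) x) * inner ℂ (b i) y).im • c i := fun x y => by
    ext k
    have h := hA k _ _ (isSmoothField_leftFrame Φ x) (isSmoothField_leftFrame Φ y) 1
    simp only [COneForm.wedgeConj, hlf] at h
    rw [hL, hΦ.extDer_eq _ (isSmoothField_leftFrame Φ x) (isSmoothField_leftFrame Φ y),
      leftCoframe_leftFrame, leftCoframe_leftFrame] at h
    have h' : -(s⁻¹ * modelBracket Φ x y k) = _ := h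
    have h'' : modelBracket Φ x y k = -s * -(s⁻¹ * modelBracket Φ x y k) := by
      field_simp
    rw [h'', h', Finset.mul_sum, WithLp.ofLp_sum, Finset.sum_apply]
    refine Finset.sum_congr rfl fun i _ => ?_
    rw [PiLp.smul_apply, Complex.real_smul, ofReal_im_conj_mul, hb, hb, hc]
    simp only [map_mul, map_inv₀, hsc]
    have hs2 : s⁻¹ * s⁻¹ = 1 / 2 := by rw [← mul_inv, hss, one_div]
    linear_combination (-s * A k i * (x i * conj (y i) - y i * conj (x i))) * hs2
      - 1 / 2 * (x i * conj (y i) - y i * conj (x i)) * (s * A k i) * Complex.I_mul_I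
  have hcO : ∀ i j, i ≠ j → ⟪c i, c j⟫_ℝ = 0 := fun i j hij => by
    rw [← re_inner_complex, PiLp.inner_apply, Complex.re_sum]
    have h := hnf.sum_re_eq_zero hij
    have e : ∀ k, ((inner ℂ (c i k) (c j k) : ℂ)).re = 2 * (conj (A k i) * A k j).re := fun k => by
      rw [hc, hc, RCLike.inner_apply]
      have e : s * Complex.I * A k j * conj (s * Complex.I * A k i)
          = (2 : ℝ) * (conj (A k i) * A k j) := by
        simp only [map_mul, hsc, Complex.conj_I, Complex.ofReal_ofNat]
        linear_combination (-Complex.I * Complex.I * A k j * conj (A k i)) * hss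
          - 2 * A k j * conj (A k i) * Complex.I_mul_I
      rw [e, Complex.re_ofReal_mul]
    rw [Finset.sum_congr rfl fun k _ => e k, ← Finset.mul_sum, h, mul_zero]
  exact hΦ.isStromingerKahlerLike (diagonalProduct_skew b c) (diagonalProduct_mulI b c)
    (algTor_diagonalProduct_skew hbr) (bianchi_diagonalProduct hbr hcO)

end UnitaryCoframe

theorem corollary1p2 (n : ℕ) (hn₂ : 2 ≤ n) (hn₆ : n ≤ 6)
    (G : Type*) [TopologicalSpace G] [ChartedSpace (EuclideanSpace ℝ (Fin (2 * n))) G] [Group G]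
    [LieGroup 𝓘(ℝ, EuclideanSpace ℝ (Fin (2 * n))) ∞ G]
    (hnil : LieRing.IsNilpotent (GroupLieAlgebra 𝓘(ℝ, EuclideanSpace ℝ (Fin (2 * n))) G))
    (S : LieHermitian (EuclideanSpace ℝ (Fin (2 * n))) G) :
    S.IsStromingerKahlerLike ↔
      ∃ (φ : Fin n → COneForm (EuclideanSpace ℝ (Fin (2 * n))) G) (A : Matrix (Fin n) (Fin n) ℂ),
        S.IsLeftInvariantUnitaryCoframe φ ∧ COneForm.StructureEquations φ A ∧
          IsNormalForm n A := by
  exact ⟨exists_coframe_isNormalForm hn₂ hn₆ hnil,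
    fun ⟨_, _, hφ, hA, hnf⟩ => isStromingerKahlerLike_of_coframe hφ hA hnf⟩
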